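/- Let $M$ be a smooth manifold. All vector bundles, bundle maps, sections and tensors are smooth and real, of finite rank. **Jacobi algebroids.** A Jacobi algebroid $(A,\phi)$ over $M$ is a Lie algebroid $(A,[\cdot,\cdot],\rho)$ with a $1$-cocycle $\phi\in\Gamma(A^*)$. Put $d^\phi\omega=d\omega+\phi\wedge\omega$ and $\mathcal L^\phi_X=i_Xd^\phi+d^\phi i_X$. A bivector $\pi\in\Gamma(\wedge^2A)$ has $\pi^\sharp:A^*\to A$ with $\pi(\alpha,\beta)=\langle\beta,\pi^\sharp\alpha\rangle$; it is a Jacobi bivector if $[\pi,\pi]^\phi=[\pi,\pi]+2\,\pi\wedge\pi^\sharp\phi=0$, where $[\cdot,\cdot]$ is the Schouten bracket of $A$. Put $$[\alpha,\beta]_\pi=\mathcal L^\phi_{\pi^\sharp\alpha}\beta-\mathcal L^\phi_{\pi^\sharp\beta}\alpha-d^\phi(\pi(\alpha,\beta)),\qquad \alpha,\beta\in\Gamma(A^*).$$ **Jacobi quasi-Nijenhuis algebroids.** $(A,\phi,\pi,N,\varphi)$ is a Jacobi quasi-Nijenhuis algebroid if $(A,\phi)$ is a Jacobi algebroid, $\pi$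 is a Jacobi bivector, $N:A\to A$ is a vector bundle map over the identity with $N\pi^\sharp=\pi^\sharp N^*$ and $$[\alpha,\beta]_{N\pi}=[N^*\alpha,\beta]_\pi+[\alpha,N^*\beta]_\pi-N^*[\alpha,\beta]_\pi ,$$ and $\varphi\in\Gamma(\wedge^3A^*)$ satisfies $d^\phi\varphi=0$, $d^\phi(i_N\varphi)=0$ and $$[NX,NY]-N[X,Y]_N=\pi^\sharp(\varphi(X,Y,\cdot)),\qquad X,Y\in\Gamma(A).$$ Here $[X,Y]_N=[NX,Y]+[X,NY]-N[X,Y]$, $(N\pi)^\sharp=N\pi^\sharp$, and $i_N\varphi(X,Y,Z)=\varphi(NX,Y,Z)+\varphi(X,NY,Z)+\varphi(X,Y,NZ)$. **Courant-Jacobi algebroids.** A Courant-Jacobi algebroid over $M$ is a vector bundle $E$ with a fiberwise nondegenerate symmetric bilinear form $\langle\cdot,\cdot\rangle$, a vector bundle map $(\rho_E,\theta_E):E\to TM\oplus\mathbb R$ and an $\mathbb R$-bilinear bracket $\circ$ on $\Gamma(E)$ such that, for all $e_1,e_2,e_3\in\Gamma(E)$, $e_1\circ(e_2\circ e_3)=(e_1\circ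 e_2)\circ e_3+e_2\circ(e_1\circ e_3)$ and $$\rho_E(e_1)\langle e_2,e_3\rangle+\theta_E(e_1)\langle e_2,e_3\rangle=\langle e_1,e_2\circ e_3+e_3\circ e_2\rangle=\langle e_1\circ e_2,e_3\rangle+\langle e_2,e_1\circ e_3\rangle .$$ **Morphisms.** Let $E\to M$ and $E'\to M'$ be Courant-Jacobi algebroids and let $E\times\overline{E'}\to M\times M'$ be the exterior product bundle with the form $\langle\cdot,\cdot\rangle_E-\langle\cdot,\cdot\rangle_{E'}$. Its sections are the finite sums $\sum_i f_i\,(a_i,b_i)$ with $f_i\in C^\infty(M\times M')$, $a_i\in\Gamma(E)$, $b_i\in\Gamma(E')$. Its bracket is $(a,b)\circ(c,d)=(a\circ c,b\circ d)$, extended by the Leibniz rules $e_1\circ(ge_2)=g(e_1\circ e_2)+(\rho(e_1)g)e_2$ and $(fe_1)\circ e_2=f(e_1\circ e_2)-(\rho(e_2)f)e_1+\langle e_1,e_2\rangle\rho^*(df)$, where $\rho=(\rho_E,\rho_{E'})$ and $\langle e,\rho^*(df)\rangle=\rho(e)f$. A Courant-Jacobi algebroid morphism between $E$ and $E'$ over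 a smooth map $f:M\to M'$ is a vector subbundle $F$ of the restriction of $E\times\overline{E'}$ to the graph of $f$ such that 1. every fiber of $F$ is maximal isotropic; 2. $Tf(\rho_E(u))=\rho_{E'}(u')$ and $\theta_E(u)=\theta_{E'}(u')$ for all $(u,u')\in F$; 3. if the restrictions of two sections $e_1,e_2$ of $E\times\overline{E'}$ to the graph are sections of $F$, then so is the restriction of $e_1\circ e_2$. **The two doubles.** Let $(A,\phi,\pi,N,\varphi)$ be a Jacobi quasi-Nijenhuis algebroid, and let $\psi\in\Gamma(\wedge^3A^*)$ satisfy $d^\phi\psi=0$ and $\varphi=N^*\psi$, i.e. $\varphi(X,Y,Z)=\psi(NX,NY,NZ)$. Given a skew bracket and an anchor on $A$ and on $A^*$ that satisfy the Leibniz rule, sections $\phi_1\in\Gamma(A^*)$ and $W_1\in\Gamma(A)$, and a $3$-form $\chi$, let $d_1$ be the differential on forms on $A$ given by the bracket on $A$ and shifted by $\phi_1\wedge$, let $d_*$ be the differential on multivectors given by the bracket on $A^*$ and shifted by $W_1\wedge$, and let $\mathcal L^1$, $\mathcal L^*$ be the corresponding Lie derivatives. The associated double is the bundle $A^*\oplus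 A$ with $$\langle\alpha+X,\beta+Y\rangle=\tfrac12(\alpha(Y)+\beta(X)),\quad \rho(\alpha+X)=\rho_{A^*}(\alpha)+\rho_A(X),\quad \theta(\alpha+X)=\langle\alpha,W_1\rangle+\langle\phi_1,X\rangle,$$ $$(\alpha+X)\circ(\beta+Y)=\big([\alpha,\beta]_{A^*}+\mathcal L^1_X\beta-i_Yd_1\alpha+\chi(X,Y,\cdot)\big)+\big([X,Y]_A+\mathcal L^*_\alpha Y-i_\beta d_*X\big).$$ * $E_\pi^\varphi$ is the double for the bracket $[\cdot,\cdot]_N$ and anchor $\rho N$ on $A$, the bracket $[\cdot,\cdot]_\pi$ and anchor $\rho\pi^\sharp$ on $A^*$, $\phi_1=N^*\phi$, $W_1=-\pi^\sharp\phi$ and $\chi=\varphi$. * $E_{N\pi}^\psi$ is the double for the bracket $[X,Y]'=[X,Y]-N\pi^\sharp(\psi(X,Y,\cdot))$ and anchor $\rho$ on $A$ (its differential satisfies $d'f=df$ and $d'\alpha=d\alpha-i_{N\pi^\sharp\alpha}\psi$), the bracket $[\alpha,\beta]^\psi_{N\pi}=[\alpha,\beta]_{N\pi}+\psi(N\pi^\sharp\alpha,N\pi^\sharp\beta,\cdot)$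 and anchor $\rho N\pi^\sharp$ on $A^*$, $\phi_1=\phi$, $W_1=-N\pi^\sharp\phi$ and $\chi=\psi$. **Theorem.** Under these assumptions $E_{N\pi}^\psi$ and $E_\pi^\varphi$ are Courant-Jacobi algebroids, and $$F=\{(Na+\alpha,\;a+N^*\alpha)\mid a\in A_x,\ \alpha\in A^*_x,\ x\in M\}\subset E_{N\pi}^\psi\times\overline{E_\pi^\varphi}$$ is a Courant-Jacobi algebroid morphism between $E_{N\pi}^\psi$ and $E_\pi^\varphi$ over the identity of $M$. -/

import Mathlib

open Bundle Topology
open scoped Manifold ContDiff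

set_option linter.unusedSectionVars false

noncomputable section

namespace JQN

section Sections

variable {n : ℕ} {M : Type*} [TopologicalSpace M] [ChartedSpace (EuclideanSpace ℝ (Fin n)) M]
  {F : Type*} [NormedAddCommGroup F] [NormedSpace ℝ F]
  {V : M → Type*} [TopologicalSpace (TotalSpace F V)]
  [∀ x, AddCommGroup (V x)] [∀ x, Module ℝ (V x)] [∀ x, TopologicalSpace (V x)]
  [FiberBundle F V] [VectorBundle ℝ F V]

/-- The `C^∞(M)`-module structure on the smooth sections of a vector bundle. -/
instance sectionModule : Module C^∞⟮𝓡 n, M; ℝ⟯ Cₛ^∞⟮𝓡 n; F, V⟯ where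
  smul f s := ⟨fun x => f x • s x, f.contMDiff.smul_section s.contMDiff⟩
  one_smul s := by ext x; exact one_smul ℝ (s x)
  mul_smul f g s := by ext x; exact mul_smul (f x) (g x) (s x)
  smul_zero f := by ext x; exact smul_zero (f x)
  smul_add f s t := by ext x; exact smul_add (f x) (s x) (t x)
  add_smul f g s := by ext x; exact add_smul (f x) (g x) (s x)
  zero_smul s := by ext x; exact zero_smul ℝ (s x)

@[simp] theorem smul_apply (f : C^∞⟮𝓡 n, M; ℝ⟯) (s : Cₛ^∞⟮𝓡 n; F, V⟯) (x : M) :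
    (f • s) x = f x • s x := rfl

variable [IsManifold (𝓡 n) ∞ M] [T2Space M] [ContMDiffVectorBundle ∞ F V (𝓡 n)]

theorem exists_section_eventuallyEq {s : ∀ x, V x} {u : Set M} (hu : IsOpen u)
    (hs : ContMDiffOn (𝓡 n) ((𝓡 n).prod 𝓘(ℝ, F)) ∞ (fun x => TotalSpace.mk' F x (s x)) u)
    {x₀ : M} (hx : x₀ ∈ u) :
    ∃ S : Cₛ^∞⟮𝓡 n; F, V⟯, ∀ᶠ x in 𝓝 x₀, S x = s x := by
  obtain ⟨f, -, hf⟩ := (SmoothBumpFunction.nhds_basis_tsupport (I := 𝓡 n) x₀).mem_iff.1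
    (hu.mem_nhds hx)
  refine ⟨⟨fun x => f x • s x, ?_⟩, ?_⟩
  · exact ContMDiffOn.smul_section_of_tsupport f.contMDiff.contMDiffOn hu hf hs
  · filter_upwards [f.eventuallyEq_one] with x hx
    change f x • s x = s x
    simp [hx]

theorem exists_bump {u : Set M} (hu : IsOpen u) {x₀ : M} (hx : x₀ ∈ u) :
    ∃ f : C^∞⟮𝓡 n, M; ℝ⟯, (∀ᶠ x in 𝓝 x₀, f x = 1) ∧ ∀ x, x ∉ u → f x = 0 := by
  obtain ⟨f, -, hf⟩ := (SmoothBumpFunction.nhds_basis_tsupport (I := 𝓡 n) x₀).mem_iff.1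
    (hu.mem_nhds hx)
  exact ⟨⟨f, f.contMDiff⟩, f.eventuallyEq_one, fun x hxu =>
    image_eq_zero_of_notMem_tsupport fun h => hxu (hf h)⟩

variable [FiniteDimensional ℝ F]

theorem exists_section_eq (x₀ : M) (v : V x₀) : ∃ S : Cₛ^∞⟮𝓡 n; F, V⟯, S x₀ = v := by
  let e := trivializationAt F V x₀
  have hx : x₀ ∈ e.baseSet := FiberBundle.mem_baseSet_trivializationAt F V x₀
  let b := Module.finBasis ℝ F
  have H : ∀ i, ∃ S : Cₛ^∞⟮𝓡 n; F, V⟯, ∀ᶠ x in 𝓝 x₀, S x = e.localFrame b i x := fun i =>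
    exists_section_eventuallyEq e.open_baseSet (e.contMDiffOn_localFrame_baseSet ∞ b i) hx
  choose S hS using H
  refine ⟨∑ i, (e.basisAt b hx).repr v i • S i, ?_⟩
  have : ∀ i, S i x₀ = e.basisAt b hx i := fun i => by
    rw [(hS i).self_of_nhds, e.localFrame_apply_of_mem_baseSet b hx]
  have h2 : (∑ i, (e.basisAt b hx).repr v i • S i) x₀ =
      ∑ i, (e.basisAt b hx).repr v i • S i x₀ := by
    change ContMDiffSection.coeAddHom (𝓡 n) F ∞ V _ x₀ = _
    rw [map_sum, Finset.sum_apply]; rfl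
  rw [h2]
  simp only [this]
  exact (e.basisAt b hx).sum_repr v

/-- A `C^∞(M)`-linear functional on sections vanishes at a point where its argument vanishes. -/
theorem functional_eq_zero (Φ : Cₛ^∞⟮𝓡 n; F, V⟯ →ₗ[C^∞⟮𝓡 n, M; ℝ⟯] C^∞⟮𝓡 n, M; ℝ⟯)
    {X : Cₛ^∞⟮𝓡 n; F, V⟯} {x₀ : M} (hX : X x₀ = 0) : Φ X x₀ = 0 := by
  let e := trivializationAt F V x₀
  have hx : x₀ ∈ e.baseSet := FiberBundle.mem_baseSet_trivializationAt F V x₀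
  let b := Module.finBasis ℝ F
  obtain ⟨f, hf1, hf0⟩ := exists_bump (n := n) e.open_baseSet hx
  have hfx : f x₀ = 1 := hf1.self_of_nhds
  obtain ⟨g, hg1, hg0⟩ := exists_bump (n := n) e.open_baseSet hx
  have : ContMDiffVectorBundle 1 F V (𝓡 n) := ContMDiffVectorBundle.of_le (n := ∞) (by simp)
  have H : ∀ i, ∃ S : Cₛ^∞⟮𝓡 n; F, V⟯, ∀ᶠ x in 𝓝 x₀, S x = e.localFrame b i x := fun i =>
    exists_section_eventuallyEq e.open_baseSet (e.contMDiffOn_localFrame_baseSet ∞ b i) hx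
  choose S hS using H
  have H' : ∀ i, ∃ c : C^∞⟮𝓡 n, M; ℝ⟯, ∀ᶠ x in 𝓝 x₀,
      c x = e.localFrameCoeff (𝓡 n) b i x (X x) := by
    intro i
    have := exists_section_eventuallyEq (n := n) (F := ℝ) (V := Bundle.Trivial M ℝ)
      (s := fun x => e.localFrameCoeff (𝓡 n) b i x (X x)) e.open_baseSet ?_ hx
    · obtain ⟨c, hc⟩ := this
      refine ⟨⟨fun x => c x, ?_⟩, hc⟩
      have := c.contMDiff
      intro x
      exact ((contMDiffAt_section x).1 (this x))
    · intro x hx'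
      rw [contMDiffWithinAt_section]
      exact contMDiffOn_baseSet_localFrameCoeff b X.contMDiff.contMDiffOn i x hx'
  choose c hc using H'
  have hc0 : ∀ i, c i x₀ = 0 := fun i => by rw [(hc i).self_of_nhds, hX, map_zero]
  have hev : ∀ᶠ x in 𝓝 x₀, (X - ∑ i, c i • S i) x = 0 := by
    filter_upwards [e.eventually_eq_localFrame_sum_coeff_smul (I := 𝓡 n) (s := fun x => X x) b hx,
      Filter.eventually_all.2 hS, Filter.eventually_all.2 hc] with x h1 h2 h3
    have h4 : (∑ i, c i • S i) x = ∑ i, c i x • S i x := by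
      change ContMDiffSection.coeAddHom (𝓡 n) F ∞ V _ x = _
      rw [map_sum, Finset.sum_apply]; rfl
    change X x - (∑ i, c i • S i) x = 0
    rw [h4, sub_eq_zero]
    simp only [h2, h3]
    exact h1
  obtain ⟨u, hu, huo, hxu⟩ := eventually_nhds_iff.1 hev
  obtain ⟨k, hk1, hk0⟩ := exists_bump (n := n) huo hxu
  have hz : k • (X - ∑ i, c i • S i) = 0 := by
    ext x
    by_cases hxu' : x ∈ u
    · rw [smul_apply, hu x hxu', smul_zero]; rfl
    · rw [smul_apply, hk0 x hxu', zero_smul]; rfl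
  have h5 : k x₀ * (Φ X x₀ - ∑ i, c i x₀ * Φ (S i) x₀) = 0 := by
    have := congrArg (fun f : C^∞⟮𝓡 n, M; ℝ⟯ => f x₀) (congrArg Φ hz)
    simp only [map_smul, map_sub, map_sum, map_zero, smul_eq_mul] at this
    have h6 : (∑ i, c i * Φ (S i) : C^∞⟮𝓡 n, M; ℝ⟯) x₀ = ∑ i, c i x₀ * Φ (S i) x₀ := by
      change ContMDiffMap.coeFnAddMonoidHom _ x₀ = _
      rw [map_sum, Finset.sum_apply]; rfl
    rw [← h6]; exact this
  rw [hk1.self_of_nhds, one_mul] at h5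
  simpa [hc0] using h5


variable (V) in
/-- The dual bundle. -/
abbrev Dual : M → Type _ := fun x => V x →L[ℝ] ℝ

theorem contMDiff_pair (α : Cₛ^∞⟮𝓡 n; F →L[ℝ] ℝ, Dual V⟯) (X : Cₛ^∞⟮𝓡 n; F, V⟯) :
    ContMDiff (𝓡 n) 𝓘(ℝ, ℝ) ∞ (fun x => α x (X x)) := by
  have h := ContMDiff.clm_bundle_apply (n := ∞) (IB := 𝓡 n) (IM := 𝓡 n) (b := fun x : M => x)
    (E₂ := Bundle.Trivial M ℝ) (F₁ := F) (F₂ := ℝ) (E₁ := V) (ϕ := fun x => α x) (v := fun x => X x)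
    α.contMDiff X.contMDiff
  exact fun x => (contMDiffAt_section x).1 (h x)

theorem contMDiff_dual {α : ∀ x, Dual V x}
    (h : ∀ X : Cₛ^∞⟮𝓡 n; F, V⟯, ContMDiff (𝓡 n) 𝓘(ℝ, ℝ) ∞ (fun x => α x (X x))) :
    ContMDiff (𝓡 n) ((𝓡 n).prod 𝓘(ℝ, F →L[ℝ] ℝ)) ∞
      (fun x => TotalSpace.mk' (F →L[ℝ] ℝ) (E := Dual V) x (α x)) := by
  intro x₀
  let e := trivializationAt F V x₀
  have hx : x₀ ∈ e.baseSet := FiberBundle.mem_baseSet_trivializationAt F V x₀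
  let b := Module.finBasis ℝ F
  have H : ∀ i, ∃ S : Cₛ^∞⟮𝓡 n; F, V⟯, ∀ᶠ x in 𝓝 x₀, S x = e.localFrame b i x := fun i =>
    exists_section_eventuallyEq e.open_baseSet (e.contMDiffOn_localFrame_baseSet ∞ b i) hx
  choose S hS using H
  refine (contMDiffAt_hom_bundle (E₂ := Bundle.Trivial M ℝ) (E₁ := V) _).2 ⟨contMDiffAt_id, ?_⟩
  have h1 : ContMDiffAt (𝓡 n) 𝓘(ℝ, F →L[ℝ] ℝ) ∞ (fun x => ∑ i, α x (S i x) •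
      LinearMap.toContinuousLinearMap (b.coord i)) x₀ := by
    refine contMDiffAt_finsetSum fun i _ => ?_
    exact (h (S i) x₀).smul contMDiffAt_const
  refine h1.congr_of_eventuallyEq ?_
  filter_upwards [e.open_baseSet.mem_nhds hx, Filter.eventually_all.2 hS] with x hxe hSx
  refine ContinuousLinearMap.coe_injective (b.ext fun j => ?_)
  simp only [hSx, e.localFrame_apply_of_mem_baseSet b hxe, ContinuousLinearMap.coe_coe,
    sum_apply, _root_.smul_apply]
  rw [ContinuousLinearMap.inCoordinates_eq hxe (by simp)]
  simp [Bundle.Trivialization.basisAt, Finsupp.single_apply, b.repr_self]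
  rfl

theorem contMDiff_predual {v : ∀ x, V x}
    (h : ∀ α : Cₛ^∞⟮𝓡 n; F →L[ℝ] ℝ, Dual V⟯, ContMDiff (𝓡 n) 𝓘(ℝ, ℝ) ∞ (fun x => α x (v x))) :
    ContMDiff (𝓡 n) ((𝓡 n).prod 𝓘(ℝ, F)) ∞ (fun x => TotalSpace.mk' F x (v x)) := by
  intro x₀
  let e := trivializationAt F V x₀
  have hx : x₀ ∈ e.baseSet := FiberBundle.mem_baseSet_trivializationAt F V x₀
  let b := Module.finBasis ℝ F
  have : ContMDiffVectorBundle 1 F V (𝓡 n) := ContMDiffVectorBundle.of_le (n := ∞) (by simp)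
  obtain ⟨f, -, hf⟩ := (SmoothBumpFunction.nhds_basis_tsupport (I := 𝓡 n) x₀).mem_iff.1
    (e.open_baseSet.mem_nhds hx)
  have H : ∀ i, ∃ α : Cₛ^∞⟮𝓡 n; F →L[ℝ] ℝ, Dual V⟯, ∀ᶠ x in 𝓝 x₀,
      e.localFrameCoeff (𝓡 n) b i x (v x) = α x (v x) := by
    intro i
    classical
    have hα (x : M) (w : V x) (hxe : x ∈ e.baseSet) : e.localFrameCoeff (𝓡 n) b i x w =
        b.coord i (e.continuousLinearMapAt ℝ x w) := by
      have := e.localFrameCoeff_eq_coeff (I := 𝓡 n) (b := b) (i := i)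
        (s := Function.update (fun _ => 0) x w) hxe
      simp only [Function.update_self] at this
      rw [this, e.continuousLinearMapAt_apply (R := ℝ), e.coe_linearMapAt_of_mem hxe]
      rfl
    refine ⟨⟨fun x => f x • (LinearMap.toContinuousLinearMap (b.coord i)).comp
      (e.continuousLinearMapAt ℝ x), contMDiff_dual fun X => ?_⟩, ?_⟩
    · have h1 := ContMDiffOn.smul_section_of_tsupport (I := 𝓡 n) (F := ℝ) (n := ∞)
        (V := Bundle.Trivial M ℝ) (s := fun x => e.localFrameCoeff (𝓡 n) b i x (X x))
        (ψ := f) f.contMDiff.contMDiffOn e.open_baseSet hf ?_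
      · intro x
        have h2 := (contMDiffAt_section x).1 (h1 x)
        refine h2.congr_of_eventuallyEq (Filter.Eventually.of_forall fun y => ?_)
        by_cases hy : y ∈ e.baseSet
        · change f y * b.coord i (e.continuousLinearMapAt ℝ y (X y)) =
            f y * e.localFrameCoeff (𝓡 n) b i y (X y)
          rw [hα y _ hy]
        · have : f y = 0 := image_eq_zero_of_notMem_tsupport fun h => hy (hf h)
          change f y * b.coord i (e.continuousLinearMapAt ℝ y (X y)) =
            f y * e.localFrameCoeff (𝓡 n) b i y (X y)
          rw [this, zero_mul, zero_mul]
      · intro x hx'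
        rw [contMDiffWithinAt_section]
        exact contMDiffOn_baseSet_localFrameCoeff b X.contMDiff.contMDiffOn i x hx'
    · filter_upwards [e.open_baseSet.mem_nhds hx, f.eventuallyEq_one] with x hxe hfx
      rw [hα x _ hxe]
      change _ = f x * b.coord i (e.continuousLinearMapAt ℝ x (v x))
      rw [hfx, Pi.one_apply, one_mul]
  rw [contMDiffAt_iff_localFrameCoeff b hx]
  intro i
  obtain ⟨α, hα⟩ := H i
  exact (h α x₀).congr_of_eventuallyEq hα

/-- A `C^∞(M)`-linear functional on the sections of `V` is the pairing with a section of the dual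
bundle. -/
theorem exists_dual_section (Φ : Cₛ^∞⟮𝓡 n; F, V⟯ →ₗ[C^∞⟮𝓡 n, M; ℝ⟯] C^∞⟮𝓡 n, M; ℝ⟯) :
    ∃ α : Cₛ^∞⟮𝓡 n; F →L[ℝ] ℝ, Dual V⟯, ∀ X x, α x (X x) = Φ X x := by
  have key : ∀ x, ∃ α : Dual V x, ∀ X : Cₛ^∞⟮𝓡 n; F, V⟯, α (X x) = Φ X x := by
    intro x
    have : T2Space (V x) := FiberBundle.t2Space F V x
    have : FiniteDimensional ℝ (V x) := VectorBundle.finiteDimensional ℝ F V x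
    have : IsTopologicalAddGroup (V x) :=
      (VectorBundle.continuousLinearEquivAt ℝ F V x).toContinuousAddEquiv.isTopologicalAddGroup
    have : ContinuousSMul ℝ (V x) :=
      (VectorBundle.continuousLinearEquivAt ℝ F V x).continuousSMul
    choose S hS using exists_section_eq (n := n) (F := F) (V := V) x
    have hΦ : ∀ X Y : Cₛ^∞⟮𝓡 n; F, V⟯, X x = Y x → Φ X x = Φ Y x := fun X Y h => by
      have h1 : Φ (X - Y) x = 0 := functional_eq_zero Φ (by
        change X x - Y x = 0
        rw [h, sub_self])
      rw [map_sub] at h1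
      exact sub_eq_zero.1 h1
    refine ⟨LinearMap.toContinuousLinearMap
      { toFun := fun v => Φ (S v) x, map_add' := fun v w => ?_, map_smul' := fun c v => ?_ },
      fun X => hΦ _ _ (hS _)⟩
    · rw [hΦ (S (v + w)) (S v + S w) (by
        change _ = S v x + S w x
        simp only [hS]), map_add]
      rfl
    · rw [hΦ (S (c • v)) ((ContMDiffMap.const c : C^∞⟮𝓡 n, M; ℝ⟯) • S v) (by
        rw [smul_apply, hS, hS]; rfl), map_smul]
      rfl
  choose α hα using key
  exact ⟨⟨α, contMDiff_dual fun X => by simpa only [hα] using (Φ X).contMDiff⟩, fun X x => hα x X⟩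

/-- A `C^∞(M)`-linear functional on the sections of the dual bundle is the pairing with a section
of `V`. -/
theorem exists_predual_section
    (Φ : Cₛ^∞⟮𝓡 n; F →L[ℝ] ℝ, Dual V⟯ →ₗ[C^∞⟮𝓡 n, M; ℝ⟯] C^∞⟮𝓡 n, M; ℝ⟯) :
    ∃ X : Cₛ^∞⟮𝓡 n; F, V⟯, ∀ α x, α x (X x) = Φ α x := by
  have key : ∀ x, ∃ v : V x, ∀ α : Cₛ^∞⟮𝓡 n; F →L[ℝ] ℝ, Dual V⟯, α x v = Φ α x := by
    intro x
    have : T2Space (V x) := FiberBundle.t2Space F V x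
    have : FiniteDimensional ℝ (V x) := VectorBundle.finiteDimensional ℝ F V x
    have : IsTopologicalAddGroup (V x) :=
      (VectorBundle.continuousLinearEquivAt ℝ F V x).toContinuousAddEquiv.isTopologicalAddGroup
    have : ContinuousSMul ℝ (V x) :=
      (VectorBundle.continuousLinearEquivAt ℝ F V x).continuousSMul
    obtain ⟨ξ, hξ⟩ := exists_dual_section (V := Dual V) Φ
    obtain ⟨v, hv⟩ := (Module.evalEquiv ℝ (V x)).surjective
      ((ξ x).toLinearMap.comp
        (LinearMap.toContinuousLinearMap : (V x →ₗ[ℝ] ℝ) ≃ₗ[ℝ] (V x →L[ℝ] ℝ)).toLinearMap)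
    refine ⟨v, fun α => ?_⟩
    rw [← hξ]
    have := congrArg (fun g => g (α x).toLinearMap) hv
    simp only [Module.evalEquiv_apply] at this
    exact this
  choose X hX using key
  exact ⟨⟨X, contMDiff_predual fun α => by simpa only [hX] using (Φ α).contMDiff⟩,
    fun α x => hX x α⟩

end Sections

section
variable {n : ℕ} {M : Type*} [TopologicalSpace M] [ChartedSpace (EuclideanSpace ℝ (Fin n)) M]
  [IsManifold (𝓡 n) ∞ M]

/-- The derivative `df(v)` of a function `f` at `x` in the direction of a tangent vector `v`. -/
def dirDeriv (f : M → ℝ) (x : M) (v : TangentSpace (𝓡 n) x) : ℝ :=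
  mfderiv (𝓡 n) 𝓘(ℝ, ℝ) f x v

/-- The smooth vector fields on `M`. -/
abbrev VectorField (n : ℕ) (M : Type*) [TopologicalSpace M]
    [ChartedSpace (EuclideanSpace ℝ (Fin n)) M] [IsManifold (𝓡 n) ∞ M] :=
  Cₛ^∞⟮𝓡 n; EuclideanSpace ℝ (Fin n), (TangentSpace (𝓡 n) : M → Type _)⟯

/-- The function `Y f`, for a smooth vector field `Y` and a smooth function `f`. -/
def VectorField.act (Y : VectorField n M) (f : C^∞⟮𝓡 n, M; ℝ⟯) : C^∞⟮𝓡 n, M; ℝ⟯ :=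
  ⟨fun x => dirDeriv f x (Y x), by
    have h1 := (f.contMDiff.contMDiff_tangentMap (m := ∞) (by simp)).comp Y.contMDiff
    exact (contMDiff_snd_tangentBundle_modelSpace ℝ 𝓘(ℝ, ℝ)).comp h1⟩

theorem VectorField.act_apply (Y : VectorField n M) (f : C^∞⟮𝓡 n, M; ℝ⟯) (x : M) :
    Y.act f x = dirDeriv f x (Y x) := rfl

theorem VectorField.add_act (Y Z : VectorField n M) (f : C^∞⟮𝓡 n, M; ℝ⟯) :
    VectorField.act (Y + Z) f = Y.act f + Z.act f := by
  ext x
  exact map_add (mfderiv (𝓡 n) 𝓘(ℝ, ℝ) f x) (Y x) (Z x)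

theorem VectorField.smul_act (g : C^∞⟮𝓡 n, M; ℝ⟯) (Y : VectorField n M) (f : C^∞⟮𝓡 n, M; ℝ⟯) :
    VectorField.act (g • Y) f = g * Y.act f := by
  ext x
  exact map_smul (mfderiv (𝓡 n) 𝓘(ℝ, ℝ) f x) (g x) (Y x)

theorem VectorField.act_add (Y : VectorField n M) (f g : C^∞⟮𝓡 n, M; ℝ⟯) :
    Y.act (f + g) = Y.act f + Y.act g := by
  ext x
  have h := mfderiv_add (I := 𝓡 n) (z := x) (f.contMDiff.mdifferentiable (by simp) x)
    (g.contMDiff.mdifferentiable (by simp) x)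
  exact congrArg (fun L : TangentSpace (𝓡 n) x →L[ℝ] ℝ => L (Y x)) h

theorem VectorField.act_mul (Y : VectorField n M) (f g : C^∞⟮𝓡 n, M; ℝ⟯) :
    Y.act (f * g) = f * Y.act g + g * Y.act f := by
  ext x
  have h := (((f.contMDiff.mdifferentiable (by simp) x).hasMFDerivAt).mul
    ((g.contMDiff.mdifferentiable (by simp) x).hasMFDerivAt)).mfderiv
  exact congrArg (fun L : TangentSpace (𝓡 n) x →L[ℝ] ℝ => L (Y x)) h
end

section Structures

variable {n : ℕ} {M : Type*} [TopologicalSpace M] [ChartedSpace (EuclideanSpace ℝ (Fin n)) M]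
  [IsManifold (𝓡 n) ∞ M] [T2Space M]
  {F : Type*} [NormedAddCommGroup F] [NormedSpace ℝ F] [FiniteDimensional ℝ F]
  {V : M → Type*} [TopologicalSpace (TotalSpace F V)]
  [∀ x, AddCommGroup (V x)] [∀ x, Module ℝ (V x)] [∀ x, TopologicalSpace (V x)]
  [FiberBundle F V] [VectorBundle ℝ F V] [ContMDiffVectorBundle ∞ F V (𝓡 n)]
  {G : Type*} [NormedAddCommGroup G] [NormedSpace ℝ G] [FiniteDimensional ℝ G]
  {W : M → Type*} [TopologicalSpace (TotalSpace G W)]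
  [∀ x, AddCommGroup (W x)] [∀ x, Module ℝ (W x)] [∀ x, TopologicalSpace (W x)]
  [FiberBundle G W] [VectorBundle ℝ G W] [ContMDiffVectorBundle ∞ G W (𝓡 n)]

/-- A smooth vector bundle map `V → W` over the identity of `M`: a family of linear maps between
the fibers that takes smooth sections to smooth sections. -/
structure BundleMap (n : ℕ) {M : Type*} [TopologicalSpace M]
    [ChartedSpace (EuclideanSpace ℝ (Fin n)) M]
    (F : Type*) [NormedAddCommGroup F] [NormedSpace ℝ F]
    (V : M → Type*) [TopologicalSpace (TotalSpace F V)]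
    [∀ x, AddCommGroup (V x)] [∀ x, Module ℝ (V x)] [∀ x, TopologicalSpace (V x)]
    [FiberBundle F V]
    (G : Type*) [NormedAddCommGroup G] [NormedSpace ℝ G]
    (W : M → Type*) [TopologicalSpace (TotalSpace G W)]
    [∀ x, AddCommGroup (W x)] [∀ x, Module ℝ (W x)] [∀ x, TopologicalSpace (W x)]
    [FiberBundle G W] where
  toFun : ∀ x, V x →L[ℝ] W x
  smooth : ∀ X : Cₛ^∞⟮𝓡 n; F, V⟯,
    ContMDiff (𝓡 n) ((𝓡 n).prod 𝓘(ℝ, G)) ∞ fun x => TotalSpace.mk' G x (toFun x (X x))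

/-- The map on sections induced by a vector bundle map. -/
def BundleMap.map (T : BundleMap n F V G W) :
    Cₛ^∞⟮𝓡 n; F, V⟯ →ₗ[C^∞⟮𝓡 n, M; ℝ⟯] Cₛ^∞⟮𝓡 n; G, W⟯ where
  toFun X := ⟨fun x => T.toFun x (X x), T.smooth X⟩
  map_add' X Y := by ext x; exact map_add (T.toFun x) (X x) (Y x)
  map_smul' f X := by ext x; exact map_smul (T.toFun x) (f x) (X x)

@[simp] theorem BundleMap.map_apply (T : BundleMap n F V G W) (X : Cₛ^∞⟮𝓡 n; F, V⟯) (x : M) :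
    T.map X x = T.toFun x (X x) := rfl

section Dualities

variable (n F V G W) in
/-- Two smooth vector bundles `V` and `W` over `M` in duality: a smooth perfect pairing of the
fibers, for which every `C^∞(M)`-linear functional on the sections of one bundle is the pairing with
a section of the other. The case of a bundle and its dual is `stdDuality` below; the only reason
for this notion is that the roles of `A` and `A*` can be exchanged, by `Duality.flip`. -/
structure Duality where
  pair : ∀ x, W x →ₗ[ℝ] V x →ₗ[ℝ] ℝ
  smooth : ∀ (ξ : Cₛ^∞⟮𝓡 n; G, W⟯) (X : Cₛ^∞⟮𝓡 n; F, V⟯),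
    ContMDiff (𝓡 n) 𝓘(ℝ, ℝ) ∞ fun x => pair x (ξ x) (X x)
  separating_left : ∀ x (w : W x), (∀ v, pair x w v = 0) → w = 0
  separating_right : ∀ x (v : V x), (∀ w, pair x w v = 0) → v = 0
  exists_left : ∀ Φ : Cₛ^∞⟮𝓡 n; F, V⟯ →ₗ[C^∞⟮𝓡 n, M; ℝ⟯] C^∞⟮𝓡 n, M; ℝ⟯,
    ∃ ξ : Cₛ^∞⟮𝓡 n; G, W⟯, ∀ X x, pair x (ξ x) (X x) = Φ X x
  exists_right : ∀ Φ : Cₛ^∞⟮𝓡 n; G, W⟯ →ₗ[C^∞⟮𝓡 n, M; ℝ⟯] C^∞⟮𝓡 n, M; ℝ⟯,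
    ∃ X : Cₛ^∞⟮𝓡 n; F, V⟯, ∀ ξ x, pair x (ξ x) (X x) = Φ ξ x

variable (n F V) in
/-- A vector bundle `V` and its dual bundle, with the evaluation pairing. -/
def stdDuality : Duality n F V (F →L[ℝ] ℝ) (Dual V) where
  pair x := ContinuousLinearMap.coeLM ℝ
  smooth := contMDiff_pair
  separating_left _ _ h := ContinuousLinearMap.ext h
  separating_right x v h := by
    have : T2Space (V x) := FiberBundle.t2Space F V x
    have : FiniteDimensional ℝ (V x) := VectorBundle.finiteDimensional ℝ F V x
    have : IsTopologicalAddGroup (V x) :=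
      (VectorBundle.continuousLinearEquivAt ℝ F V x).toContinuousAddEquiv.isTopologicalAddGroup
    have : ContinuousSMul ℝ (V x) :=
      (VectorBundle.continuousLinearEquivAt ℝ F V x).continuousSMul
    exact (Module.forall_dual_apply_eq_zero_iff ℝ v).1 fun f => h (LinearMap.toContinuousLinearMap f)
  exists_left := exists_dual_section
  exists_right := exists_predual_section

/-- The duality with the roles of the two bundles exchanged. -/
def Duality.flip (p : Duality n F V G W) : Duality n G W F V where
  pair x := (p.pair x).flip
  smooth X ξ := p.smooth ξ X
  separating_left := p.separating_right
  separating_right := p.separating_left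
  exists_left := p.exists_right
  exists_right := p.exists_left

namespace Duality

variable (p : Duality n F V G W)

/-- The pairing `⟨ξ, X⟩` of sections. -/
def pairing : Cₛ^∞⟮𝓡 n; G, W⟯ →ₗ[C^∞⟮𝓡 n, M; ℝ⟯] Cₛ^∞⟮𝓡 n; F, V⟯ →ₗ[C^∞⟮𝓡 n, M; ℝ⟯]
    C^∞⟮𝓡 n, M; ℝ⟯ :=
  LinearMap.mk₂ _ (fun ξ X => ⟨fun x => p.pair x (ξ x) (X x), p.smooth ξ X⟩)
    (fun ξ η X => by ext x; exact LinearMap.map_add₂ (p.pair x) (ξ x) (η x) (X x))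
    (fun f ξ X => by ext x; exact LinearMap.map_smul₂ (p.pair x) (f x) (ξ x) (X x))
    (fun ξ X Y => by ext x; exact map_add (p.pair x (ξ x)) (X x) (Y x))
    (fun f ξ X => by ext x; exact map_smul (p.pair x (ξ x)) (f x) (X x))

@[simp] theorem pairing_apply (ξ : Cₛ^∞⟮𝓡 n; G, W⟯) (X : Cₛ^∞⟮𝓡 n; F, V⟯) (x : M) :
    p.pairing ξ X x = p.pair x (ξ x) (X x) := rfl

@[simp] theorem flip_pairing (ξ : Cₛ^∞⟮𝓡 n; G, W⟯) (X : Cₛ^∞⟮𝓡 n; F, V⟯) :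
    p.flip.pairing X ξ = p.pairing ξ X := rfl

theorem ext_left {ξ η : Cₛ^∞⟮𝓡 n; G, W⟯} (h : ∀ X, p.pairing ξ X = p.pairing η X) : ξ = η := by
  ext x
  refine sub_eq_zero.1 (p.separating_left x _ fun v => ?_)
  obtain ⟨X, rfl⟩ := exists_section_eq (n := n) (F := F) x v
  rw [map_sub, LinearMap.sub_apply, sub_eq_zero]
  exact congrArg (fun f : C^∞⟮𝓡 n, M; ℝ⟯ => f x) (h X)

/-- The section of `W` that represents a `C^∞(M)`-linear functional on the sections of `V`. -/
def ofFunctional (Φ : Cₛ^∞⟮𝓡 n; F, V⟯ →ₗ[C^∞⟮𝓡 n, M; ℝ⟯] C^∞⟮𝓡 n, M; ℝ⟯) :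
    Cₛ^∞⟮𝓡 n; G, W⟯ :=
  (p.exists_left Φ).choose

@[simp] theorem pairing_ofFunctional
    (Φ : Cₛ^∞⟮𝓡 n; F, V⟯ →ₗ[C^∞⟮𝓡 n, M; ℝ⟯] C^∞⟮𝓡 n, M; ℝ⟯) (X : Cₛ^∞⟮𝓡 n; F, V⟯) :
    p.pairing (p.ofFunctional Φ) X = Φ X := by
  ext x
  exact (p.exists_left Φ).choose_spec X x

/-- The transpose `N*` of a bundle map `N : V → V`, on sections: `⟨N*ξ, X⟩ = ⟨ξ, N X⟩`. -/
def transpose (N : BundleMap n F V F V) (ξ : Cₛ^∞⟮𝓡 n; G, W⟯) : Cₛ^∞⟮𝓡 n; G, W⟯ :=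
  p.ofFunctional ((p.pairing ξ).comp N.map)

@[simp] theorem pairing_transpose (N : BundleMap n F V F V) (ξ : Cₛ^∞⟮𝓡 n; G, W⟯)
    (X : Cₛ^∞⟮𝓡 n; F, V⟯) : p.pairing (p.transpose N ξ) X = p.pairing ξ (N.map X) := by
  simp [transpose]

end Duality

end Dualities

section Forms

variable (n F V) in
/-- A smooth `3`-form on the vector bundle `V`, i.e. a smooth section of `∧³V*`. -/
structure ThreeForm where
  toFun : ∀ x, V x [⋀^Fin 3]→ₗ[ℝ] ℝ
  smooth : ∀ X Y Z : Cₛ^∞⟮𝓡 n; F, V⟯,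
    ContMDiff (𝓡 n) 𝓘(ℝ, ℝ) ∞ fun x => toFun x ![X x, Y x, Z x]

namespace ThreeForm

/-- The smooth function `χ(X, Y, Z)`. -/
def eval (χ : ThreeForm n F V) (X Y Z : Cₛ^∞⟮𝓡 n; F, V⟯) : C^∞⟮𝓡 n, M; ℝ⟯ :=
  ⟨fun x => χ.toFun x ![X x, Y x, Z x], χ.smooth X Y Z⟩

variable (χ : ThreeForm n F V) (X Y Z Z' : Cₛ^∞⟮𝓡 n; F, V⟯)

theorem eval_swap₁ : χ.eval X Y Z = - χ.eval Y X Z := by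
  ext x
  have h := (χ.toFun x).map_swap ![Y x, X x, Z x] (i := 0) (j := 1) (by decide)
  have e : ![Y x, X x, Z x] ∘ Equiv.swap (0 : Fin 3) 1 = ![X x, Y x, Z x] := by
    funext i; fin_cases i <;> simp [Equiv.swap_apply_def]
  rw [e] at h
  exact h

theorem eval_swap₂ : χ.eval X Y Z = - χ.eval X Z Y := by
  ext x
  have h := (χ.toFun x).map_swap ![X x, Z x, Y x] (i := 1) (j := 2) (by decide)
  have e : ![X x, Z x, Y x] ∘ Equiv.swap (1 : Fin 3) 2 = ![X x, Y x, Z x] := by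
    funext i; fin_cases i <;> simp [Equiv.swap_apply_def]
  rw [e] at h
  exact h

theorem eval_add : χ.eval X Y (Z + Z') = χ.eval X Y Z + χ.eval X Y Z' := by
  ext x
  have h := (χ.toFun x).map_update_add ![X x, Y x, 0] 2 (Z x) (Z' x)
  have e : ∀ v : V x, Function.update ![X x, Y x, 0] (2 : Fin 3) v = ![X x, Y x, v] := by
    intro v; funext i; fin_cases i <;> rfl
  simp only [e] at h
  exact h

theorem eval_smul (f : C^∞⟮𝓡 n, M; ℝ⟯) : χ.eval X Y (f • Z) = f * χ.eval X Y Z := by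
  ext x
  have h := (χ.toFun x).map_update_smul ![X x, Y x, 0] 2 (f x) (Z x)
  have e : ∀ v : V x, Function.update ![X x, Y x, 0] (2 : Fin 3) v = ![X x, Y x, v] := by
    intro v; funext i; fin_cases i <;> rfl
  simp only [e] at h
  exact h

/-- The contraction `(X, Y) ↦ χ(X, Y, ·)`, a section of the dual bundle. -/
def contract (p : Duality n F V G W) (χ : ThreeForm n F V) :
    Cₛ^∞⟮𝓡 n; F, V⟯ →ₗ[C^∞⟮𝓡 n, M; ℝ⟯] Cₛ^∞⟮𝓡 n; F, V⟯ →ₗ[C^∞⟮𝓡 n, M; ℝ⟯] Cₛ^∞⟮𝓡 n; G, W⟯ :=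
  LinearMap.mk₂ _ (fun X Y => p.ofFunctional
      { toFun := χ.eval X Y, map_add' := χ.eval_add X Y, map_smul' := fun f Z => χ.eval_smul X Y Z f })
    (fun X X' Y => p.ext_left fun Z => by
      simp only [map_add, LinearMap.add_apply, Duality.pairing_ofFunctional, LinearMap.coe_mk,
        AddHom.coe_mk]
      rw [χ.eval_swap₁, χ.eval_swap₂, eval_add, χ.eval_swap₁ X, χ.eval_swap₂ Y X,
        χ.eval_swap₁ X', χ.eval_swap₂ Y X']
      ring)
    (fun f X Y => p.ext_left fun Z => by
      simp only [map_smul, LinearMap.smul_apply, Duality.pairing_ofFunctional, LinearMap.coe_mk,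
        AddHom.coe_mk, smul_eq_mul]
      rw [χ.eval_swap₁, χ.eval_swap₂, eval_smul, χ.eval_swap₁ X, χ.eval_swap₂ Y X]
      ring)
    (fun X Y Y' => p.ext_left fun Z => by
      simp only [map_add, LinearMap.add_apply, Duality.pairing_ofFunctional, LinearMap.coe_mk,
        AddHom.coe_mk]
      rw [χ.eval_swap₂, eval_add, χ.eval_swap₂ X Y, χ.eval_swap₂ X Y']
      ring)
    (fun f X Y => p.ext_left fun Z => by
      simp only [map_smul, LinearMap.smul_apply, Duality.pairing_ofFunctional, LinearMap.coe_mk,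
        AddHom.coe_mk, smul_eq_mul]
      rw [χ.eval_swap₂, eval_smul, χ.eval_swap₂ X Y]
      ring)

@[simp] theorem pairing_contract (p : Duality n F V G W) :
    p.pairing (χ.contract p X Y) Z = χ.eval X Y Z := by
  simp [contract]

/-- The pullback `N*χ` of a `3`-form: `(N*χ)(X, Y, Z) = χ(N X, N Y, N Z)`. -/
def pullback (N : BundleMap n F V F V) (χ : ThreeForm n F V) : ThreeForm n F V where
  toFun x := (χ.toFun x).compLinearMap (N.toFun x).toLinearMap
  smooth X Y Z := by
    refine (χ.smooth (N.map X) (N.map Y) (N.map Z)).congr fun x => ?_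
    rw [AlternatingMap.compLinearMap_apply]
    congr 1
    funext i
    fin_cases i <;> rfl

end ThreeForm

end Forms

section Algebroids

/-- A bracket on the sections of `V` that is additive, skew-symmetric and satisfies the Leibniz rule
for an anchor `V → TM`, together with a `1`-form `φ`. Such a bracket is the same thing as a degree-one
derivation `d` of the exterior algebra of forms on `V`, and `d^φ ω = dω + φ ∧ ω` is then a
degree-one `φ`-quasi derivation. -/
structure AlmostJacobi (p : Duality n F V G W) where
  anchor : BundleMap n F V (EuclideanSpace ℝ (Fin n)) (TangentSpace (𝓡 n) : M → Type _)
  bracket : Cₛ^∞⟮𝓡 n; F, V⟯ → Cₛ^∞⟮𝓡 n; F, V⟯ → Cₛ^∞⟮𝓡 n; F, V⟯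
  form : Cₛ^∞⟮𝓡 n; G, W⟯
  bracket_add : ∀ X Y Z, bracket X (Y + Z) = bracket X Y + bracket X Z
  bracket_skew : ∀ X Y, bracket X Y = - bracket Y X
  bracket_leibniz : ∀ X (f : C^∞⟮𝓡 n, M; ℝ⟯) Y,
    bracket X (f • Y) = f • bracket X Y + (VectorField.act (anchor.map X) f) • Y

namespace AlmostJacobi

variable {p : Duality n F V G W} (P : AlmostJacobi p)

/-- `ρ(X) f`. -/
def rho (X : Cₛ^∞⟮𝓡 n; F, V⟯) (f : C^∞⟮𝓡 n, M; ℝ⟯) : C^∞⟮𝓡 n, M; ℝ⟯ :=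
  VectorField.act (P.anchor.map X) f

/-- `ρ^φ(X) f = ρ(X) f + f ⟨φ, X⟩`. -/
def rhoForm (X : Cₛ^∞⟮𝓡 n; F, V⟯) (f : C^∞⟮𝓡 n, M; ℝ⟯) : C^∞⟮𝓡 n, M; ℝ⟯ :=
  P.rho X f + f * p.pairing P.form X

/-- The bracket makes `V` a Lie algebroid, and the `1`-form is a `1`-cocycle. -/
structure IsJacobi : Prop where
  jacobi : ∀ X Y Z, P.bracket X (P.bracket Y Z) =
    P.bracket (P.bracket X Y) Z + P.bracket Y (P.bracket X Z)
  cocycle : ∀ X Y, P.rho X (p.pairing P.form Y) - P.rho Y (p.pairing P.form X)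
    - p.pairing P.form (P.bracket X Y) = 0

theorem bracket_add_left (X Y Z : Cₛ^∞⟮𝓡 n; F, V⟯) :
    P.bracket (X + Y) Z = P.bracket X Z + P.bracket Y Z := by
  rw [P.bracket_skew, P.bracket_add, P.bracket_skew Z X, P.bracket_skew Z Y]
  abel

theorem bracket_leibniz_left (f : C^∞⟮𝓡 n, M; ℝ⟯) (X Y : Cₛ^∞⟮𝓡 n; F, V⟯) :
    P.bracket (f • X) Y = f • P.bracket X Y - P.rho Y f • X := by
  rw [P.bracket_skew, P.bracket_leibniz, P.bracket_skew Y X, rho, smul_neg]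
  abel

theorem rho_add (X : Cₛ^∞⟮𝓡 n; F, V⟯) (f g : C^∞⟮𝓡 n, M; ℝ⟯) :
    P.rho X (f + g) = P.rho X f + P.rho X g := VectorField.act_add _ _ _

theorem rho_mul (X : Cₛ^∞⟮𝓡 n; F, V⟯) (f g : C^∞⟮𝓡 n, M; ℝ⟯) :
    P.rho X (f * g) = f * P.rho X g + g * P.rho X f := VectorField.act_mul _ _ _

theorem rho_add_left (X Y : Cₛ^∞⟮𝓡 n; F, V⟯) (f : C^∞⟮𝓡 n, M; ℝ⟯) :
    P.rho (X + Y) f = P.rho X f + P.rho Y f := by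
  rw [rho, map_add, VectorField.add_act]; rfl

theorem rho_smul_left (g : C^∞⟮𝓡 n, M; ℝ⟯) (X : Cₛ^∞⟮𝓡 n; F, V⟯) (f : C^∞⟮𝓡 n, M; ℝ⟯) :
    P.rho (g • X) f = g * P.rho X f := by
  rw [rho, map_smul, VectorField.smul_act]; rfl

theorem rhoForm_add_left (X Y : Cₛ^∞⟮𝓡 n; F, V⟯) (f : C^∞⟮𝓡 n, M; ℝ⟯) :
    P.rhoForm (X + Y) f = P.rhoForm X f + P.rhoForm Y f := by
  simp only [rhoForm, rho_add_left, map_add]; ring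

theorem rhoForm_smul_left (g : C^∞⟮𝓡 n, M; ℝ⟯) (X : Cₛ^∞⟮𝓡 n; F, V⟯) (f : C^∞⟮𝓡 n, M; ℝ⟯) :
    P.rhoForm (g • X) f = g * P.rhoForm X f := by
  simp only [rhoForm, rho_smul_left, map_smul, smul_eq_mul]; ring

/-- The `φ`-differential of a function: `⟨d^φ f, X⟩ = ρ^φ(X) f`. -/
def dFun (f : C^∞⟮𝓡 n, M; ℝ⟯) : Cₛ^∞⟮𝓡 n; G, W⟯ :=
  p.ofFunctional
    { toFun := fun X => P.rhoForm X f
      map_add' := fun X Y => P.rhoForm_add_left X Y f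
      map_smul' := fun g X => P.rhoForm_smul_left g X f }

/-- The `φ`-differential of a `1`-form, as a function of two sections:
`(d^φ α)(X, Y) = ρ^φ(X)⟨α, Y⟩ - ρ^φ(Y)⟨α, X⟩ - ⟨α, [X, Y]⟩`. -/
def dForm (α : Cₛ^∞⟮𝓡 n; G, W⟯) (X Y : Cₛ^∞⟮𝓡 n; F, V⟯) : C^∞⟮𝓡 n, M; ℝ⟯ :=
  P.rhoForm X (p.pairing α Y) - P.rhoForm Y (p.pairing α X) - p.pairing α (P.bracket X Y)

/-- The contraction `i_X d^φ α`. -/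
def iD (X : Cₛ^∞⟮𝓡 n; F, V⟯) (α : Cₛ^∞⟮𝓡 n; G, W⟯) : Cₛ^∞⟮𝓡 n; G, W⟯ :=
  p.ofFunctional
    { toFun := fun Y => P.dForm α X Y
      map_add' := fun Y Z => by
        simp only [dForm, rhoForm, map_add, rho_add, rho_add_left, P.bracket_add]; ring
      map_smul' := fun f Y => by
        simp only [dForm, rhoForm, map_add, map_smul, rho_mul, rho_smul_left, P.bracket_leibniz,
          smul_eq_mul, RingHom.id_apply, ← rho.eq_def]; ring }

/-- The Lie derivative `L^φ_X α = i_X d^φ α + d^φ ⟨α, X⟩`. -/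
def lie (X : Cₛ^∞⟮𝓡 n; F, V⟯) (α : Cₛ^∞⟮𝓡 n; G, W⟯) : Cₛ^∞⟮𝓡 n; G, W⟯ :=
  P.iD X α + P.dFun (p.pairing α X)

@[simp] theorem pairing_dFun (f : C^∞⟮𝓡 n, M; ℝ⟯) (X : Cₛ^∞⟮𝓡 n; F, V⟯) :
    p.pairing (P.dFun f) X = P.rhoForm X f := by
  simp [dFun]

@[simp] theorem pairing_iD (X Y : Cₛ^∞⟮𝓡 n; F, V⟯) (α : Cₛ^∞⟮𝓡 n; G, W⟯) :
    p.pairing (P.iD X α) Y = P.dForm α X Y := by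
  simp [iD]

theorem pairing_lie (X Y : Cₛ^∞⟮𝓡 n; F, V⟯) (α : Cₛ^∞⟮𝓡 n; G, W⟯) :
    p.pairing (P.lie X α) Y = P.rhoForm X (p.pairing α Y) - p.pairing α (P.bracket X Y) := by
  simp only [lie, map_add, LinearMap.add_apply, pairing_iD, pairing_dFun, dForm]; ring

/-- The `φ`-differential `(d^φ τ)(X, Y, Z, U)` of an alternating trilinear map `τ`. -/
def dThree (τ : Cₛ^∞⟮𝓡 n; F, V⟯ → Cₛ^∞⟮𝓡 n; F, V⟯ → Cₛ^∞⟮𝓡 n; F, V⟯ → C^∞⟮𝓡 n, M; ℝ⟯)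
    (X Y Z U : Cₛ^∞⟮𝓡 n; F, V⟯) : C^∞⟮𝓡 n, M; ℝ⟯ :=
  P.rhoForm X (τ Y Z U) - P.rhoForm Y (τ X Z U) + P.rhoForm Z (τ X Y U) - P.rhoForm U (τ X Y Z)
    - τ (P.bracket X Y) Z U + τ (P.bracket X Z) Y U - τ (P.bracket X U) Y Z
    - τ (P.bracket Y Z) X U + τ (P.bracket Y U) X Z - τ (P.bracket Z U) X Y

/-- The `3`-form `χ` is `d^φ`-closed. -/
def IsClosed (χ : ThreeForm n F V) : Prop :=
  ∀ X Y Z U, P.dThree χ.eval X Y Z U = 0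

/-- The bracket changed by a `C^∞(M)`-bilinear skew-symmetric map, with the same anchor and the same
`1`-form. -/
def twist (T : Cₛ^∞⟮𝓡 n; F, V⟯ →ₗ[C^∞⟮𝓡 n, M; ℝ⟯] Cₛ^∞⟮𝓡 n; F, V⟯ →ₗ[C^∞⟮𝓡 n, M; ℝ⟯]
    Cₛ^∞⟮𝓡 n; F, V⟯) (hT : ∀ X Y, T X Y = - T Y X) : AlmostJacobi p where
  anchor := P.anchor
  bracket X Y := P.bracket X Y + T X Y
  form := P.form
  bracket_add X Y Z := by rw [P.bracket_add, map_add]; abel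
  bracket_skew X Y := by rw [P.bracket_skew, hT]; abel
  bracket_leibniz X f Y := by rw [P.bracket_leibniz, map_smul, smul_add]; abel

/-- The deformation by a bundle map `N : V → V`: the anchor is `ρ ∘ N`, the bracket is
`[X, Y]_N = [N X, Y] + [X, N Y] - N [X, Y]` and the `1`-form is `N*φ`. -/
def deform (N : BundleMap n F V F V) : AlmostJacobi p where
  anchor :=
    { toFun := fun x => (P.anchor.toFun x).comp (N.toFun x)
      smooth := fun X => P.anchor.smooth (N.map X) }
  bracket X Y := P.bracket (N.map X) Y + P.bracket X (N.map Y) - N.map (P.bracket X Y)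
  form := p.transpose N P.form
  bracket_add X Y Z := by simp only [P.bracket_add, map_add]; abel
  bracket_skew X Y := by
    rw [P.bracket_skew (N.map X), P.bracket_skew X (N.map Y), P.bracket_skew X Y, map_neg]; abel
  bracket_leibniz X f Y := by
    simp only [P.bracket_leibniz, map_smul, map_add, smul_add, smul_sub]
    change _ = _ + VectorField.act (P.anchor.map (N.map X)) f • Y
    abel

end AlmostJacobi

/-- A bivector `Λ`, i.e. a smooth section of `∧²V`, given by the bundle map `Λ♯ : V* → V`,
`Λ(α, β) = ⟨β, Λ♯ α⟩`. -/
structure Bivector (p : Duality n F V G W) where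
  sharp : BundleMap n G W F V
  skew : ∀ x (w : W x), p.pair x w (sharp.toFun x w) = 0

namespace Bivector

variable {p : Duality n F V G W}

/-- `Λ(α, β) = ⟨β, Λ♯ α⟩`. -/
def eval (Λ : Bivector p) (α β : Cₛ^∞⟮𝓡 n; G, W⟯) : C^∞⟮𝓡 n, M; ℝ⟯ :=
  p.pairing β (Λ.sharp.map α)

theorem eval_skew (Λ : Bivector p) (α β : Cₛ^∞⟮𝓡 n; G, W⟯) : Λ.eval α β = - Λ.eval β α := by
  ext x
  have h := Λ.skew x (α x + β x)
  simp only [map_add, LinearMap.add_apply, Λ.skew] at h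
  change p.pair x (β x) (Λ.sharp.toFun x (α x)) = - p.pair x (α x) (Λ.sharp.toFun x (β x))
  linarith

/-- The bivector `NΛ`, with `(NΛ)♯ = N ∘ Λ♯`, for a bundle map `N` such that
`N ∘ Λ♯ = Λ♯ ∘ N*`. -/
def mulMap (Λ : Bivector p) (N : BundleMap n F V F V)
    (h : ∀ α, N.map (Λ.sharp.map α) = Λ.sharp.map (p.transpose N α)) : Bivector p where
  sharp :=
    { toFun := fun x => (N.toFun x).comp (Λ.sharp.toFun x)
      smooth := fun α => N.smooth (Λ.sharp.map α) }
  skew x w := by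
    obtain ⟨α, rfl⟩ := exists_section_eq (n := n) (F := G) x w
    have h1 : p.pairing α (N.map (Λ.sharp.map α)) = Λ.eval (p.transpose N α) α := by
      rw [h]; rfl
    have h2 : p.pairing α (N.map (Λ.sharp.map α)) = Λ.eval α (p.transpose N α) := by
      rw [eval, p.pairing_transpose]
    have h3 := congrArg (fun f : C^∞⟮𝓡 n, M; ℝ⟯ => f x) h1
    have h4 := congrArg (fun f : C^∞⟮𝓡 n, M; ℝ⟯ => f x) (h2.trans (Λ.eval_skew _ _))
    change p.pair x (α x) (N.toFun x (Λ.sharp.toFun x (α x))) = Λ.eval (p.transpose N α) α x at h3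
    change p.pair x (α x) (N.toFun x (Λ.sharp.toFun x (α x))) =
      - Λ.eval (p.transpose N α) α x at h4
    change p.pair x (α x) (N.toFun x (Λ.sharp.toFun x (α x))) = 0
    linarith

end Bivector

namespace AlmostJacobi

variable {p : Duality n F V G W} (P : AlmostJacobi p)

/-- The Schouten bracket `[Λ, Λ]`, evaluated on three `1`-forms:
`[Λ, Λ](α, β, γ) = 2 ∑ (⟨γ, [Λ♯ α, Λ♯ β]⟩ - ρ(Λ♯ α) Λ(β, γ))`, the sum being over the cyclic
permutations of `(α, β, γ)`. For `Λ = X ∧ Y` this is `2 [X, Y] ∧ X ∧ Y`. -/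
def schouten (Λ : Bivector p) (α β γ : Cₛ^∞⟮𝓡 n; G, W⟯) : C^∞⟮𝓡 n, M; ℝ⟯ :=
  2 * (p.pairing γ (P.bracket (Λ.sharp.map α) (Λ.sharp.map β))
        - P.rho (Λ.sharp.map α) (Λ.eval β γ)
      + (p.pairing α (P.bracket (Λ.sharp.map β) (Λ.sharp.map γ))
        - P.rho (Λ.sharp.map β) (Λ.eval γ α))
      + (p.pairing β (P.bracket (Λ.sharp.map γ) (Λ.sharp.map α))
        - P.rho (Λ.sharp.map γ) (Λ.eval α β)))

/-- The Schouten-Jacobi bracket `[Λ, Λ]^φ = [Λ, Λ] + 2 Λ ∧ i_φ Λ`, evaluated on three `1`-forms,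
where `i_φ Λ = Λ♯ φ`. -/
def schoutenJacobi (Λ : Bivector p) (α β γ : Cₛ^∞⟮𝓡 n; G, W⟯) : C^∞⟮𝓡 n, M; ℝ⟯ :=
  P.schouten Λ α β γ + 2 * (Λ.eval α β * p.pairing γ (Λ.sharp.map P.form)
    + Λ.eval β γ * p.pairing α (Λ.sharp.map P.form)
    + Λ.eval γ α * p.pairing β (Λ.sharp.map P.form))

/-- The structure on the dual bundle defined by a bivector `Λ`: the anchor is `ρ ∘ Λ♯`, the bracket
is `[α, β]_Λ = L^φ_{Λ♯ α} β - L^φ_{Λ♯ β} α - d^φ (Λ(α, β))`, and the section of the dual of the dual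
bundle is `W = - Λ♯ φ`. -/
def koszul (Λ : Bivector p) : AlmostJacobi p.flip where
  anchor :=
    { toFun := fun x => (P.anchor.toFun x).comp (Λ.sharp.toFun x)
      smooth := fun α => P.anchor.smooth (Λ.sharp.map α) }
  bracket α β := P.lie (Λ.sharp.map α) β - P.lie (Λ.sharp.map β) α - P.dFun (Λ.eval α β)
  form := - Λ.sharp.map P.form
  bracket_add α β γ := p.ext_left fun X => by
    simp only [map_sub, map_add, LinearMap.sub_apply, LinearMap.add_apply, pairing_lie,
      pairing_dFun, rhoForm, rho_add, rho_add_left, Bivector.eval, P.bracket_add_left]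
    ring
  bracket_skew α β := p.ext_left fun X => by
    rw [Λ.eval_skew α β]
    have h0 : P.rho X (0 : C^∞⟮𝓡 n, M; ℝ⟯) = 0 := by
      have := P.rho_add X 0 0
      simpa using this
    have h1 : P.rho X (- Λ.eval β α) = - P.rho X (Λ.eval β α) := by
      have := P.rho_add X (Λ.eval β α) (- Λ.eval β α)
      rw [add_neg_cancel, h0] at this
      linear_combination - this
    simp only [map_sub, map_neg, LinearMap.sub_apply, LinearMap.neg_apply, pairing_lie,
      pairing_dFun, rhoForm, h1]
    ring
  bracket_leibniz α f β := p.ext_left fun X => by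
    have h : p.pairing α (Λ.sharp.map β) = - p.pairing β (Λ.sharp.map α) := Λ.eval_skew β α
    have hr : VectorField.act (BundleMap.map (n := n)
      { toFun := fun x => (P.anchor.toFun x).comp (Λ.sharp.toFun x)
        smooth := fun α => P.anchor.smooth (Λ.sharp.map α) } α) f = P.rho (Λ.sharp.map α) f := rfl
    rw [hr]
    simp only [map_sub, map_add, map_smul, LinearMap.sub_apply, LinearMap.add_apply,
      LinearMap.smul_apply, smul_eq_mul, pairing_lie,
      pairing_dFun, rhoForm, rho_mul, rho_smul_left, Bivector.eval, P.bracket_leibniz_left, h]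
    ring

/-- The bracket `[X, Y]' = [X, Y] - Λ♯ (χ(X, Y, ·))`, with the same anchor and `1`-form. -/
def twistBy (Λ : Bivector p) (χ : ThreeForm n F V) : AlmostJacobi p :=
  P.twist ((χ.contract p).compr₂ (- Λ.sharp.map)) fun X Y => by
    have : χ.contract p X Y = - χ.contract p Y X := p.ext_left fun Z => by
      rw [map_neg, LinearMap.neg_apply, χ.pairing_contract, χ.pairing_contract, χ.eval_swap₁]
    simp [this]

/-- The twist of the structure on the dual bundle defined by a bivector `Λ` by a `3`-form `χ`: the
bracket is `[α, β]_Λ + χ(Λ♯ α, Λ♯ β, ·)`. -/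
def koszulTwisted (Λ : Bivector p) (χ : ThreeForm n F V) : AlmostJacobi p.flip :=
  (P.koszul Λ).twist ((χ.contract p).compl₁₂ Λ.sharp.map Λ.sharp.map) fun α β => by
    refine p.ext_left fun Z => ?_
    rw [map_neg, LinearMap.neg_apply, LinearMap.compl₁₂_apply, LinearMap.compl₁₂_apply,
      χ.pairing_contract, χ.pairing_contract, χ.eval_swap₁]

/-- The differential `d'` of `1`-forms that belongs to `[·,·]'` is `d^φ α - i_{Λ♯ α} χ`. -/
theorem twistBy_dForm (Λ : Bivector p) (χ : ThreeForm n F V) (α : Cₛ^∞⟮𝓡 n; G, W⟯)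
    (X Y : Cₛ^∞⟮𝓡 n; F, V⟯) :
    (P.twistBy Λ χ).dForm α X Y = P.dForm α X Y - χ.eval (Λ.sharp.map α) X Y := by
  have h : p.pairing α (Λ.sharp.map (χ.contract p X Y)) = - χ.eval (Λ.sharp.map α) X Y := by
    have := Λ.eval_skew (χ.contract p X Y) α
    rw [Bivector.eval, Bivector.eval, χ.pairing_contract, χ.eval_swap₂, χ.eval_swap₁] at this
    rw [this]; ring
  have h' : (P.twistBy Λ χ).bracket X Y =
      P.bracket X Y - Λ.sharp.map (χ.contract p X Y) := by
    simp [twistBy, twist, sub_eq_add_neg]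
  change P.rhoForm X _ - P.rhoForm Y _ - p.pairing α ((P.twistBy Λ χ).bracket X Y) = _
  rw [h', map_sub, h, dForm]; ring

end AlmostJacobi

end Algebroids

end Structures

section Courant

variable {n : ℕ} {M : Type*} [TopologicalSpace M] [ChartedSpace (EuclideanSpace ℝ (Fin n)) M]
  [IsManifold (𝓡 n) ∞ M]
  {F : Type*} [NormedAddCommGroup F] [NormedSpace ℝ F] [FiniteDimensional ℝ F]
  {E : M → Type*} [TopologicalSpace (TotalSpace F E)]
  [∀ x, AddCommGroup (E x)] [∀ x, Module ℝ (E x)] [∀ x, TopologicalSpace (E x)]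
  [FiberBundle F E] [VectorBundle ℝ F E]

variable (n F E) in
/-- The data of a Courant-Jacobi algebroid on a vector bundle `E` over `M`: a fiberwise
nondegenerate symmetric bilinear form, a vector bundle map `(ρ, θ) : E → TM ⊕ ℝ`, and a bracket of
smooth sections. -/
structure CourantJacobiData where
  pairing : ∀ x, E x →ₗ[ℝ] E x →ₗ[ℝ] ℝ
  pairing_smooth : ∀ e₁ e₂ : Cₛ^∞⟮𝓡 n; F, E⟯,
    ContMDiff (𝓡 n) 𝓘(ℝ, ℝ) ∞ fun x => pairing x (e₁ x) (e₂ x)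
  pairing_symm : ∀ x u v, pairing x u v = pairing x v u
  pairing_nondegenerate : ∀ x, (pairing x).Nondegenerate
  anchor : BundleMap n F E (EuclideanSpace ℝ (Fin n)) (TangentSpace (𝓡 n) : M → Type _)
  theta : ∀ x, E x →ₗ[ℝ] ℝ
  theta_smooth : ∀ e : Cₛ^∞⟮𝓡 n; F, E⟯, ContMDiff (𝓡 n) 𝓘(ℝ, ℝ) ∞ fun x => theta x (e x)
  bracket : Cₛ^∞⟮𝓡 n; F, E⟯ → Cₛ^∞⟮𝓡 n; F, E⟯ → Cₛ^∞⟮𝓡 n; F, E⟯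

namespace CourantJacobiData

variable (D : CourantJacobiData n F E)

/-- The function `⟨e₁, e₂⟩`. -/
def pair (e₁ e₂ : Cₛ^∞⟮𝓡 n; F, E⟯) : C^∞⟮𝓡 n, M; ℝ⟯ :=
  ⟨fun x => D.pairing x (e₁ x) (e₂ x), D.pairing_smooth e₁ e₂⟩

/-- The action of `(ρ, θ)(e) ∈ Γ(TM ⊕ ℝ)` on functions: `f ↦ ρ(e) f + θ(e) f`. -/
def act (e : Cₛ^∞⟮𝓡 n; F, E⟯) (f : C^∞⟮𝓡 n, M; ℝ⟯) : C^∞⟮𝓡 n, M; ℝ⟯ :=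
  VectorField.act (D.anchor.map e) f + ⟨fun x => D.theta x (e x), D.theta_smooth e⟩ * f

/-- The data form a Courant-Jacobi algebroid: the bracket `e₁ ∘ e₂` is `ℝ`-bilinear and
* `e₁ ∘ (e₂ ∘ e₃) = (e₁ ∘ e₂) ∘ e₃ + e₂ ∘ (e₁ ∘ e₃)`,
* `(ρ, θ)(e₁) · ⟨e₂, e₃⟩ = ⟨e₁, e₂ ∘ e₃ + e₃ ∘ e₂⟩`,
* `(ρ, θ)(e₁) · ⟨e₂, e₃⟩ = ⟨e₁ ∘ e₂, e₃⟩ + ⟨e₂, e₁ ∘ e₃⟩`. -/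
structure IsCourantJacobi : Prop where
  add_left : ∀ e₁ e₂ e₃, D.bracket (e₁ + e₂) e₃ = D.bracket e₁ e₃ + D.bracket e₂ e₃
  add_right : ∀ e₁ e₂ e₃, D.bracket e₁ (e₂ + e₃) = D.bracket e₁ e₂ + D.bracket e₁ e₃
  smul_left : ∀ (c : ℝ) e₁ e₂, D.bracket (c • e₁) e₂ = c • D.bracket e₁ e₂
  smul_right : ∀ (c : ℝ) e₁ e₂, D.bracket e₁ (c • e₂) = c • D.bracket e₁ e₂
  jacobi : ∀ e₁ e₂ e₃, D.bracket e₁ (D.bracket e₂ e₃) =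
    D.bracket (D.bracket e₁ e₂) e₃ + D.bracket e₂ (D.bracket e₁ e₃)
  act_pair : ∀ e₁ e₂ e₃,
    D.act e₁ (D.pair e₂ e₃) = D.pair e₁ (D.bracket e₂ e₃ + D.bracket e₃ e₂)
  act_pair_eq : ∀ e₁ e₂ e₃,
    D.act e₁ (D.pair e₂ e₃) = D.pair (D.bracket e₁ e₂) e₃ + D.pair e₂ (D.bracket e₁ e₃)

/-- The vector `u` of `E x` with `⟨u, v⟩ = l v` for all `v`. -/
def sharp (x : M) (l : E x →ₗ[ℝ] ℝ) : E x :=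
  haveI : FiniteDimensional ℝ (E x) := VectorBundle.finiteDimensional ℝ F E x
  (LinearMap.BilinForm.toDual (D.pairing x) (D.pairing_nondegenerate x)).symm l

end CourantJacobiData
end Courant

section Double

variable {n : ℕ} {M : Type*} [TopologicalSpace M] [ChartedSpace (EuclideanSpace ℝ (Fin n)) M]
  [IsManifold (𝓡 n) ∞ M] [T2Space M]
  {F : Type*} [NormedAddCommGroup F] [NormedSpace ℝ F] [FiniteDimensional ℝ F]
  {V : M → Type*} [TopologicalSpace (TotalSpace F V)]
  [∀ x, AddCommGroup (V x)] [∀ x, Module ℝ (V x)] [∀ x, TopologicalSpace (V x)]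
  [FiberBundle F V] [VectorBundle ℝ F V] [ContMDiffVectorBundle ∞ F V (𝓡 n)]
  {G : Type*} [NormedAddCommGroup G] [NormedSpace ℝ G] [FiniteDimensional ℝ G]
  {W : M → Type*} [TopologicalSpace (TotalSpace G W)]
  [∀ x, AddCommGroup (W x)] [∀ x, Module ℝ (W x)] [∀ x, TopologicalSpace (W x)]
  [FiberBundle G W] [VectorBundle ℝ G W] [ContMDiffVectorBundle ∞ G W (𝓡 n)]

/-- The section `α + X` of `W ⊕ V`. -/
def directSum (α : Cₛ^∞⟮𝓡 n; G, W⟯) (X : Cₛ^∞⟮𝓡 n; F, V⟯) : Cₛ^∞⟮𝓡 n; G × F, W ×ᵇ V⟯ :=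
  ⟨fun x => (α x, X x), fun x => (contMDiffAt_section x).2
    (((contMDiffAt_section x).1 (α.contMDiff x)).prodMk_space
      ((contMDiffAt_section x).1 (X.contMDiff x)))⟩

/-- The component in `W` of a section of `W ⊕ V`. -/
def fstSection (e : Cₛ^∞⟮𝓡 n; G × F, W ×ᵇ V⟯) : Cₛ^∞⟮𝓡 n; G, W⟯ :=
  ⟨fun x => (e x).1, fun x => (contMDiffAt_section x).2
    ((ContinuousLinearMap.fst ℝ G F).contMDiff.contMDiffAt.comp x
      ((contMDiffAt_section x).1 (e.contMDiff x)))⟩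

/-- The component in `V` of a section of `W ⊕ V`. -/
def sndSection (e : Cₛ^∞⟮𝓡 n; G × F, W ×ᵇ V⟯) : Cₛ^∞⟮𝓡 n; F, V⟯ :=
  ⟨fun x => (e x).2, fun x => (contMDiffAt_section x).2
    ((ContinuousLinearMap.snd ℝ G F).contMDiff.contMDiffAt.comp x
      ((contMDiffAt_section x).1 (e.contMDiff x)))⟩

/-- The double `W ⊕ V` of two structures on bundles `V` and `W` in duality and a `3`-form `χ` on `V`,
with the pairing `⟨α + X, β + Y⟩ = (⟨α, Y⟩ + ⟨β, X⟩) / 2`, the anchor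
`α + X ↦ (ρ_W(α) + ρ_V(X), ⟨α, w⟩ + ⟨φ, X⟩)`, where `φ` and `w` are the `1`-forms of the structures on
`V` and `W`, and the bracket
`(α + X) ∘ (β + Y) = ([α, β]_W + L_X β - i_Y d α + χ(X, Y, ·)) + ([X, Y]_V + L_α Y - i_β d X)`,
where `d` and `L` are the differentials and Lie derivatives shifted by `φ` and by `w`. -/
def double {p : Duality n F V G W} (P : AlmostJacobi p) (Q : AlmostJacobi p.flip)
    (χ : ThreeForm n F V) : CourantJacobiData n (G × F) (W ×ᵇ V) where
  pairing x := (1 / 2 : ℝ) •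
    ((p.pair x).compl₁₂ (LinearMap.fst ℝ (W x) (V x)) (LinearMap.snd ℝ (W x) (V x)) +
      ((p.pair x).compl₁₂ (LinearMap.fst ℝ (W x) (V x)) (LinearMap.snd ℝ (W x) (V x))).flip)
  pairing_smooth e₁ e₂ := by
    have h := contMDiff_const (c := (1 / 2 : ℝ)) (I := 𝓡 n) (I' := 𝓘(ℝ, ℝ)) (n := ∞) |>.mul
      ((p.smooth (fstSection e₁) (sndSection e₂)).add (p.smooth (fstSection e₂) (sndSection e₁)))
    exact h
  pairing_symm x u v := by
    simp only [LinearMap.smul_apply, LinearMap.add_apply, LinearMap.flip_apply]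
    rw [add_comm]
  pairing_nondegenerate x := by
    have key : ∀ u : W x × V x, (∀ v : W x × V x,
        p.pair x u.1 v.2 + p.pair x v.1 u.2 = 0) → u = 0 := fun u h => by
      refine Prod.ext (p.separating_left x _ fun v => ?_) (p.separating_right x _ fun w => ?_)
      · simpa using h (0, v)
      · simpa using h (w, 0)
    refine ⟨fun u h => key u fun v => ?_, fun u h => key u fun v => ?_⟩
    · have := h v
      simp only [LinearMap.smul_apply, LinearMap.add_apply, LinearMap.flip_apply,
        LinearMap.compl₁₂_apply, LinearMap.fst_apply, LinearMap.snd_apply, smul_eq_mul] at this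
      linarith
    · have := h v
      simp only [LinearMap.smul_apply, LinearMap.add_apply, LinearMap.flip_apply,
        LinearMap.compl₁₂_apply, LinearMap.fst_apply, LinearMap.snd_apply, smul_eq_mul] at this
      linarith
  anchor :=
    { toFun := fun x => (Q.anchor.toFun x).comp (ContinuousLinearMap.fst ℝ (W x) (V x)) +
        (P.anchor.toFun x).comp (ContinuousLinearMap.snd ℝ (W x) (V x))
      smooth := fun e => (Q.anchor.map (fstSection e) + P.anchor.map (sndSection e)).contMDiff }
  theta x := (p.pair x).flip (Q.form x) ∘ₗ LinearMap.fst ℝ (W x) (V x) +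
    p.pair x (P.form x) ∘ₗ LinearMap.snd ℝ (W x) (V x)
  theta_smooth e := (p.smooth (fstSection e) Q.form).add (p.smooth P.form (sndSection e))
  bracket e₁ e₂ :=
    directSum
      (Q.bracket (fstSection e₁) (fstSection e₂) + P.lie (sndSection e₁) (fstSection e₂)
        - P.iD (sndSection e₂) (fstSection e₁) + χ.contract p (sndSection e₁) (sndSection e₂))
      (P.bracket (sndSection e₁) (sndSection e₂) + Q.lie (fstSection e₁) (sndSection e₂)
        - Q.iD (fstSection e₂) (sndSection e₁))

end Double

section Morphisms

variable {n : ℕ} {M : Type*} [TopologicalSpace M] [ChartedSpace (EuclideanSpace ℝ (Fin n)) M]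
  [IsManifold (𝓡 n) ∞ M]
  {F : Type*} [NormedAddCommGroup F] [NormedSpace ℝ F] [FiniteDimensional ℝ F]
  {E : M → Type*} [TopologicalSpace (TotalSpace F E)]
  [∀ x, AddCommGroup (E x)] [∀ x, Module ℝ (E x)] [∀ x, TopologicalSpace (E x)]
  [FiberBundle F E] [VectorBundle ℝ F E]
  {n' : ℕ} {M' : Type*} [TopologicalSpace M'] [ChartedSpace (EuclideanSpace ℝ (Fin n')) M']
  [IsManifold (𝓡 n') ∞ M']
  {F' : Type*} [NormedAddCommGroup F'] [NormedSpace ℝ F'] [FiniteDimensional ℝ F']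
  {E' : M' → Type*} [TopologicalSpace (TotalSpace F' E')]
  [∀ x, AddCommGroup (E' x)] [∀ x, Module ℝ (E' x)] [∀ x, TopologicalSpace (E' x)]
  [FiberBundle F' E'] [VectorBundle ℝ F' E']

variable (n F E n' F' E') in
/-- A smooth section of the bundle `E × E'` over `M × M'`, whose fiber at `(x, y)` is `E x × E' y`,
written as a finite sum `∑ f_i (a_i, b_i)` with smooth functions `f_i` on `M × M'` and smooth
sections `a_i` of `E` and `b_i` of `E'`. -/
structure ProdSection where
  size : ℕ
  coeff : Fin size → C^∞⟮(𝓡 n).prod (𝓡 n'), M × M'; ℝ⟯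
  left : Fin size → Cₛ^∞⟮𝓡 n; F, E⟯
  right : Fin size → Cₛ^∞⟮𝓡 n'; F', E'⟯

/-- The value of a section of `E × E'` at `(x, y)`. -/
def ProdSection.value (s : ProdSection n F E n' F' E') (x : M) (y : M') : E x × E' y :=
  ∑ i, s.coeff i (x, y) • (s.left i x, s.right i y)

namespace CourantJacobiData

variable (D : CourantJacobiData n F E) (D' : CourantJacobiData n' F' E')

/-- The bilinear form `⟨·,·⟩ - ⟨·,·⟩'` of `E × Ē'`, where `Ē'` is `E'` with the opposite form. -/
def diffPairing (x : M) (y : M') (u v : E x × E' y) : ℝ :=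
  D.pairing x u.1 v.1 - D'.pairing y u.2 v.2

/-- The linear form `df ∘ ρ` on the fiber `E x`. -/
def dAnchor (f : M → ℝ) (x : M) : E x →ₗ[ℝ] ℝ :=
  (mfderiv (𝓡 n) 𝓘(ℝ, ℝ) f x).toLinearMap ∘ₗ (D.anchor.toFun x).toLinearMap

/-- The function `(ρ(a), ρ'(b)) f` on `M × M'`, evaluated at `(x, y)`. -/
def prodAct (a : Cₛ^∞⟮𝓡 n; F, E⟯) (b : Cₛ^∞⟮𝓡 n'; F', E'⟯) (f : M × M' → ℝ) (x : M) (y : M') : ℝ :=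
  D.dAnchor (fun x' => f (x', y)) x (a x) + D'.dAnchor (fun y' => f (x, y')) y (b y)

/-- The bracket of `E × Ē'`, evaluated at `(x, y)`: it is `(a, b) ∘ (c, d) = (a ∘ c, b ∘ d)` for sections
`a, c` of `E` and `b, d` of `E'`, and is extended to all sections of `E × E'` by the Leibniz rules
`e₁ ∘ (g e₂) = g (e₁ ∘ e₂) + (ρ(e₁) g) e₂` and
`(f e₁) ∘ e₂ = f (e₁ ∘ e₂) - (ρ(e₂) f) e₁ + ⟨e₁, e₂⟩ ρ*(df)`, that hold in every Courant-Jacobi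
algebroid. Here `⟨e, ρ*(df)⟩ = ρ(e) f`. -/
def prodBracket (s t : ProdSection n F E n' F' E') (x : M) (y : M') : E x × E' y :=
  ∑ i, ∑ j,
    ((s.coeff i (x, y) * t.coeff j (x, y)) •
        (D.bracket (s.left i) (t.left j) x, D'.bracket (s.right i) (t.right j) y)
      + (s.coeff i (x, y) * prodAct D D' (s.left i) (s.right i) (t.coeff j) x y) •
        (t.left j x, t.right j y)
      - (t.coeff j (x, y) * prodAct D D' (t.left j) (t.right j) (s.coeff i) x y) •
        (s.left i x, s.right i y)
      + (t.coeff j (x, y) *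
          diffPairing D D' x y (s.left i x, s.right i y) (t.left j x, t.right j y)) •
        (D.sharp x (D.dAnchor (fun x' => s.coeff i (x', y)) x),
          - D'.sharp y (D'.dAnchor (fun y' => s.coeff i (x, y')) y)))

/-- A subspace of a fiber of `E × Ē'` is isotropic. -/
def IsIsotropic (x : M) (y : M') (K : Submodule ℝ (E x × E' y)) : Prop :=
  ∀ u ∈ K, ∀ v ∈ K, diffPairing D D' x y u v = 0

end CourantJacobiData

/-- A Courant-Jacobi algebroid morphism between two Courant-Jacobi algebroids `E → M` and `E' → M'`,
over a smooth map `φ : M → M'`: a Dirac structure `L` in `E × Ē'` supported on the graph of `φ`.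
The fiber of `L` over the point `(x, φ x)` of the graph is `L x`. It depends smoothly on `x`, it is
maximal isotropic, its image under the anchors `(ρ, θ)` and `(ρ', θ')` is tangent to the graph of
`φ`, with the same component in `ℝ` on both sides, and the sections of `E × Ē'` whose restrictions
to the graph are sections of `L` are closed under the bracket. -/
structure IsCourantJacobiMorphism (D : CourantJacobiData n F E) (D' : CourantJacobiData n' F' E')
    (φ : C^∞⟮𝓡 n, M; 𝓡 n', M'⟯) (L : ∀ x, Submodule ℝ (E x × E' (φ x))) : Prop where
  left : D.IsCourantJacobi
  right : D'.IsCourantJacobi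
  rank_locally_constant : ∀ x₀, ∀ᶠ x in 𝓝 x₀, Module.finrank ℝ (L x) = Module.finrank ℝ (L x₀)
  exists_section : ∀ x₀, ∀ u ∈ L x₀, ∃ s : ProdSection n F E n' F' E',
    s.value x₀ (φ x₀) = u ∧ ∀ᶠ x in 𝓝 x₀, s.value x (φ x) ∈ L x
  isotropic : ∀ x, CourantJacobiData.IsIsotropic D D' x (φ x) (L x)
  maximal : ∀ x (K : Submodule ℝ (E x × E' (φ x))),
    CourantJacobiData.IsIsotropic D D' x (φ x) K → L x ≤ K → K = L x
  anchor : ∀ x, ∀ u ∈ L x,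
    mfderiv (𝓡 n) (𝓡 n') φ x (D.anchor.toFun x u.1) = D'.anchor.toFun (φ x) u.2 ∧
      D.theta x u.1 = D'.theta (φ x) u.2
  closed : ∀ s t : ProdSection n F E n' F' E',
    (∀ x, s.value x (φ x) ∈ L x) → (∀ x, t.value x (φ x) ∈ L x) →
      ∀ x, CourantJacobiData.prodBracket D D' s t x (φ x) ∈ L x

end Morphisms

section Nijenhuis

variable {n : ℕ} {M : Type*} [TopologicalSpace M] [ChartedSpace (EuclideanSpace ℝ (Fin n)) M]
  [IsManifold (𝓡 n) ∞ M] [T2Space M]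
  {F : Type*} [NormedAddCommGroup F] [NormedSpace ℝ F] [FiniteDimensional ℝ F]
  {V : M → Type*} [TopologicalSpace (TotalSpace F V)]
  [∀ x, AddCommGroup (V x)] [∀ x, Module ℝ (V x)] [∀ x, TopologicalSpace (V x)]
  [FiberBundle F V] [VectorBundle ℝ F V] [ContMDiffVectorBundle ∞ F V (𝓡 n)]

/-- The function `i_N χ(X, Y, Z) = χ(N X, Y, Z) + χ(X, N Y, Z) + χ(X, Y, N Z)`. -/
def ThreeForm.insert (χ : ThreeForm n F V) (N : BundleMap n F V F V)
    (X Y Z : Cₛ^∞⟮𝓡 n; F, V⟯) : C^∞⟮𝓡 n, M; ℝ⟯ :=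
  χ.eval (N.map X) Y Z + χ.eval X (N.map Y) Z + χ.eval X Y (N.map Z)

variable (n F V) in
/-- A Jacobi quasi-Nijenhuis algebroid: a Jacobi algebroid `(V, φ)` with a bivector `Λ` such that
`[Λ, Λ]^φ = 0`, a vector bundle map `N : V → V` that is compatible with `Λ`, and a `3`-form `χ` such
that `d^φ χ = 0`, `d^φ (i_N χ) = 0` and
`[N X, N Y] - N [X, Y]_N = - Λ♯ (i_{X ∧ Y} χ) = Λ♯ (χ(X, Y, ·))`, with `i_{X ∧ Y} = i_X ∘ i_Y`. -/
structure JacobiQuasiNijenhuis where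
  alg : AlmostJacobi (stdDuality n F V)
  isJacobi : alg.IsJacobi
  bivector : Bivector (stdDuality n F V)
  schoutenJacobi_eq_zero : ∀ α β γ, alg.schoutenJacobi bivector α β γ = 0
  N : BundleMap n F V F V
  map_sharp : ∀ α, N.map (bivector.sharp.map α) =
    bivector.sharp.map ((stdDuality n F V).transpose N α)
  concomitant : ∀ α β, (alg.koszul (bivector.mulMap N map_sharp)).bracket α β =
    (alg.koszul bivector).bracket ((stdDuality n F V).transpose N α) β
      + (alg.koszul bivector).bracket α ((stdDuality n F V).transpose N β)
      - (stdDuality n F V).transpose N ((alg.koszul bivector).bracket α β)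
  threeForm : ThreeForm n F V
  closed : alg.IsClosed threeForm
  torsion : ∀ X Y, alg.bracket (N.map X) (N.map Y) - N.map ((alg.deform N).bracket X Y) =
    bivector.sharp.map (threeForm.contract (stdDuality n F V) X Y)
  closed_insert : ∀ X Y Z U, alg.dThree (threeForm.insert N) X Y Z U = 0

namespace JacobiQuasiNijenhuis

variable (J : JacobiQuasiNijenhuis n F V)

/-- The bivector `NΛ`. -/
def mulBivector : Bivector (stdDuality n F V) := J.bivector.mulMap J.N J.map_sharp

/-- The double `V* ⊕ V` of the quasi-Jacobi bialgebroid `(V*_Λ, -Λ♯ φ, d_N^{N*φ}, χ)`, where `χ` is the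
`3`-form of the Jacobi quasi-Nijenhuis algebroid. -/
def double : CourantJacobiData n ((F →L[ℝ] ℝ) × F) (Dual V ×ᵇ V) :=
  JQN.double (J.alg.deform J.N) (J.alg.koszul J.bivector) J.threeForm

/-- The double `V* ⊕ V` of the quasi-Jacobi bialgebroid on `V*` that is defined by the bivector `NΛ`
and a `3`-form `ψ`: the bracket on `V*` is `[α, β]_{NΛ} + ψ(NΛ♯ α, NΛ♯ β, ·)`, with cocycle
`- NΛ♯ φ`, and the differential is given by `d' f = d f` and `d' α = d α - i_{NΛ♯ α} ψ`, shifted by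
`φ`. -/
def twistedDouble (ψ : ThreeForm n F V) : CourantJacobiData n ((F →L[ℝ] ℝ) × F) (Dual V ×ᵇ V) :=
  JQN.double (J.alg.twistBy J.mulBivector ψ) (J.alg.koszulTwisted J.mulBivector ψ) ψ

/-- The graph `{(N a + α, a + N*α)}`, for `a ∈ V` and `α ∈ V*`. -/
def graph (x : M) : Submodule ℝ ((Dual V ×ᵇ V) x × (Dual V ×ᵇ V) x) where
  carrier := {u | ∃ (a : V x) (α : Dual V x), u = ((α, J.N.toFun x a), (α.comp (J.N.toFun x), a))}
  zero_mem' := ⟨0, 0, by simp; rfl⟩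
  add_mem' := by
    rintro _ _ ⟨a, α, rfl⟩ ⟨b, β, rfl⟩
    exact ⟨a + b, α + β, by simp⟩
  smul_mem' := by
    rintro c _ ⟨a, α, rfl⟩
    exact ⟨c • a, c • α, by simp⟩

end JacobiQuasiNijenhuis
end Nijenhuis

end JQN

end

set_option linter.unusedSimpArgs false

noncomputable section

/-! Both doubles are obtained algebraically from one bracket on `Γ(A*) ⊕ Γ(A)`, the standard bracket
`m` (`dorfman`) of the Jacobi algebroid `(A, φ)`. Write `A·m` for the deformation `m(A x, y) + m(x,
A y) - A m(x, y)`, and `J(m, m')` for the polarized Jacobiator. Deformation is a derivation of `J`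
(`jacobiator_deform`), and this alone replaces most computations with four-term Jacobi identities.

Let `D = -N* + N`, `E = π♯` and let `c` be the bracket defined by `φ(X, Y, ·)`. The bracket of
`E_π^φ`, with `φ` the `3`-form, is `(D + E)·m + c` (`doubleBracket_deform`). The axioms on `π`, `N`
and the torsion say that `D·D·m = N²·m - 2 E·c`, that `D·E·m` and `E·D·m` cancel, and that `E·E·m =
0`. The two closedness conditions say that `J(m, c) = 0` and `J(m, D·c) = 0`. Together with the
Jacobi identity of `m` this yields the Jacobi identity of the sum (`compatible_deform_add`).

The bracket of `E_{Nπ}^ψ` is conjugate, under the shear `α + X ↦ α + (X + Nπ♯ α)`, to the standard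
bracket twisted by the closed form `ψ` (`doubleBracket_twist`). The only obstruction is the defect
of `Nπ♯` as a morphism of brackets, which has to equal `Nπ♯ ψ(Nπ♯ α, Nπ♯ β, ·)`. This is the torsion
identity on the image of `π♯`, rewritten with `φ = N*ψ` (`bracket_mulBivector`).

The subbundle `F` equals its own orthogonal, which gives maximal isotropy. Its sections are the
pairs `((α, N X), (N*α, X))`, and closure under the bracket amounts to `doubleBracket_snd` and
`doubleBracket_fst`, consequences of the torsion identity and the concomitant. Sections of the
exterior product have coefficients on `M × M`; `prodBracket_diag_mem` reduces them to pairs of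
sections over `M`, because the error consists of elements `(ρ*ω, ρ'*ω)`, which are orthogonal to `F`
and hence in `F`. -/

namespace JQN


/-! ### Calculus of biadditive brackets: deformations and polarized Jacobiators -/

section BracketAlgebra

variable {E : Type*} [AddCommGroup E]

/-- A biadditive map, from its values. -/
def biadd (f : E → E → E) (hl : ∀ x y z, f (x + y) z = f x z + f y z)
    (hr : ∀ x y z, f x (y + z) = f x y + f x z) : E →+ E →+ E :=
  AddMonoidHom.mk' (fun x => AddMonoidHom.mk' (f x) (hr x)) fun x y =>
    AddMonoidHom.ext fun z => hl x y z

/-- The bracket `m` deformed by an endomorphism `A`: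
`(x, y) ↦ m (A x, y) + m (x, A y) - A (m (x, y))`. -/
def deformBracket (A : E →+ E) (m : E →+ E →+ E) : E →+ E →+ E :=
  biadd (fun x y => m (A x) y + m x (A y) - A (m x y))
    (fun x y z => by simp only [map_add, AddMonoidHom.add_apply]; abel)
    (fun x y z => by simp only [map_add]; abel)

theorem deformBracket_apply (A : E →+ E) (m : E →+ E →+ E) (x y : E) :
    deformBracket A m x y = m (A x) y + m x (A y) - A (m x y) := rfl

/-- The polarization of the Jacobiator: `jacobiator m m` is twice the Jacobiator of `m`. -/
def jacobiator (m m' : E →+ E →+ E) (x y z : E) : E :=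
  m x (m' y z) + m' x (m y z) - m (m' x y) z - m' (m x y) z - m y (m' x z) - m' y (m x z)

theorem jacobiator_comm (m m' : E →+ E →+ E) (x y z : E) :
    jacobiator m m' x y z = jacobiator m' m x y z := by
  simp only [jacobiator]; abel

theorem jacobiator_add (m m₁ m₂ : E →+ E →+ E) (x y z : E) :
    jacobiator m (m₁ + m₂) x y z = jacobiator m m₁ x y z + jacobiator m m₂ x y z := by
  simp only [jacobiator, map_add, AddMonoidHom.add_apply]; abel

theorem jacobiator_neg (m m' : E →+ E →+ E) (x y z : E) :
    jacobiator m (-m') x y z = - jacobiator m m' x y z := by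
  simp only [jacobiator, map_neg, AddMonoidHom.neg_apply]; abel

/-- The Leibniz rule for the action of endomorphisms on brackets: terms with `A` between an inner
and an outer bracket appear twice with opposite signs. Biadditivity is enough; no skew-symmetry
enters. -/
theorem jacobiator_deform (A : E →+ E) (m m' : E →+ E →+ E) (x y z : E) :
    jacobiator (deformBracket A m) m' x y z + jacobiator m (deformBracket A m') x y z =
      jacobiator m m' (A x) y z + jacobiator m m' x (A y) z + jacobiator m m' x y (A z)
        - A (jacobiator m m' x y z) := by
  simp only [jacobiator, deformBracket_apply, map_add, map_sub, AddMonoidHom.add_apply,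
    AddMonoidHom.sub_apply]
  abel

/-- Two brackets are compatible if their polarized Jacobiator vanishes. -/
def Compatible (m m' : E →+ E →+ E) : Prop := ∀ x y z, jacobiator m m' x y z = 0

theorem Compatible.symm {m m' : E →+ E →+ E} (h : Compatible m m') : Compatible m' m :=
  fun x y z => by rw [jacobiator_comm, h]

/-- For a compatible pair the right side of the Leibniz rule vanishes, so a deformation moves from
one argument to the other at the cost of a sign. -/
theorem Compatible.jacobiator_deform {m m' : E →+ E →+ E} (h : Compatible m m') (A : E →+ E)
    (x y z : E) :
    jacobiator (deformBracket A m) m' x y z = - jacobiator m (deformBracket A m') x y z := by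
  have := JQN.jacobiator_deform A m m' x y z
  simp only [h _ _ _, map_zero, add_zero, sub_zero] at this
  exact eq_neg_of_add_eq_zero_left this

theorem Compatible.deform_left [IsAddTorsionFree E] {m : E →+ E →+ E} (h : Compatible m m)
    (A : E →+ E) : Compatible (deformBracket A m) m := fun x y z => by
  have := h.jacobiator_deform A x y z
  rw [jacobiator_comm m] at this
  -- Moving `A` across `J(m, m)` and using symmetry shows that the value is its own negative;
  -- torsion-freeness then makes it zero.
  exact self_eq_neg.1 this

theorem deformBracket_add (A : E →+ E) (m m' : E →+ E →+ E) :
    deformBracket A (m + m') = deformBracket A m + deformBracket A m' := by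
  ext x y
  simp only [deformBracket_apply, AddMonoidHom.add_apply, map_add]; abel

theorem add_deformBracket (A B : E →+ E) (m : E →+ E →+ E) :
    deformBracket (A + B) m = deformBracket A m + deformBracket B m := by
  ext x y
  simp only [deformBracket_apply, AddMonoidHom.add_apply, map_add]; abel

/-- Deformations represent endomorphisms up to the order of the commutator. -/
theorem deformBracket_comm (A B : E →+ E) (m : E →+ E →+ E) :
    deformBracket A (deformBracket B m) = deformBracket B (deformBracket A m)
      + deformBracket (B.comp A - A.comp B) m := by
  ext x y
  simp only [deformBracket_apply, AddMonoidHom.add_apply, AddMonoidHom.sub_apply, map_add, map_sub,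
    AddMonoidHom.comp_apply]
  abel

/-- If the second deformation of a Jacobi bracket `m` by `N + P` is a first deformation up to
`-2 P · c`, and the bracket `c` is compatible with `m` and with itself, as is `N · c` with `m`, then
`(N + P) · m + c` satisfies the Jacobi identity. -/
theorem compatible_deform_add [IsAddTorsionFree E] {m c : E →+ E →+ E} {N P S : E →+ E}
    (hm : Compatible m m) (hc : Compatible m c) (hcc : Compatible c c)
    (hN : Compatible m (deformBracket N c))
    (h : deformBracket (N + P) (deformBracket (N + P) m) =
      deformBracket S m - (deformBracket P c + deformBracket P c)) :
    Compatible (deformBracket (N + P) m + c) (deformBracket (N + P) m + c) := by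
  intro x y z
  -- With `A = N + P`, this is `J(A·m, A·m) = -J(m, A·A·m)`; after inserting `h` the `S` term drops
  -- out, leaving `2 J(m, P·c)`.
  have h1 := (hm.deform_left (N + P)).symm.jacobiator_deform (N + P) x y z
  rw [h, sub_eq_add_neg, jacobiator_add, jacobiator_neg, jacobiator_add,
    (hm.deform_left S).symm] at h1
  -- The cross term `2 J(A·m, c)` splits into a `P` part, equal to `-2 J(m, P·c)`, and an `N` part,
  -- equal to `-2 J(m, N·c) = 0`. The `P` part cancels what is left of `h1`.
  have h2 := hc.symm.jacobiator_deform P x y z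
  have h3 := hc.jacobiator_deform N x y z
  rw [hN, neg_zero] at h3
  rw [jacobiator_add, jacobiator_comm _ (deformBracket _ _), jacobiator_comm _ c, jacobiator_add,
    jacobiator_add, h1, hcc, jacobiator_comm m, h2, jacobiator_comm _ c, add_deformBracket,
    jacobiator_add, jacobiator_comm c (deformBracket N m), h3]
  abel

/-- In a nested bracket the inner `T'` meets the outer `T`, so only `T ∘ T' = id` is needed. -/
theorem Compatible.conj {m m' : E →+ E →+ E} (hm : Compatible m m) {T T' : E →+ E}
    (hT : ∀ x, T (T' x) = x) (h : ∀ x y, m' x y = T' (m (T x) (T y))) : Compatible m' m' := by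
  intro x y z
  have := congrArg T' (hm (T x) (T y) (T z))
  simpa only [jacobiator, h, hT, map_add, map_sub, map_zero] using this

theorem Compatible.add {m c : E →+ E →+ E} (hm : Compatible m m) (hc : Compatible m c)
    (hcc : Compatible c c) : Compatible (m + c) (m + c) := fun x y z => by
  rw [jacobiator_add, jacobiator_comm _ m, jacobiator_comm _ c, jacobiator_add, jacobiator_add,
    hm, hc, hcc, hc.symm]
  simp

end BracketAlgebra

/-! ### The standard bracket of a Jacobi algebroid and its twists by closed forms -/

section Dorfman

variable {n : ℕ} {M : Type*} [TopologicalSpace M] [ChartedSpace (EuclideanSpace ℝ (Fin n)) M]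
  [IsManifold (𝓡 n) ∞ M] [T2Space M]
  {F : Type*} [NormedAddCommGroup F] [NormedSpace ℝ F] [FiniteDimensional ℝ F]
  {V : M → Type*} [TopologicalSpace (TotalSpace F V)]
  [∀ x, AddCommGroup (V x)] [∀ x, Module ℝ (V x)] [∀ x, TopologicalSpace (V x)]
  [FiberBundle F V] [VectorBundle ℝ F V] [ContMDiffVectorBundle ∞ F V (𝓡 n)]
  {G : Type*} [NormedAddCommGroup G] [NormedSpace ℝ G] [FiniteDimensional ℝ G]
  {W : M → Type*} [TopologicalSpace (TotalSpace G W)]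
  [∀ x, AddCommGroup (W x)] [∀ x, Module ℝ (W x)] [∀ x, TopologicalSpace (W x)]
  [FiberBundle G W] [VectorBundle ℝ G W] [ContMDiffVectorBundle ∞ G W (𝓡 n)]
  {p : Duality n F V G W}

/-- Allows division by the factor `2` that polarization introduces. -/
instance : IsAddTorsionFree Cₛ^∞⟮𝓡 n; F, V⟯  where
  nsmul_right_injective k hk X Y h := by
    ext x
    have h' : k • X x = k • Y x := by
      simpa only [ContMDiffSection.coe_nsmul, Pi.smul_apply] using
        congrArg (fun s : Cₛ^∞⟮𝓡 n; F, V⟯ => s x) h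
    simpa [← Nat.cast_smul_eq_nsmul ℝ, hk] using h'

theorem Duality.ext_right (p : Duality n F V G W) {X Y : Cₛ^∞⟮𝓡 n; F, V⟯}
    (h : ∀ ξ, p.pairing ξ X = p.pairing ξ Y) : X = Y := p.flip.ext_left h

theorem Duality.transpose_add (p : Duality n F V G W) (N : BundleMap n F V F V)
    (ξ η : Cₛ^∞⟮𝓡 n; G, W⟯) : p.transpose N (ξ + η) = p.transpose N ξ + p.transpose N η :=
  p.ext_left fun X => by simp

namespace AlmostJacobi

variable (P : AlmostJacobi p)

theorem rhoForm_add (X : Cₛ^∞⟮𝓡 n; F, V⟯) (f g : C^∞⟮𝓡 n, M; ℝ⟯) :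
    P.rhoForm X (f + g) = P.rhoForm X f + P.rhoForm X g := by
  simp only [rhoForm, rho_add]; ring

theorem rhoForm_zero (X : Cₛ^∞⟮𝓡 n; F, V⟯) : P.rhoForm X 0 = 0 := by
  simpa using P.rhoForm_add X 0 0

theorem rhoForm_neg (X : Cₛ^∞⟮𝓡 n; F, V⟯) (f : C^∞⟮𝓡 n, M; ℝ⟯) :
    P.rhoForm X (-f) = - P.rhoForm X f := by
  have := P.rhoForm_add X f (-f)
  rw [add_neg_cancel, rhoForm_zero] at this
  linear_combination -this

theorem rhoForm_sub (X : Cₛ^∞⟮𝓡 n; F, V⟯) (f g : C^∞⟮𝓡 n, M; ℝ⟯) :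
    P.rhoForm X (f - g) = P.rhoForm X f - P.rhoForm X g := by
  rw [sub_eq_add_neg, rhoForm_add, rhoForm_neg, sub_eq_add_neg]

theorem rhoForm_neg_left (X : Cₛ^∞⟮𝓡 n; F, V⟯) (f : C^∞⟮𝓡 n, M; ℝ⟯) :
    P.rhoForm (-X) f = - P.rhoForm X f := by
  have := P.rhoForm_smul_left (-1) X f
  simpa using this

theorem rhoForm_sub_left (X Y : Cₛ^∞⟮𝓡 n; F, V⟯) (f : C^∞⟮𝓡 n, M; ℝ⟯) :
    P.rhoForm (X - Y) f = P.rhoForm X f - P.rhoForm Y f := by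
  rw [sub_eq_add_neg, rhoForm_add_left, rhoForm_neg_left, sub_eq_add_neg]

theorem rhoForm_mul (X : Cₛ^∞⟮𝓡 n; F, V⟯) (f g : C^∞⟮𝓡 n, M; ℝ⟯) :
    P.rhoForm X (f * g) = f * P.rhoForm X g + g * P.rho X f := by
  simp only [rhoForm, rho_mul]; ring

theorem bracket_zero (X : Cₛ^∞⟮𝓡 n; F, V⟯) : P.bracket X 0 = 0 := by
  simpa using P.bracket_add X 0 0

theorem bracket_neg (X Y : Cₛ^∞⟮𝓡 n; F, V⟯) : P.bracket X (-Y) = - P.bracket X Y := by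
  have := P.bracket_add X Y (-Y)
  rw [add_neg_cancel, bracket_zero] at this
  exact (neg_eq_of_add_eq_zero_right this.symm).symm

theorem bracket_neg_left (X Y : Cₛ^∞⟮𝓡 n; F, V⟯) : P.bracket (-X) Y = - P.bracket X Y := by
  rw [P.bracket_skew, bracket_neg, ← P.bracket_skew]

theorem lie_add_left (X Y : Cₛ^∞⟮𝓡 n; F, V⟯) (α : Cₛ^∞⟮𝓡 n; G, W⟯) :
    P.lie (X + Y) α = P.lie X α + P.lie Y α := p.ext_left fun Z => by
  simp only [map_add, LinearMap.add_apply, pairing_lie, rhoForm_add_left, bracket_add_left]; ring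

theorem lie_add (X : Cₛ^∞⟮𝓡 n; F, V⟯) (α β : Cₛ^∞⟮𝓡 n; G, W⟯) :
    P.lie X (α + β) = P.lie X α + P.lie X β := p.ext_left fun Z => by
  simp only [map_add, LinearMap.add_apply, pairing_lie, rhoForm_add]; ring

theorem iD_add_left (X Y : Cₛ^∞⟮𝓡 n; F, V⟯) (α : Cₛ^∞⟮𝓡 n; G, W⟯) :
    P.iD (X + Y) α = P.iD X α + P.iD Y α := p.ext_left fun Z => by
  simp only [map_add, LinearMap.add_apply, pairing_iD, dForm, rhoForm_add_left, rhoForm_add,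
    bracket_add_left]
  ring

theorem iD_add (X : Cₛ^∞⟮𝓡 n; F, V⟯) (α β : Cₛ^∞⟮𝓡 n; G, W⟯) :
    P.iD X (α + β) = P.iD X α + P.iD X β := p.ext_left fun Z => by
  simp only [map_add, LinearMap.add_apply, pairing_iD, dForm, rhoForm_add]
  ring

/-- The standard bracket `(α + X) ∘ (β + Y) = (L_X β - i_Y d α) + [X, Y]`. -/
def dorfman : (Cₛ^∞⟮𝓡 n; G, W⟯ × Cₛ^∞⟮𝓡 n; F, V⟯) →+ (Cₛ^∞⟮𝓡 n; G, W⟯ × Cₛ^∞⟮𝓡 n; F, V⟯) →+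
    (Cₛ^∞⟮𝓡 n; G, W⟯ × Cₛ^∞⟮𝓡 n; F, V⟯) :=
  biadd (fun a b => (P.lie a.2 b.1 - P.iD b.2 a.1, P.bracket a.2 b.2))
    (fun a b c => Prod.ext (by simp only [Prod.fst_add, Prod.snd_add, lie_add_left, iD_add]; abel)
      (P.bracket_add_left _ _ _))
    (fun a b c => Prod.ext (by simp only [Prod.fst_add, Prod.snd_add, lie_add, iD_add_left]; abel)
      (P.bracket_add _ _ _))

theorem dorfman_apply (a b : Cₛ^∞⟮𝓡 n; G, W⟯ × Cₛ^∞⟮𝓡 n; F, V⟯) :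
    P.dorfman a b = (P.lie a.2 b.1 - P.iD b.2 a.1, P.bracket a.2 b.2) := rfl

/-- Pairing with a test section turns identities between forms into identities between functions,
which are then linear consequences of the axioms. The later bracket identities rely on this
expansion. -/
theorem pairing_dorfman_fst (a b : Cₛ^∞⟮𝓡 n; G, W⟯ × Cₛ^∞⟮𝓡 n; F, V⟯) (Z : Cₛ^∞⟮𝓡 n; F, V⟯) :
    p.pairing (P.dorfman a b).1 Z = P.rhoForm a.2 (p.pairing b.1 Z)
      - p.pairing b.1 (P.bracket a.2 Z) - P.rhoForm b.2 (p.pairing a.1 Z)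
      + P.rhoForm Z (p.pairing a.1 b.2) + p.pairing a.1 (P.bracket b.2 Z) := by
  simp only [dorfman_apply, map_sub, LinearMap.sub_apply, pairing_lie, pairing_iD, dForm]; ring

theorem dorfman_snd (a b : Cₛ^∞⟮𝓡 n; G, W⟯ × Cₛ^∞⟮𝓡 n; F, V⟯) :
    (P.dorfman a b).2 = P.bracket a.2 b.2 := rfl

variable {P}

/-- The anchor of a Lie algebroid preserves brackets. -/
theorem IsJacobi.rho_bracket (hP : P.IsJacobi) (X Y : Cₛ^∞⟮𝓡 n; F, V⟯) (f : C^∞⟮𝓡 n, M; ℝ⟯) :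
    P.rho (P.bracket X Y) f = P.rho X (P.rho Y f) - P.rho Y (P.rho X f) := by
  -- Expand the Jacobi identity of `X`, `Y`, `f • Z` by the Leibniz rule: what survives is the
  -- defect of the anchor times `Z`.
  have key : ∀ Z : Cₛ^∞⟮𝓡 n; F, V⟯,
      (P.rho (P.bracket X Y) f - (P.rho X (P.rho Y f) - P.rho Y (P.rho X f))) • Z = 0 := by
    intro Z
    have h := hP.jacobi X Y (f • Z)
    have e : ∀ (X Z : Cₛ^∞⟮𝓡 n; F, V⟯) (f : C^∞⟮𝓡 n, M; ℝ⟯),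
        P.bracket X (f • Z) = f • P.bracket X Z + P.rho X f • Z :=
      fun X Z f => P.bracket_leibniz X f Z
    simp only [e, P.bracket_add, hP.jacobi X Y Z] at h
    simp only [smul_add] at h
    rw [sub_smul, sub_smul]
    rw [← sub_eq_zero] at h
    rw [← neg_eq_zero, ← h]
    abel
  ext x
  -- On a zero fiber no section can detect the defect, but there the anchor itself vanishes.
  rcases subsingleton_or_nontrivial (V x) with hx | hx
  · have h0 : ∀ (Z : Cₛ^∞⟮𝓡 n; F, V⟯) (g : C^∞⟮𝓡 n, M; ℝ⟯), P.rho Z g x = 0 := fun Z g => by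
      rw [rho, VectorField.act_apply, BundleMap.map_apply, Subsingleton.elim (Z x) 0, map_zero]
      exact map_zero (mfderiv (𝓡 n) 𝓘(ℝ, ℝ) g x)
    change _ = P.rho X _ x - P.rho Y _ x
    rw [h0, h0, h0, sub_zero]
  · obtain ⟨v, hv⟩ := exists_ne (0 : V x)
    obtain ⟨Z, rfl⟩ := exists_section_eq (n := n) (F := F) x v
    have := congrArg (fun s : Cₛ^∞⟮𝓡 n; F, V⟯ => s x) (key Z)
    exact sub_eq_zero.1 ((smul_eq_zero.1 this).resolve_right hv)

/-- `ρ^φ` is a connection on the trivial line bundle along the algebroid; its curvature is `dφ`,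
which the cocycle condition kills. -/
theorem IsJacobi.rhoForm_bracket (hP : P.IsJacobi) (X Y : Cₛ^∞⟮𝓡 n; F, V⟯)
    (f : C^∞⟮𝓡 n, M; ℝ⟯) :
    P.rhoForm (P.bracket X Y) f = P.rhoForm X (P.rhoForm Y f) - P.rhoForm Y (P.rhoForm X f) := by
  have h := hP.cocycle X Y
  simp only [rhoForm, rho_add, rho_mul, hP.rho_bracket]
  linear_combination -f * h

/-- The form component needs flatness of `ρ^φ` and the Jacobi identity paired with each of the three
forms; the vector component is the Jacobi identity itself. -/
theorem IsJacobi.compatible_dorfman (hP : P.IsJacobi) : Compatible P.dorfman P.dorfman := by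
  rintro a b c
  refine Prod.ext (p.ext_left fun U => ?_) ?_
  · have e := hP.rhoForm_bracket
    have h1 := congrArg (p.pairing a.1) (hP.jacobi b.2 c.2 U)
    have h2 := congrArg (p.pairing b.1) (hP.jacobi a.2 c.2 U)
    have h3 := congrArg (p.pairing c.1) (hP.jacobi a.2 b.2 U)
    simp only [map_add] at h1 h2 h3
    simp only [jacobiator, Prod.fst_add, Prod.fst_sub, map_add, map_sub, LinearMap.add_apply,
      LinearMap.sub_apply, pairing_dorfman_fst, dorfman_snd, rhoForm_add, rhoForm_sub, e,
      Prod.fst_zero, map_zero, LinearMap.zero_apply]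
    -- The coefficients are `±2` because `jacobiator m m` counts the Jacobiator twice.
    linear_combination -2 * h1 + 2 * h2 - 2 * h3
  · simp only [jacobiator, Prod.snd_add, Prod.snd_sub, dorfman_snd, hP.jacobi a.2 b.2 c.2,
      Prod.snd_zero]
    abel

end AlmostJacobi

/-- The bracket `(α + X, β + Y) ↦ χ(X, Y, ·)` defined by a `3`-form. -/
def ThreeForm.toBracket (p : Duality n F V G W) (χ : ThreeForm n F V) :
    (Cₛ^∞⟮𝓡 n; G, W⟯ × Cₛ^∞⟮𝓡 n; F, V⟯) →+ (Cₛ^∞⟮𝓡 n; G, W⟯ × Cₛ^∞⟮𝓡 n; F, V⟯) →+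
    (Cₛ^∞⟮𝓡 n; G, W⟯ × Cₛ^∞⟮𝓡 n; F, V⟯) :=
  biadd (fun a b => (χ.contract p a.2 b.2, 0)) (fun a b c => by simp) (fun a b c => by simp)

theorem ThreeForm.toBracket_apply (χ : ThreeForm n F V)
    (a b : Cₛ^∞⟮𝓡 n; G, W⟯ × Cₛ^∞⟮𝓡 n; F, V⟯) :
    χ.toBracket p a b = (χ.contract p a.2 b.2, 0) := rfl

theorem ThreeForm.compatible_self (χ : ThreeForm n F V) :
    Compatible (χ.toBracket p) (χ.toBracket p) := fun a b c => by
  simp [jacobiator, ThreeForm.toBracket_apply]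

/-- The bracket defined by an alternating trilinear map on the sections of `V`, represented by its
contractions, is compatible with the standard bracket if the map is closed. -/
theorem AlmostJacobi.compatible_of_dThree {P : AlmostJacobi p}
    {m : (Cₛ^∞⟮𝓡 n; G, W⟯ × Cₛ^∞⟮𝓡 n; F, V⟯) →+ (Cₛ^∞⟮𝓡 n; G, W⟯ × Cₛ^∞⟮𝓡 n; F, V⟯) →+
      (Cₛ^∞⟮𝓡 n; G, W⟯ × Cₛ^∞⟮𝓡 n; F, V⟯)}
    {τ : Cₛ^∞⟮𝓡 n; F, V⟯ → Cₛ^∞⟮𝓡 n; F, V⟯ → Cₛ^∞⟮𝓡 n; F, V⟯ → C^∞⟮𝓡 n, M; ℝ⟯}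
    (hm : ∀ a b Z, p.pairing (m a b).1 Z = τ a.2 b.2 Z) (hm' : ∀ a b, (m a b).2 = 0)
    (h₁ : ∀ X Y Z, τ X Y Z = - τ Y X Z) (h₂ : ∀ X Y Z, τ X Y Z = - τ X Z Y)
    (hτ : ∀ X Y Z U, P.dThree τ X Y Z U = 0) : Compatible P.dorfman m := by
  intro a b c
  have h0 : P.bracket 0 = 0 := by
    funext Y; rw [P.bracket_skew, P.bracket_zero]; simp
  have r0 : P.rhoForm 0 = 0 := by
    funext f; simpa using P.rhoForm_sub_left 0 0 f
  refine Prod.ext (p.ext_left fun U => ?_) ?_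
  · simp only [jacobiator, Prod.fst_add, Prod.fst_sub, map_add, map_sub, LinearMap.add_apply,
      LinearMap.sub_apply, P.pairing_dorfman_fst, P.dorfman_snd, hm, hm',
      h0, r0, Pi.zero_apply, map_zero, sub_zero]
    have := hτ a.2 b.2 c.2 U
    rw [AlmostJacobi.dThree] at this
    -- The Jacobiator produces brackets in slots other than those of the formula for `d^φ τ`; the
    -- alternation of `τ` matches the two.
    have e1 := h₁ (P.bracket a.2 c.2) b.2 U
    have e2 := h₁ (P.bracket b.2 c.2) a.2 U
    have e3 : τ (P.bracket a.2 U) b.2 c.2 = τ b.2 c.2 (P.bracket a.2 U) := by rw [h₁, h₂, neg_neg]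
    have e4 : τ (P.bracket b.2 U) a.2 c.2 = τ a.2 c.2 (P.bracket b.2 U) := by rw [h₁, h₂, neg_neg]
    have e5 : τ (P.bracket c.2 U) a.2 b.2 = τ a.2 b.2 (P.bracket c.2 U) := by rw [h₁, h₂, neg_neg]
    rw [e1, e2, e3, e4, e5] at this
    simp only [Prod.fst_zero, map_zero, LinearMap.zero_apply]
    linear_combination this
  · simp [jacobiator, hm', P.dorfman_snd, h0, P.bracket_zero]

theorem AlmostJacobi.IsClosed.compatible {P : AlmostJacobi p} {χ : ThreeForm n F V}
    (h : P.IsClosed χ) : Compatible P.dorfman (χ.toBracket p) :=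
  compatible_of_dThree (fun a b Z => χ.pairing_contract a.2 b.2 Z p) (fun _ _ => rfl)
    χ.eval_swap₁ χ.eval_swap₂ h

end Dorfman

/-! ### Doubles: reduction of the Courant-Jacobi axioms to the Jacobi identity -/

section Doubles

variable {n : ℕ} {M : Type*} [TopologicalSpace M] [ChartedSpace (EuclideanSpace ℝ (Fin n)) M]
  [IsManifold (𝓡 n) ∞ M] [T2Space M]
  {F : Type*} [NormedAddCommGroup F] [NormedSpace ℝ F] [FiniteDimensional ℝ F]
  {V : M → Type*} [TopologicalSpace (TotalSpace F V)]
  [∀ x, AddCommGroup (V x)] [∀ x, Module ℝ (V x)] [∀ x, TopologicalSpace (V x)]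
  [FiberBundle F V] [VectorBundle ℝ F V] [ContMDiffVectorBundle ∞ F V (𝓡 n)]
  {G : Type*} [NormedAddCommGroup G] [NormedSpace ℝ G] [FiniteDimensional ℝ G]
  {W : M → Type*} [TopologicalSpace (TotalSpace G W)]
  [∀ x, AddCommGroup (W x)] [∀ x, Module ℝ (W x)] [∀ x, TopologicalSpace (W x)]
  [FiberBundle G W] [VectorBundle ℝ G W] [ContMDiffVectorBundle ∞ G W (𝓡 n)]
  {p : Duality n F V G W}

theorem real_smul_eq (c : ℝ) (X : Cₛ^∞⟮𝓡 n; F, V⟯) :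
    c • X = (ContMDiffMap.const c : C^∞⟮𝓡 n, M; ℝ⟯) • X := rfl

namespace AlmostJacobi

variable (P : AlmostJacobi p)

theorem rho_const (X : Cₛ^∞⟮𝓡 n; F, V⟯) (c : ℝ) :
    P.rho X (ContMDiffMap.const c : C^∞⟮𝓡 n, M; ℝ⟯) = 0 := by
  ext x
  change mfderiv (𝓡 n) 𝓘(ℝ, ℝ) (fun _ : M => c) x _ = 0
  rw [mfderiv_const]; rfl

theorem rhoForm_const_mul (X : Cₛ^∞⟮𝓡 n; F, V⟯) (c : ℝ) (f : C^∞⟮𝓡 n, M; ℝ⟯) :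
    P.rhoForm X (ContMDiffMap.const c * f) = ContMDiffMap.const c * P.rhoForm X f := by
  rw [rhoForm_mul, rho_const, mul_zero, add_zero]

theorem bracket_real_smul (c : ℝ) (X Y : Cₛ^∞⟮𝓡 n; F, V⟯) :
    P.bracket X (c • Y) = c • P.bracket X Y := by
  rw [real_smul_eq, bracket_leibniz, ← rho.eq_def, rho_const, zero_smul, add_zero, ← real_smul_eq]

theorem bracket_real_smul_left (c : ℝ) (X Y : Cₛ^∞⟮𝓡 n; F, V⟯) :
    P.bracket (c • X) Y = c • P.bracket X Y := by
  rw [P.bracket_skew, bracket_real_smul, P.bracket_skew X, smul_neg]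

theorem dorfman_real_smul_left (c : ℝ) (a b : Cₛ^∞⟮𝓡 n; G, W⟯ × Cₛ^∞⟮𝓡 n; F, V⟯) :
    P.dorfman (c • a) b = c • P.dorfman a b := by
  refine Prod.ext (p.ext_left fun Z => ?_) (P.bracket_real_smul_left c _ _)
  simp only [pairing_dorfman_fst, Prod.smul_fst, Prod.smul_snd, real_smul_eq, map_smul,
    LinearMap.smul_apply, smul_eq_mul, rhoForm_const_mul, rhoForm_smul_left]
  simp only [← real_smul_eq, bracket_real_smul_left]
  simp only [real_smul_eq, map_smul, smul_eq_mul]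
  ring

theorem dorfman_real_smul (c : ℝ) (a b : Cₛ^∞⟮𝓡 n; G, W⟯ × Cₛ^∞⟮𝓡 n; F, V⟯) :
    P.dorfman a (c • b) = c • P.dorfman a b := by
  refine Prod.ext (p.ext_left fun Z => ?_) (P.bracket_real_smul c _ _)
  simp only [pairing_dorfman_fst, Prod.smul_fst, Prod.smul_snd, real_smul_eq, map_smul,
    LinearMap.smul_apply, smul_eq_mul, rhoForm_const_mul, rhoForm_smul_left]
  simp only [← real_smul_eq, bracket_real_smul_left]
  simp only [real_smul_eq, map_smul, smul_eq_mul]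
  ring

/-- The bracket of the double of two structures in duality and a `3`-form. -/
def doubleBracket (P : AlmostJacobi p) (Q : AlmostJacobi p.flip) (χ : ThreeForm n F V) :
    (Cₛ^∞⟮𝓡 n; G, W⟯ × Cₛ^∞⟮𝓡 n; F, V⟯) →+ (Cₛ^∞⟮𝓡 n; G, W⟯ × Cₛ^∞⟮𝓡 n; F, V⟯) →+
    (Cₛ^∞⟮𝓡 n; G, W⟯ × Cₛ^∞⟮𝓡 n; F, V⟯) :=
  P.dorfman + biadd (fun a b => (Q.dorfman a.swap b.swap).swap)
      (fun a b c => by simp) (fun a b c => by simp)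
    + χ.toBracket p

theorem doubleBracket_apply (Q : AlmostJacobi p.flip) (χ : ThreeForm n F V)
    (a b : Cₛ^∞⟮𝓡 n; G, W⟯ × Cₛ^∞⟮𝓡 n; F, V⟯) :
    P.doubleBracket Q χ a b = P.dorfman a b + (Q.dorfman a.swap b.swap).swap
      + (χ.contract p a.2 b.2, 0) := rfl

theorem pairing_doubleBracket_fst (Q : AlmostJacobi p.flip) (χ : ThreeForm n F V)
    (a b : Cₛ^∞⟮𝓡 n; G, W⟯ × Cₛ^∞⟮𝓡 n; F, V⟯) (Z : Cₛ^∞⟮𝓡 n; F, V⟯) :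
    p.pairing (P.doubleBracket Q χ a b).1 Z = P.rhoForm a.2 (p.pairing b.1 Z)
      - p.pairing b.1 (P.bracket a.2 Z) - P.rhoForm b.2 (p.pairing a.1 Z)
      + P.rhoForm Z (p.pairing a.1 b.2) + p.pairing a.1 (P.bracket b.2 Z)
      + p.pairing (Q.bracket a.1 b.1) Z + χ.eval a.2 b.2 Z := by
  rw [doubleBracket_apply, Prod.fst_add, Prod.fst_add, map_add, map_add, LinearMap.add_apply,
    LinearMap.add_apply, pairing_dorfman_fst, ThreeForm.pairing_contract]
  rfl

theorem pairing_doubleBracket_snd (Q : AlmostJacobi p.flip) (χ : ThreeForm n F V)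
    (a b : Cₛ^∞⟮𝓡 n; G, W⟯ × Cₛ^∞⟮𝓡 n; F, V⟯) (γ : Cₛ^∞⟮𝓡 n; G, W⟯) :
    p.pairing γ (P.doubleBracket Q χ a b).2 = Q.rhoForm a.1 (p.pairing γ b.2)
      - p.pairing (Q.bracket a.1 γ) b.2 - Q.rhoForm b.1 (p.pairing γ a.2)
      + Q.rhoForm γ (p.pairing b.1 a.2) + p.pairing (Q.bracket b.1 γ) a.2
      + p.pairing γ (P.bracket a.2 b.2) := by
  have h : p.pairing γ (Q.dorfman a.swap b.swap).1 = _ := Q.pairing_dorfman_fst a.swap b.swap γ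
  rw [doubleBracket_apply, Prod.snd_add, Prod.snd_add, map_add, map_add, Prod.snd_swap, h,
    dorfman_snd, map_zero, add_zero, add_comm]
  rfl

end AlmostJacobi

/-- The two components of a section of a direct sum. -/
def components (e : Cₛ^∞⟮𝓡 n; G × F, W ×ᵇ V⟯) : Cₛ^∞⟮𝓡 n; G, W⟯ × Cₛ^∞⟮𝓡 n; F, V⟯ :=
  (fstSection e, sndSection e)

theorem components_injective : Function.Injective
    (components : Cₛ^∞⟮𝓡 n; G × F, W ×ᵇ V⟯ → _) := fun e e' h => by
  ext x : 1
  exact Prod.ext (congrArg (fun s : Cₛ^∞⟮𝓡 n; G, W⟯ => s x) (congrArg Prod.fst h))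
    (congrArg (fun s : Cₛ^∞⟮𝓡 n; F, V⟯ => s x) (congrArg Prod.snd h))

theorem components_add (e e' : Cₛ^∞⟮𝓡 n; G × F, W ×ᵇ V⟯) :
    components (e + e') = components e + components e' := rfl

theorem components_smul (c : ℝ) (e : Cₛ^∞⟮𝓡 n; G × F, W ×ᵇ V⟯) :
    components (c • e) = c • components e := rfl

theorem components_bracket (P : AlmostJacobi p) (Q : AlmostJacobi p.flip) (χ : ThreeForm n F V)
    (e e' : Cₛ^∞⟮𝓡 n; G × F, W ×ᵇ V⟯) :
    components ((double P Q χ).bracket e e') =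
      P.doubleBracket Q χ (components e) (components e') := by
  change (Q.bracket _ _ + _ - _ + _, P.bracket _ _ + _ - _) = _
  simp only [AlmostJacobi.doubleBracket_apply, AlmostJacobi.dorfman_apply]
  refine Prod.ext ?_ ?_
  · simp [components]; abel
  · simp [components]; abel

theorem double_act (P : AlmostJacobi p) (Q : AlmostJacobi p.flip) (χ : ThreeForm n F V)
    (e : Cₛ^∞⟮𝓡 n; G × F, W ×ᵇ V⟯) (f : C^∞⟮𝓡 n, M; ℝ⟯) :
    (double P Q χ).act e f = Q.rhoForm (components e).1 f + P.rhoForm (components e).2 f := by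
  have h1 : VectorField.act ((double P Q χ).anchor.map e) f =
      Q.rho (components e).1 f + P.rho (components e).2 f :=
    VectorField.add_act (Q.anchor.map (components e).1) (P.anchor.map (components e).2) f
  have h2 : (⟨fun x => (double P Q χ).theta x (e x), (double P Q χ).theta_smooth e⟩ :
      C^∞⟮𝓡 n, M; ℝ⟯) = p.flip.pairing Q.form (components e).1
        + p.pairing P.form (components e).2 := rfl
  rw [CourantJacobiData.act, h1, h2, AlmostJacobi.rhoForm, AlmostJacobi.rhoForm]
  ring

theorem double_pair (P : AlmostJacobi p) (Q : AlmostJacobi p.flip) (χ : ThreeForm n F V)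
    (e e' : Cₛ^∞⟮𝓡 n; G × F, W ×ᵇ V⟯) :
    (double P Q χ).pair e e' = ContMDiffMap.const (1 / 2) *
      (p.pairing (components e).1 (components e').2
        + p.pairing (components e').1 (components e).2) := rfl

/-- The two axioms on the pairing hold for any skew brackets with anchors and any `3`-form, by
skew-symmetry alone once both sides are expanded. Integrability enters only in the Jacobi identity.
-/
theorem double_isCourantJacobi {P : AlmostJacobi p} {Q : AlmostJacobi p.flip}
    {χ : ThreeForm n F V} (h : Compatible (P.doubleBracket Q χ) (P.doubleBracket Q χ)) :
    (double P Q χ).IsCourantJacobi where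
  add_left e₁ e₂ e₃ := components_injective <| by
    simp only [components_add, components_bracket, map_add, AddMonoidHom.add_apply]
  add_right e₁ e₂ e₃ := components_injective <| by
    simp only [components_add, components_bracket, map_add]
  smul_left c e₁ e₂ := components_injective <| by
    rw [components_smul, components_bracket, components_bracket, components_smul,
      AlmostJacobi.doubleBracket_apply, AlmostJacobi.doubleBracket_apply, Prod.smul_swap,
      AlmostJacobi.dorfman_real_smul_left, AlmostJacobi.dorfman_real_smul_left, Prod.smul_swap,
      Prod.smul_snd, real_smul_eq, map_smul, LinearMap.smul_apply, ← real_smul_eq, smul_add,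
      smul_add]
    exact congrArg _ (Prod.ext rfl (smul_zero c).symm)
  smul_right c e₁ e₂ := components_injective <| by
    rw [components_smul, components_bracket, components_bracket, components_smul,
      AlmostJacobi.doubleBracket_apply, AlmostJacobi.doubleBracket_apply, Prod.smul_swap,
      AlmostJacobi.dorfman_real_smul, AlmostJacobi.dorfman_real_smul, Prod.smul_swap,
      Prod.smul_snd, real_smul_eq, map_smul, ← real_smul_eq, smul_add,
      smul_add]
    exact congrArg _ (Prod.ext rfl (smul_zero c).symm)
  jacobi e₁ e₂ e₃ := components_injective <| by
    have := h (components e₁) (components e₂) (components e₃)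
    simp only [components_add, components_bracket]
    set m := P.doubleBracket Q χ
    rw [← sub_eq_zero]
    -- The hypothesis is twice the required identity, so the defect is shown to equal its negative.
    refine self_eq_neg.1 ?_
    rw [← sub_eq_zero, ← this, jacobiator]
    abel
  act_pair e₁ e₂ e₃ := by
    have hχ := χ.eval_swap₁ (components e₂).2 (components e₃).2 (components e₁).2
    have h1 := P.bracket_skew (components e₂).2 (components e₃).2
    have h2 := Q.bracket_skew (components e₂).1 (components e₃).1
    simp only [double_act, double_pair, components_add, components_bracket,
      Prod.fst_add, Prod.snd_add, map_add, LinearMap.add_apply,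
      AlmostJacobi.rhoForm_const_mul, AlmostJacobi.rhoForm_add,
      AlmostJacobi.pairing_doubleBracket_fst, AlmostJacobi.pairing_doubleBracket_snd, hχ, h1, h2,
      map_neg, LinearMap.neg_apply]
    ring
  act_pair_eq e₁ e₂ e₃ := by
    have hχ := χ.eval_swap₂ (components e₁).2 (components e₂).2 (components e₃).2
    have h1 := P.bracket_skew (components e₂).2 (components e₃).2
    have h2 := Q.bracket_skew (components e₂).1 (components e₃).1
    simp only [double_act, double_pair, components_bracket,
      AlmostJacobi.rhoForm_const_mul, AlmostJacobi.rhoForm_add,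
      AlmostJacobi.pairing_doubleBracket_fst, AlmostJacobi.pairing_doubleBracket_snd, hχ, h1, h2,
      map_neg, LinearMap.neg_apply]
    ring

end Doubles

/-! ### Both doubles as deformations or conjugates of the standard bracket -/

section Deformations

variable {n : ℕ} {M : Type*} [TopologicalSpace M] [ChartedSpace (EuclideanSpace ℝ (Fin n)) M]
  [IsManifold (𝓡 n) ∞ M] [T2Space M]
  {F : Type*} [NormedAddCommGroup F] [NormedSpace ℝ F] [FiniteDimensional ℝ F]
  {V : M → Type*} [TopologicalSpace (TotalSpace F V)]
  [∀ x, AddCommGroup (V x)] [∀ x, Module ℝ (V x)] [∀ x, TopologicalSpace (V x)]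
  [FiberBundle F V] [VectorBundle ℝ F V] [ContMDiffVectorBundle ∞ F V (𝓡 n)]
  {G : Type*} [NormedAddCommGroup G] [NormedSpace ℝ G] [FiniteDimensional ℝ G]
  {W : M → Type*} [TopologicalSpace (TotalSpace G W)]
  [∀ x, AddCommGroup (W x)] [∀ x, Module ℝ (W x)] [∀ x, TopologicalSpace (W x)]
  [FiberBundle G W] [VectorBundle ℝ G W] [ContMDiffVectorBundle ∞ G W (𝓡 n)]
  {p : Duality n F V G W}

/-- The endomorphism `α + X ↦ - N*α + N X`. -/
def diagEndo (p : Duality n F V G W) (N : BundleMap n F V F V) :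
    (Cₛ^∞⟮𝓡 n; G, W⟯ × Cₛ^∞⟮𝓡 n; F, V⟯) →+ (Cₛ^∞⟮𝓡 n; G, W⟯ × Cₛ^∞⟮𝓡 n; F, V⟯) :=
  AddMonoidHom.mk' (fun a => (- p.transpose N a.1, N.map a.2)) fun a b => by
    simp [p.transpose_add, add_comm]

theorem diagEndo_apply (N : BundleMap n F V F V) (a : Cₛ^∞⟮𝓡 n; G, W⟯ × Cₛ^∞⟮𝓡 n; F, V⟯) :
    diagEndo p N a = (- p.transpose N a.1, N.map a.2) := rfl

/-- The endomorphism `α + X ↦ Λ♯ α`. -/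
def Bivector.endo (Λ : Bivector p) :
    (Cₛ^∞⟮𝓡 n; G, W⟯ × Cₛ^∞⟮𝓡 n; F, V⟯) →+ (Cₛ^∞⟮𝓡 n; G, W⟯ × Cₛ^∞⟮𝓡 n; F, V⟯) :=
  AddMonoidHom.mk' (fun a => (0, Λ.sharp.map a.1)) fun a b => by simp

theorem Bivector.endo_apply (Λ : Bivector p) (a : Cₛ^∞⟮𝓡 n; G, W⟯ × Cₛ^∞⟮𝓡 n; F, V⟯) :
    Λ.endo a = (0, Λ.sharp.map a.1) := rfl

/-- The shear `α + X ↦ α + (X + Λ♯ α)`. -/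
def Bivector.shear (Λ : Bivector p) :
    (Cₛ^∞⟮𝓡 n; G, W⟯ × Cₛ^∞⟮𝓡 n; F, V⟯) →+ (Cₛ^∞⟮𝓡 n; G, W⟯ × Cₛ^∞⟮𝓡 n; F, V⟯) :=
  AddMonoidHom.mk' (fun a => (a.1, a.2 + Λ.sharp.map a.1)) fun a b => by
    simp only [Prod.fst_add, Prod.snd_add, map_add, Prod.mk_add_mk]; congr 1; abel

/-- The shear `α + X ↦ α + (X - Λ♯ α)`. -/
def Bivector.unshear (Λ : Bivector p) :
    (Cₛ^∞⟮𝓡 n; G, W⟯ × Cₛ^∞⟮𝓡 n; F, V⟯) →+ (Cₛ^∞⟮𝓡 n; G, W⟯ × Cₛ^∞⟮𝓡 n; F, V⟯) :=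
  AddMonoidHom.mk' (fun a => (a.1, a.2 - Λ.sharp.map a.1)) fun a b => by
    simp only [Prod.fst_add, Prod.snd_add, map_add, Prod.mk_add_mk]; congr 1; abel

theorem Bivector.shear_apply (Λ : Bivector p) (a : Cₛ^∞⟮𝓡 n; G, W⟯ × Cₛ^∞⟮𝓡 n; F, V⟯) :
    Λ.shear a = (a.1, a.2 + Λ.sharp.map a.1) := rfl

theorem Bivector.unshear_apply (Λ : Bivector p) (a : Cₛ^∞⟮𝓡 n; G, W⟯ × Cₛ^∞⟮𝓡 n; F, V⟯) :
    Λ.unshear a = (a.1, a.2 - Λ.sharp.map a.1) := rfl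

theorem Bivector.pairing_sharp (Λ : Bivector p) (α β : Cₛ^∞⟮𝓡 n; G, W⟯) :
    p.pairing α (Λ.sharp.map β) = - p.pairing β (Λ.sharp.map α) := Λ.eval_skew β α

namespace AlmostJacobi

variable (P : AlmostJacobi p)

theorem deform_rhoForm (N : BundleMap n F V F V) (X : Cₛ^∞⟮𝓡 n; F, V⟯) (f : C^∞⟮𝓡 n, M; ℝ⟯) :
    (P.deform N).rhoForm X f = P.rhoForm (N.map X) f := by
  change P.rho (N.map X) f + f * p.pairing (p.transpose N P.form) X = _
  rw [p.pairing_transpose, rhoForm]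

theorem deform_bracket (N : BundleMap n F V F V) (X Y : Cₛ^∞⟮𝓡 n; F, V⟯) :
    (P.deform N).bracket X Y =
      P.bracket (N.map X) Y + P.bracket X (N.map Y) - N.map (P.bracket X Y) := rfl

theorem koszul_rhoForm (Λ : Bivector p) (α : Cₛ^∞⟮𝓡 n; G, W⟯) (f : C^∞⟮𝓡 n, M; ℝ⟯) :
    (P.koszul Λ).rhoForm α f = P.rhoForm (Λ.sharp.map α) f := by
  change P.rho (Λ.sharp.map α) f + f * p.pairing α (- Λ.sharp.map P.form) = _
  rw [map_neg, Λ.pairing_sharp, neg_neg, rhoForm]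

theorem pairing_koszul_bracket (Λ : Bivector p) (α β : Cₛ^∞⟮𝓡 n; G, W⟯)
    (Z : Cₛ^∞⟮𝓡 n; F, V⟯) :
    p.pairing ((P.koszul Λ).bracket α β) Z = P.rhoForm (Λ.sharp.map α) (p.pairing β Z)
      - p.pairing β (P.bracket (Λ.sharp.map α) Z) - P.rhoForm (Λ.sharp.map β) (p.pairing α Z)
      + p.pairing α (P.bracket (Λ.sharp.map β) Z)
      - P.rhoForm Z (p.pairing β (Λ.sharp.map α)) := by
  change p.pairing (P.lie _ _ - P.lie _ _ - P.dFun _) Z = _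
  simp only [map_sub, LinearMap.sub_apply, pairing_lie, pairing_dFun, Bivector.eval]
  ring

theorem twistBy_rhoForm (Λ : Bivector p) (χ : ThreeForm n F V) (X : Cₛ^∞⟮𝓡 n; F, V⟯)
    (f : C^∞⟮𝓡 n, M; ℝ⟯) : (P.twistBy Λ χ).rhoForm X f = P.rhoForm X f := rfl

theorem twistBy_bracket (Λ : Bivector p) (χ : ThreeForm n F V) (X Y : Cₛ^∞⟮𝓡 n; F, V⟯) :
    (P.twistBy Λ χ).bracket X Y = P.bracket X Y - Λ.sharp.map (χ.contract p X Y) := by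
  simp [twistBy, twist, sub_eq_add_neg]

theorem koszulTwisted_rhoForm (Λ : Bivector p) (χ : ThreeForm n F V) (α : Cₛ^∞⟮𝓡 n; G, W⟯)
    (f : C^∞⟮𝓡 n, M; ℝ⟯) :
    (P.koszulTwisted Λ χ).rhoForm α f = P.rhoForm (Λ.sharp.map α) f := P.koszul_rhoForm Λ α f

theorem koszulTwisted_bracket (Λ : Bivector p) (χ : ThreeForm n F V)
    (α β : Cₛ^∞⟮𝓡 n; G, W⟯) :
    (P.koszulTwisted Λ χ).bracket α β =
      (P.koszul Λ).bracket α β + χ.contract p (Λ.sharp.map α) (Λ.sharp.map β) := rfl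

/-- Gives the Jacobi condition its usable form: `[Λ, Λ]^φ` measures the failure of `Λ♯` to
intertwine `[·,·]_Λ` with the bracket of `V`. -/
theorem schoutenJacobi_eq (Λ : Bivector p) (α β γ : Cₛ^∞⟮𝓡 n; G, W⟯) :
    P.schoutenJacobi Λ α β γ =
      2 * p.pairing γ (P.bracket (Λ.sharp.map α) (Λ.sharp.map β)
        - Λ.sharp.map ((P.koszul Λ).bracket α β)) := by
  rw [map_sub, Λ.pairing_sharp γ, pairing_koszul_bracket, schoutenJacobi, schouten,
    P.bracket_skew (Λ.sharp.map γ), map_neg]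
  simp only [Bivector.eval, rhoForm, Λ.pairing_sharp _ P.form, Λ.pairing_sharp β γ]
  have h (X) (f : C^∞⟮𝓡 n, M; ℝ⟯) : P.rho X (-f) = - P.rho X f := by
    have := P.rhoForm_neg X f
    simp only [rhoForm] at this
    linear_combination this
  simp only [h]
  ring

theorem sharp_koszul_bracket {Λ : Bivector p} (h : ∀ α β γ, P.schoutenJacobi Λ α β γ = 0)
    (α β : Cₛ^∞⟮𝓡 n; G, W⟯) :
    Λ.sharp.map ((P.koszul Λ).bracket α β) = P.bracket (Λ.sharp.map α) (Λ.sharp.map β) := by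
  refine (sub_eq_zero.1 (p.ext_right fun γ => ?_)).symm
  have h1 := P.schoutenJacobi_eq Λ α β γ
  rw [h] at h1
  ext x
  have h2 := congrArg (fun f : C^∞⟮𝓡 n, M; ℝ⟯ => f x) h1
  rw [two_mul] at h2
  rw [map_zero]
  exact self_eq_neg.1 (eq_neg_of_add_eq_zero_left h2.symm)

/-- Deforming by `-N* + N` gives the standard bracket of the deformed structure, and deforming by
`Λ♯` gives the standard bracket of the Koszul structure with the two summands exchanged. No
compatibility between `N` and `Λ` is needed. The sign in `-N*` makes the endomorphism skew for the
pairing. -/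
theorem doubleBracket_deform (N : BundleMap n F V F V) (Λ : Bivector p) (χ : ThreeForm n F V) :
    (P.deform N).doubleBracket (P.koszul Λ) χ =
      deformBracket (diagEndo p N + Λ.endo) P.dorfman + χ.toBracket p := by
  ext a b : 2
  refine Prod.ext (p.ext_left fun Z => ?_) (p.ext_right fun γ => ?_)
  · simp only [pairing_doubleBracket_fst, deform_rhoForm, deform_bracket, pairing_koszul_bracket,
      deformBracket_apply, AddMonoidHom.add_apply, diagEndo_apply, Bivector.endo_apply,
      Prod.fst_add, Prod.fst_sub, Prod.mk_add_mk, map_add, map_sub, map_neg, LinearMap.add_apply,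
      LinearMap.sub_apply, LinearMap.neg_apply, pairing_dorfman_fst, p.pairing_transpose, add_zero,
      map_zero, zero_add, sub_zero, ThreeForm.toBracket_apply, ThreeForm.pairing_contract,
      rhoForm_add, rhoForm_neg, rhoForm_add_left, bracket_add_left, dorfman_snd, bracket_add,
      Λ.pairing_sharp a.1 b.1]
    ring
  · simp only [pairing_doubleBracket_snd, deform_rhoForm, deform_bracket, pairing_koszul_bracket,
      koszul_rhoForm,
      deformBracket_apply, AddMonoidHom.add_apply, diagEndo_apply, Bivector.endo_apply,
      Prod.snd_add, Prod.snd_sub, Prod.mk_add_mk, map_add, map_sub, map_neg, LinearMap.add_apply,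
      LinearMap.sub_apply, LinearMap.neg_apply, pairing_dorfman_fst, p.pairing_transpose, add_zero,
      map_zero, zero_add, sub_zero, ThreeForm.toBracket_apply, ThreeForm.pairing_contract,
      rhoForm_add, rhoForm_neg, rhoForm_add_left, bracket_add_left, dorfman_snd, bracket_add,
      Λ.pairing_sharp γ, P.bracket_skew a.2 (Λ.sharp.map _), P.bracket_skew b.2 (Λ.sharp.map _)]
    ring

/-- The shear is orthogonal for the pairing, since `Λ` is skew. Expanding the conjugated bracket
reproduces every term of the double except the part of the vector component that comes from two
forms `α`, `β`; the hypothesis is exactly what makes that part vanish. -/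
theorem doubleBracket_twist {Λ : Bivector p} {χ : ThreeForm n F V}
    (h : ∀ α β, P.bracket (Λ.sharp.map α) (Λ.sharp.map β)
      - Λ.sharp.map ((P.koszul Λ).bracket α β) =
        Λ.sharp.map (χ.contract p (Λ.sharp.map α) (Λ.sharp.map β)))
    (a b : Cₛ^∞⟮𝓡 n; G, W⟯ × Cₛ^∞⟮𝓡 n; F, V⟯) :
    (P.twistBy Λ χ).doubleBracket (P.koszulTwisted Λ χ) χ a b =
      Λ.unshear ((P.dorfman + χ.toBracket p) (Λ.shear a) (Λ.shear b)) := by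
  refine Prod.ext (p.ext_left fun Z => ?_) (p.ext_right fun γ => ?_)
  · simp only [pairing_doubleBracket_fst, twistBy_rhoForm, twistBy_bracket, koszulTwisted_bracket,
      pairing_koszul_bracket,
      AddMonoidHom.add_apply, Bivector.shear_apply, Bivector.unshear_apply,
      Prod.fst_add, Prod.snd_add, Prod.fst_sub, map_add, map_sub, map_neg, LinearMap.add_apply,
      LinearMap.sub_apply, LinearMap.neg_apply, pairing_dorfman_fst, add_zero,
      map_zero, zero_add, sub_zero, ThreeForm.toBracket_apply, ThreeForm.pairing_contract,
      rhoForm_add, rhoForm_neg, rhoForm_add_left, bracket_add_left, dorfman_snd, bracket_add,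
      Λ.pairing_sharp a.1 b.1, Λ.pairing_sharp _ (χ.contract p _ _)]
    rw [χ.eval_swap₂ a.2 Z, χ.eval_swap₂ b.2 Z, χ.eval_swap₁ b.2]
    ring
  · have := congrArg (p.pairing γ) (h a.1 b.1)
    simp only [pairing_doubleBracket_snd, twistBy_rhoForm, twistBy_bracket, koszulTwisted_bracket,
      pairing_koszul_bracket, koszulTwisted_rhoForm,
      AddMonoidHom.add_apply, Bivector.shear_apply, Bivector.unshear_apply,
      Prod.fst_add, Prod.snd_add, Prod.fst_sub, Prod.snd_sub, map_add, map_sub, map_neg,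
      LinearMap.add_apply,
      LinearMap.sub_apply, LinearMap.neg_apply, pairing_dorfman_fst, add_zero,
      map_zero, zero_add, sub_zero, ThreeForm.toBracket_apply, ThreeForm.pairing_contract,
      rhoForm_add, rhoForm_neg, rhoForm_add_left, bracket_add_left, dorfman_snd, bracket_add,
      Λ.pairing_sharp γ, Λ.pairing_sharp a.1 b.1] at this ⊢
    rw [χ.eval_swap₂ _ (Λ.sharp.map γ) b.2, χ.eval_swap₂ _ (Λ.sharp.map γ) a.2,
      χ.eval_swap₁ _ a.2, P.bracket_skew (Λ.sharp.map γ) b.2, P.bracket_skew (Λ.sharp.map γ) a.2,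
      P.bracket_skew _ a.2, map_neg, map_neg, map_neg]
    linear_combination -this

end AlmostJacobi

end Deformations

/-! ### Second deformations of the standard bracket -/

section NijenhuisIdentities

variable {n : ℕ} {M : Type*} [TopologicalSpace M] [ChartedSpace (EuclideanSpace ℝ (Fin n)) M]
  [IsManifold (𝓡 n) ∞ M] [T2Space M]
  {F : Type*} [NormedAddCommGroup F] [NormedSpace ℝ F] [FiniteDimensional ℝ F]
  {V : M → Type*} [TopologicalSpace (TotalSpace F V)]
  [∀ x, AddCommGroup (V x)] [∀ x, Module ℝ (V x)] [∀ x, TopologicalSpace (V x)]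
  [FiberBundle F V] [VectorBundle ℝ F V] [ContMDiffVectorBundle ∞ F V (𝓡 n)]
  {G : Type*} [NormedAddCommGroup G] [NormedSpace ℝ G] [FiniteDimensional ℝ G]
  {W : M → Type*} [TopologicalSpace (TotalSpace G W)]
  [∀ x, AddCommGroup (W x)] [∀ x, Module ℝ (W x)] [∀ x, TopologicalSpace (W x)]
  [FiberBundle G W] [VectorBundle ℝ G W] [ContMDiffVectorBundle ∞ G W (𝓡 n)]
  {p : Duality n F V G W}
  {P : AlmostJacobi p} {Λ : Bivector p} {N : BundleMap n F V F V}
  {hΛ : ∀ α, N.map (Λ.sharp.map α) = Λ.sharp.map (p.transpose N α)} {χ : ThreeForm n F V}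

theorem Bivector.mulMap_sharp (α : Cₛ^∞⟮𝓡 n; G, W⟯) :
    (Λ.mulMap N hΛ).sharp.map α = N.map (Λ.sharp.map α) := rfl

/-- The square of a bundle map. -/
def BundleMap.square (N : BundleMap n F V F V) : BundleMap n F V F V where
  toFun x := (N.toFun x).comp (N.toFun x)
  smooth X := N.smooth (N.map X)

theorem BundleMap.square_map (X : Cₛ^∞⟮𝓡 n; F, V⟯) : N.square.map X = N.map (N.map X) := rfl

/-- After `N ∘ Λ♯ = Λ♯ ∘ N*` is used, the derivatives along `NΛ♯ α` and `NΛ♯ β` cancel, and a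
condition remains that involves only `Λ♯ α`, `Λ♯ β`, `X` and `N X`. -/
theorem pairing_concomitant
    (hC : ∀ α β, (P.koszul (Λ.mulMap N hΛ)).bracket α β =
      (P.koszul Λ).bracket (p.transpose N α) β + (P.koszul Λ).bracket α (p.transpose N β)
        - p.transpose N ((P.koszul Λ).bracket α β))
    (α β : Cₛ^∞⟮𝓡 n; G, W⟯) (X : Cₛ^∞⟮𝓡 n; F, V⟯) :
    p.pairing β (N.map (P.bracket (Λ.sharp.map α) X))
      - p.pairing α (N.map (P.bracket (Λ.sharp.map β) X))
      + P.rhoForm X (p.pairing β (N.map (Λ.sharp.map α)))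
      - p.pairing β (P.bracket (Λ.sharp.map α) (N.map X))
      + p.pairing α (P.bracket (Λ.sharp.map β) (N.map X))
      - P.rhoForm (N.map X) (p.pairing β (Λ.sharp.map α)) = 0 := by
  have h := congrArg (fun ξ => p.pairing ξ X) (hC α β)
  simp only [map_add, map_sub, LinearMap.add_apply, LinearMap.sub_apply, P.pairing_koszul_bracket,
    Bivector.mulMap_sharp, p.pairing_transpose, ← hΛ] at h
  linear_combination h

/-- The concomitant read in transposed form: one of the two forms serves as test covector, so that
the condition becomes an equation between sections of `V`. -/
theorem bracket_sharp_of_concomitant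
    (hC : ∀ α β, (P.koszul (Λ.mulMap N hΛ)).bracket α β =
      (P.koszul Λ).bracket (p.transpose N α) β + (P.koszul Λ).bracket α (p.transpose N β)
        - p.transpose N ((P.koszul Λ).bracket α β))
    (X : Cₛ^∞⟮𝓡 n; F, V⟯) (β : Cₛ^∞⟮𝓡 n; G, W⟯) :
    P.bracket (N.map X) (Λ.sharp.map β) - N.map (P.bracket X (Λ.sharp.map β))
      - Λ.sharp.map (P.lie (N.map X) β - P.lie X (p.transpose N β)) = 0 := by
  refine p.ext_right fun α => ?_
  have h := pairing_concomitant hC α β X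
  rw [P.bracket_skew _ (N.map X), P.bracket_skew _ (N.map X), P.bracket_skew _ X,
    P.bracket_skew _ X] at h
  simp only [map_add, map_sub, map_neg, LinearMap.add_apply, LinearMap.sub_apply,
    P.pairing_lie, p.pairing_transpose, Λ.pairing_sharp α, map_zero] at h ⊢
  linear_combination -h

/-- The second deformation of the standard bracket by `N`, in terms of `N²` and the torsion. -/
theorem deform_deform_diagEndo
    (hT : ∀ X Y, P.bracket (N.map X) (N.map Y) - N.map ((P.deform N).bracket X Y) =
      Λ.sharp.map (χ.contract p X Y)) :
    deformBracket (diagEndo p N) (deformBracket (diagEndo p N) P.dorfman) =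
      deformBracket (diagEndo p N.square) P.dorfman
        - (deformBracket Λ.endo (χ.toBracket p) + deformBracket Λ.endo (χ.toBracket p)) := by
  ext a b : 2
  refine Prod.ext (p.ext_left fun Z => ?_) ?_
  · have h1 := congrArg (p.pairing b.1) (hT a.2 Z)
    have h2 := congrArg (p.pairing a.1) (hT b.2 Z)
    simp only [P.deform_bracket,
      deformBracket_apply, AddMonoidHom.add_apply, AddMonoidHom.sub_apply, AddMonoidHom.neg_apply,
      BundleMap.square_map, diagEndo_apply, Bivector.endo_apply,
      Prod.fst_add, Prod.fst_sub, Prod.fst_neg, Prod.snd_neg, map_add, map_sub, map_neg,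
      LinearMap.add_apply, neg_neg,
      LinearMap.sub_apply, LinearMap.neg_apply, P.pairing_dorfman_fst, p.pairing_transpose,
      add_zero, LinearMap.zero_apply,
      map_zero, zero_add, sub_zero, ThreeForm.toBracket_apply, ThreeForm.pairing_contract,
      P.rhoForm_add, P.rhoForm_neg, P.rhoForm_add_left, P.bracket_add_left, P.dorfman_snd,
      P.bracket_neg_left, P.rhoForm_neg_left, P.rhoForm_sub, P.rhoForm_sub_left,
      P.bracket_add, Λ.pairing_sharp _ (χ.contract p _ _)] at h1 h2 ⊢
    rw [χ.eval_swap₂ a.2 Z] at h1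
    rw [χ.eval_swap₂ b.2 Z, χ.eval_swap₁ b.2] at h2
    linear_combination -2 * h1 + 2 * h2
  · have h1 := hT a.2 b.2
    simp only [P.deform_bracket,
      deformBracket_apply, AddMonoidHom.add_apply, AddMonoidHom.sub_apply, AddMonoidHom.neg_apply,
      BundleMap.square_map, diagEndo_apply, Bivector.endo_apply,
      Prod.snd_add, Prod.snd_sub, Prod.snd_neg, map_add, map_sub, map_neg,
      map_zero, ThreeForm.toBracket_apply, neg_neg, P.bracket_neg_left, P.bracket_neg,
      P.dorfman_snd] at h1 ⊢
    rw [← h1]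
    abel

/-- The form component is the concomitant paired with a section; the vector component uses its
transposed form for the pairs `(X, β)` and `(Y, α)`. -/
theorem deform_diagEndo_endo
    (hC : ∀ α β, (P.koszul (Λ.mulMap N hΛ)).bracket α β =
      (P.koszul Λ).bracket (p.transpose N α) β + (P.koszul Λ).bracket α (p.transpose N β)
        - p.transpose N ((P.koszul Λ).bracket α β)) :
    deformBracket (diagEndo p N) (deformBracket Λ.endo P.dorfman) =
      - deformBracket (Λ.mulMap N hΛ).endo P.dorfman := by
  ext a b : 2
  refine Prod.ext (p.ext_left fun Z => ?_) (p.ext_right fun γ => ?_)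
  · have h := pairing_concomitant hC a.1 b.1 Z
    have hN : p.pairing a.1 (N.map (Λ.sharp.map b.1)) =
        - p.pairing b.1 (N.map (Λ.sharp.map a.1)) := (Λ.mulMap N hΛ).pairing_sharp a.1 b.1
    simp only [
      deformBracket_apply, AddMonoidHom.add_apply, AddMonoidHom.sub_apply, AddMonoidHom.neg_apply,
      diagEndo_apply, Bivector.endo_apply, Bivector.mulMap_sharp,
      Prod.fst_add, Prod.fst_sub, Prod.fst_neg, map_add, map_sub, map_neg,
      LinearMap.add_apply, ← hΛ,
      LinearMap.sub_apply, LinearMap.neg_apply, P.pairing_dorfman_fst, p.pairing_transpose,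
      add_zero, LinearMap.zero_apply, P.rhoForm_zero, P.bracket_zero,
      map_zero, zero_add, sub_zero, P.dorfman_snd, P.bracket_neg_left, P.rhoForm_neg_left,
      P.rhoForm_neg, Λ.pairing_sharp a.1 b.1, hN] at h ⊢
    linear_combination h
  · have h1 := congrArg (p.pairing γ) (bracket_sharp_of_concomitant hC a.2 b.1)
    have h2 := congrArg (p.pairing γ) (bracket_sharp_of_concomitant hC b.2 a.1)
    simp only [
      deformBracket_apply, AddMonoidHom.add_apply, AddMonoidHom.sub_apply, AddMonoidHom.neg_apply,
      diagEndo_apply, Bivector.endo_apply, Bivector.mulMap_sharp,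
      Prod.snd_add, Prod.snd_sub, Prod.snd_neg, map_add, map_sub, map_neg,
      LinearMap.add_apply, ← hΛ, Λ.pairing_sharp γ, P.pairing_lie,
      LinearMap.sub_apply, LinearMap.neg_apply, P.pairing_dorfman_fst, p.pairing_transpose,
      add_zero, LinearMap.zero_apply, P.rhoForm_zero, P.bracket_zero,
      map_zero, zero_add, sub_zero, P.dorfman_snd, P.bracket_neg_left, P.rhoForm_neg_left,
      P.rhoForm_neg, P.bracket_neg] at h1 h2 ⊢
    rw [P.bracket_skew _ (N.map b.2), P.bracket_skew (Λ.sharp.map _) b.2]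
    simp only [map_neg]
    linear_combination h1 - h2

/-- Follows from the opposite order of deformation, since the commutator of the two endomorphisms is
`2 NΛ♯` by `N ∘ Λ♯ = Λ♯ ∘ N*`, and `-1 + 2 = 1`. -/
theorem deform_endo_diagEndo
    (hC : ∀ α β, (P.koszul (Λ.mulMap N hΛ)).bracket α β =
      (P.koszul Λ).bracket (p.transpose N α) β + (P.koszul Λ).bracket α (p.transpose N β)
        - p.transpose N ((P.koszul Λ).bracket α β)) :
    deformBracket Λ.endo (deformBracket (diagEndo p N) P.dorfman) =
      deformBracket (Λ.mulMap N hΛ).endo P.dorfman := by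
  have : (diagEndo p N).comp Λ.endo - Λ.endo.comp (diagEndo p N) =
      (Λ.mulMap N hΛ).endo + (Λ.mulMap N hΛ).endo := by
    ext a : 1
    refine Prod.ext ?_ ?_
    · have : p.transpose N 0 = 0 := p.ext_left fun X => by simp
      simp [diagEndo_apply, Bivector.endo_apply, this]
    · simp [diagEndo_apply, Bivector.endo_apply, Bivector.mulMap_sharp, ← hΛ]
  rw [deformBracket_comm, this, add_deformBracket, deform_diagEndo_endo hC]
  abel

/-- The endomorphism squares to zero and its image contains no forms, so the form component vanishes
identically. The vector component is twice the morphism defect of `Λ♯`. -/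
theorem deform_endo_endo (h : ∀ α β γ, P.schoutenJacobi Λ α β γ = 0) :
    deformBracket Λ.endo (deformBracket Λ.endo P.dorfman) = 0 := by
  ext a b : 2
  have h0 : P.bracket 0 = 0 := by
    funext Y; rw [P.bracket_skew, P.bracket_zero]; simp
  have r0 : P.rhoForm 0 = 0 := by
    funext f; simpa using P.rhoForm_sub_left 0 0 f
  refine Prod.ext (p.ext_left fun Z => ?_) (p.ext_right fun γ => ?_)
  · simp only [
      deformBracket_apply, AddMonoidHom.zero_apply,
      Bivector.endo_apply,
      Prod.fst_add, Prod.fst_sub, Prod.fst_zero, map_add, map_sub, 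
      LinearMap.add_apply,
      LinearMap.sub_apply, P.pairing_dorfman_fst, 
      add_zero, LinearMap.zero_apply, P.rhoForm_zero, P.bracket_zero, h0, r0, Pi.zero_apply,
      map_zero, zero_add, sub_zero, P.dorfman_snd]
  · have := congrArg (p.pairing γ) (P.sharp_koszul_bracket h a.1 b.1)
    simp only [
      deformBracket_apply, AddMonoidHom.zero_apply,
      Bivector.endo_apply, P.pairing_koszul_bracket,
      Prod.snd_add, Prod.snd_sub, Prod.snd_zero, map_add, map_sub, 
      LinearMap.add_apply, Λ.pairing_sharp γ, 
      LinearMap.sub_apply, P.pairing_dorfman_fst, 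
      add_zero, LinearMap.zero_apply, P.rhoForm_zero, P.bracket_zero, h0, r0, Pi.zero_apply,
      map_zero, zero_add, sub_zero, P.dorfman_snd, Λ.pairing_sharp a.1 b.1,
      P.rhoForm_neg] at this ⊢
    linear_combination -2 * this

end NijenhuisIdentities

/-! ### The two doubles of a Jacobi quasi-Nijenhuis algebroid and the relation between their
brackets -/

section QuasiNijenhuis

variable {n : ℕ} {M : Type*} [TopologicalSpace M] [ChartedSpace (EuclideanSpace ℝ (Fin n)) M]
  [IsManifold (𝓡 n) ∞ M] [T2Space M]
  {F : Type*} [NormedAddCommGroup F] [NormedSpace ℝ F] [FiniteDimensional ℝ F]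
  {V : M → Type*} [TopologicalSpace (TotalSpace F V)]
  [∀ x, AddCommGroup (V x)] [∀ x, Module ℝ (V x)] [∀ x, TopologicalSpace (V x)]
  [FiberBundle F V] [VectorBundle ℝ F V] [ContMDiffVectorBundle ∞ F V (𝓡 n)]
  {G : Type*} [NormedAddCommGroup G] [NormedSpace ℝ G] [FiniteDimensional ℝ G]
  {W : M → Type*} [TopologicalSpace (TotalSpace G W)]
  [∀ x, AddCommGroup (W x)] [∀ x, Module ℝ (W x)] [∀ x, TopologicalSpace (W x)]
  [FiberBundle G W] [VectorBundle ℝ G W] [ContMDiffVectorBundle ∞ G W (𝓡 n)]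

/-- Deforming the bracket of `χ` gives the bracket of `i_N χ`: the outer term `-(-N*)` supplies the
insertion of `N` in the third slot. -/
theorem ThreeForm.compatible_deform {p : Duality n F V G W} {P : AlmostJacobi p}
    {χ : ThreeForm n F V} {N : BundleMap n F V F V}
    (h : ∀ X Y Z U, P.dThree (χ.insert N) X Y Z U = 0) :
    Compatible P.dorfman (deformBracket (diagEndo p N) (χ.toBracket p)) := by
  refine AlmostJacobi.compatible_of_dThree (τ := χ.insert N) (fun a b Z => ?_) (fun a b => ?_)
    (fun X Y Z => ?_) (fun X Y Z => ?_) h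
  · simp only [deformBracket_apply, diagEndo_apply, ThreeForm.toBracket_apply, Prod.fst_add,
      Prod.fst_sub, map_add, map_sub, map_neg, LinearMap.add_apply, LinearMap.sub_apply,
      LinearMap.neg_apply, ThreeForm.pairing_contract, p.pairing_transpose, ThreeForm.insert]
    ring
  · simp [deformBracket_apply, diagEndo_apply, ThreeForm.toBracket_apply]
  · simp only [ThreeForm.insert]
    rw [χ.eval_swap₁ (N.map X), χ.eval_swap₁ X, χ.eval_swap₁ X]
    ring
  · simp only [ThreeForm.insert]
    rw [χ.eval_swap₂ (N.map X), χ.eval_swap₂ X (N.map Y), χ.eval_swap₂ X Y]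
    ring

theorem ThreeForm.eval_pullback (ψ : ThreeForm n F V) (N : BundleMap n F V F V)
    (X Y Z : Cₛ^∞⟮𝓡 n; F, V⟯) :
    (ψ.pullback N).eval X Y Z = ψ.eval (N.map X) (N.map Y) (N.map Z) := by
  ext x
  change ψ.toFun x _ = ψ.toFun x _
  congr 1
  funext i
  fin_cases i <;> rfl

theorem ThreeForm.contract_pullback (p : Duality n F V G W) (ψ : ThreeForm n F V)
    (N : BundleMap n F V F V) (X Y : Cₛ^∞⟮𝓡 n; F, V⟯) :
    (ψ.pullback N).contract p X Y = p.transpose N (ψ.contract p (N.map X) (N.map Y)) :=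
  p.ext_left fun Z => by
    rw [ThreeForm.pairing_contract, p.pairing_transpose, ThreeForm.pairing_contract,
      ThreeForm.eval_pullback]

namespace JacobiQuasiNijenhuis

variable (J : JacobiQuasiNijenhuis n F V)

/-- Each axiom has one role: closedness of the `3`-form and of its insertion are the compatibility
hypotheses of `compatible_deform_add`; the torsion, the concomitant and the Jacobi condition on the
bivector evaluate the second deformation. -/
theorem double_compatible :
    Compatible ((J.alg.deform J.N).doubleBracket (J.alg.koszul J.bivector) J.threeForm)
      ((J.alg.deform J.N).doubleBracket (J.alg.koszul J.bivector) J.threeForm) := by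
  rw [AlmostJacobi.doubleBracket_deform]
  refine compatible_deform_add (S := diagEndo (stdDuality n F V) J.N.square)
    J.isJacobi.compatible_dorfman (AlmostJacobi.IsClosed.compatible J.closed)
    J.threeForm.compatible_self (ThreeForm.compatible_deform J.closed_insert) ?_
  -- Of the four double deformations, the two mixed ones cancel and that by the bivector vanishes;
  -- the remaining one is `N²·m` with the torsion correction.
  rw [add_deformBracket, add_deformBracket, deformBracket_add, deformBracket_add,
    deform_deform_diagEndo J.torsion, deform_diagEndo_endo J.concomitant,
    deform_endo_diagEndo J.concomitant, deform_endo_endo J.schoutenJacobi_eq_zero]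
  abel

theorem double_isCourantJacobi : J.double.IsCourantJacobi :=
  JQN.double_isCourantJacobi J.double_compatible

/-- Apply `Λ♯` to the concomitant: `Λ♯` is a morphism for `[·,·]_Λ` and turns `N*` into `N`. -/
theorem sharp_koszul_mulBivector (α β : Cₛ^∞⟮𝓡 n; F →L[ℝ] ℝ, Dual V⟯) :
    J.bivector.sharp.map ((J.alg.koszul J.mulBivector).bracket α β) =
      (J.alg.deform J.N).bracket (J.bivector.sharp.map α) (J.bivector.sharp.map β) := by
  rw [mulBivector, J.concomitant, map_sub, map_add, ← J.map_sharp,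
    J.alg.sharp_koszul_bracket J.schoutenJacobi_eq_zero,
    J.alg.sharp_koszul_bracket J.schoutenJacobi_eq_zero,
    J.alg.sharp_koszul_bracket J.schoutenJacobi_eq_zero, ← J.map_sharp, ← J.map_sharp]
  rfl

theorem mulBivector_sharp (α : Cₛ^∞⟮𝓡 n; F →L[ℝ] ℝ, Dual V⟯) :
    J.mulBivector.sharp.map α = J.N.map (J.bivector.sharp.map α) := rfl

variable {J} {ψ : ThreeForm n F V} (h : J.threeForm = ψ.pullback J.N)
include h

theorem sharp_threeForm (X Y : Cₛ^∞⟮𝓡 n; F, V⟯) :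
    J.bivector.sharp.map (J.threeForm.contract (stdDuality n F V) X Y) =
      J.mulBivector.sharp.map (ψ.contract (stdDuality n F V) (J.N.map X) (J.N.map Y)) := by
  rw [h, ThreeForm.contract_pullback, mulBivector_sharp, ← J.map_sharp]

/-- The torsion identity on `Λ♯ α`, `Λ♯ β`, where the deformed bracket is `Λ♯ [α, β]_{NΛ}` and `Λ♯
N* = N Λ♯` moves the transpose coming from `N*ψ`. -/
theorem bracket_mulBivector (α β : Cₛ^∞⟮𝓡 n; F →L[ℝ] ℝ, Dual V⟯) :
    J.alg.bracket (J.mulBivector.sharp.map α) (J.mulBivector.sharp.map β)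
      - J.mulBivector.sharp.map ((J.alg.koszul J.mulBivector).bracket α β) =
      J.mulBivector.sharp.map (ψ.contract (stdDuality n F V) (J.mulBivector.sharp.map α)
        (J.mulBivector.sharp.map β)) := by
  have := J.torsion (J.bivector.sharp.map α) (J.bivector.sharp.map β)
  rw [sharp_threeForm h] at this
  rw [J.mulBivector_sharp ((J.alg.koszul J.mulBivector).bracket α β), sharp_koszul_mulBivector]
  exact this

theorem twistedDouble_isCourantJacobi (hψ : J.alg.IsClosed ψ) :
    (J.twistedDouble ψ).IsCourantJacobi :=
  JQN.double_isCourantJacobi <| (J.isJacobi.compatible_dorfman.add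
      (AlmostJacobi.IsClosed.compatible hψ) ψ.compatible_self).conj
    (T := J.mulBivector.shear) (T' := J.mulBivector.unshear)
    (fun x => by simp [Bivector.shear_apply, Bivector.unshear_apply])
    (J.alg.doubleBracket_twist (bracket_mulBivector h))

-- The vector half of the closure of the graph under the bracket. The shear sends `(α, N X)` to `(α,
-- N (X + Λ♯ α))`, so the vector part of the standard bracket is a bracket of two values of `N`, to
-- which the torsion identity applies.
set_option maxHeartbeats 800000 in
theorem doubleBracket_snd (α β : Cₛ^∞⟮𝓡 n; F →L[ℝ] ℝ, Dual V⟯) (X Y : Cₛ^∞⟮𝓡 n; F, V⟯) :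
    ((J.alg.twistBy J.mulBivector ψ).doubleBracket (J.alg.koszulTwisted J.mulBivector ψ) ψ
        (α, J.N.map X) (β, J.N.map Y)).2 =
      J.N.map ((J.alg.deform J.N).doubleBracket (J.alg.koszul J.bivector) J.threeForm
        ((stdDuality n F V).transpose J.N α, X) ((stdDuality n F V).transpose J.N β, Y)).2 := by
  have hT := J.torsion (X + J.bivector.sharp.map α) (Y + J.bivector.sharp.map β)
  rw [sharp_threeForm h, sub_eq_iff_eq_add, mulBivector_sharp, map_add J.N.map X,
    map_add J.N.map Y] at hT
  rw [J.alg.doubleBracket_twist (bracket_mulBivector h)]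
  change J.alg.bracket (J.N.map X + J.N.map (J.bivector.sharp.map α))
      (J.N.map Y + J.N.map (J.bivector.sharp.map β)) + 0 - J.N.map (J.bivector.sharp.map
        (J.alg.lie (J.N.map X + J.N.map (J.bivector.sharp.map α)) β
          - J.alg.iD (J.N.map Y + J.N.map (J.bivector.sharp.map β)) α
          + ψ.contract (stdDuality n F V) (J.N.map X + J.N.map (J.bivector.sharp.map α))
            (J.N.map Y + J.N.map (J.bivector.sharp.map β)))) = _
  -- The `ψ` term of the torsion cancels the one produced by undoing the shear, and an outer `N`
  -- factors out of the rest, so the equality can be proved before `N` is applied.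
  rw [add_zero, hT, map_add J.bivector.sharp.map, map_add J.N.map (J.bivector.sharp.map _),
    add_comm (J.N.map (J.bivector.sharp.map (J.alg.lie _ _ - _))), add_sub_add_left_eq_sub,
    ← map_sub J.N.map]
  congr 1
  refine (stdDuality n F V).ext_right fun γ => ?_
  -- By bilinearity the remaining identity splits into the pairs `(X, Y)`, which is trivial, `(X,
  -- β)` and `(Y, α)`, which are the concomitant, and `(α, β)`, which is `sharp_koszul_mulBivector`.
  have h1 := bracket_sharp_of_concomitant J.concomitant X β
  have h2 := bracket_sharp_of_concomitant J.concomitant Y α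
  apply_fun (stdDuality n F V).pairing γ at h1 h2
  have h3 := congrArg ((stdDuality n F V).pairing γ) (J.sharp_koszul_mulBivector α β)
  rw [AlmostJacobi.doubleBracket_deform]
  simp only [deformBracket_apply, AddMonoidHom.add_apply, diagEndo_apply, Bivector.endo_apply,
    J.alg.deform_bracket, mulBivector_sharp, J.alg.pairing_koszul_bracket,
    ThreeForm.toBracket_apply, ← J.map_sharp, Prod.snd_add, Prod.snd_sub,
    map_add, map_sub, map_neg, LinearMap.add_apply, LinearMap.sub_apply, LinearMap.neg_apply,
    J.bivector.pairing_sharp γ, J.alg.pairing_lie, J.alg.pairing_iD, AlmostJacobi.dForm,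
    J.alg.pairing_dorfman_fst, Duality.pairing_transpose, add_zero, map_zero, zero_add, sub_zero,
    J.alg.dorfman_snd, J.alg.bracket_add_left, J.alg.bracket_add, J.alg.rhoForm_add_left,
    J.alg.rhoForm_add, J.alg.rhoForm_zero, J.alg.rhoForm_neg] at h1 h2 h3 ⊢
  rw [J.alg.bracket_skew _ (J.bivector.sharp.map α), J.alg.bracket_skew _ (J.bivector.sharp.map α),
    map_neg, map_neg, map_neg] at h2
  have hN : (stdDuality n F V).pairing α (J.N.map (J.bivector.sharp.map β)) =
      - (stdDuality n F V).pairing β (J.N.map (J.bivector.sharp.map α)) :=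
    J.mulBivector.pairing_sharp α β
  have hR := congrArg (J.alg.rhoForm (J.bivector.sharp.map γ)) hN
  rw [J.alg.rhoForm_neg] at hR
  linear_combination h1 - h2 - h3 + hR

/-- The form half of the closure. Pairing with `Z` puts `N Z` on one side, so the torsion is needed
with `Z` as second argument. The terms in `α` and `β` alone are handled by the torsion at `Λ♯ α` and
the concomitant at `N*β`, `α`. -/
theorem doubleBracket_fst (α β : Cₛ^∞⟮𝓡 n; F →L[ℝ] ℝ, Dual V⟯) (X Y : Cₛ^∞⟮𝓡 n; F, V⟯) :
    ((J.alg.deform J.N).doubleBracket (J.alg.koszul J.bivector) J.threeForm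
        ((stdDuality n F V).transpose J.N α, X) ((stdDuality n F V).transpose J.N β, Y)).1 =
      (stdDuality n F V).transpose J.N
        ((J.alg.twistBy J.mulBivector ψ).doubleBracket (J.alg.koszulTwisted J.mulBivector ψ) ψ
          (α, J.N.map X) (β, J.N.map Y)).1 := by
  refine (stdDuality n F V).ext_left fun Z => ?_
  have h1 := congrArg ((stdDuality n F V).pairing β) (J.torsion X Z)
  have h2 := congrArg ((stdDuality n F V).pairing α) (J.torsion Y Z)
  have h3 := congrArg ((stdDuality n F V).pairing β) (J.torsion (J.bivector.sharp.map α) Z)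
  have h4 := pairing_concomitant J.concomitant ((stdDuality n F V).transpose J.N β) α Z
  rw [J.alg.doubleBracket_twist (bracket_mulBivector h), Bivector.unshear_apply,
    AlmostJacobi.doubleBracket_deform]
  simp only [deformBracket_apply, AddMonoidHom.add_apply, diagEndo_apply, Bivector.endo_apply,
    J.alg.deform_bracket, mulBivector_sharp, J.alg.pairing_koszul_bracket, Bivector.shear_apply,
    ThreeForm.toBracket_apply, ← J.map_sharp, Prod.snd_add, Prod.snd_sub, Prod.fst_add,
    Prod.fst_sub,
    map_add, map_sub, map_neg, LinearMap.add_apply, LinearMap.sub_apply, LinearMap.neg_apply,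
    J.alg.pairing_lie, J.alg.pairing_iD, AlmostJacobi.dForm,
    J.alg.pairing_dorfman_fst, Duality.pairing_transpose, add_zero, map_zero, zero_add, sub_zero,
    J.alg.dorfman_snd, J.alg.bracket_add_left, J.alg.bracket_add, J.alg.rhoForm_add_left,
    J.alg.rhoForm_add, LinearMap.zero_apply, J.alg.rhoForm_zero, J.alg.rhoForm_neg,
    ThreeForm.pairing_contract, ← ThreeForm.eval_pullback, ← h,
    J.bivector.pairing_sharp _ (J.threeForm.contract _ _ _)] at h1 h2 h3 h4 ⊢
  rw [J.threeForm.eval_swap₂ _ Z] at h1 h2 h3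
  rw [J.threeForm.eval_swap₁ Y] at h2
  linear_combination h1 - h2 + h3 + h4

end JacobiQuasiNijenhuis
end QuasiNijenhuis

/-! ### Pointwise comparison of the bracket of the exterior product with the pair of brackets -/

section LinearAlgebra

universe u

variable {T ι κ : Type*} {E E' : Type u} [AddCommGroup T] [Module ℝ T] [AddCommGroup E] [Module ℝ E]
  [AddCommGroup E'] [Module ℝ E'] [Fintype ι] [Fintype κ]

/-- Comparison of a bracket of sums `∑ f_i (a_i, b_i)` and `∑ g_j (c_j, d_j)`, whose coefficients
have the partial derivatives `f₁, f₂` and `g₁, g₂`, with the pair of the brackets of the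
components. -/
theorem sum_leibniz_eq (ρ : E →ₗ[ℝ] T) (ρ' : E' →ₗ[ℝ] T) (sh : (T →ₗ[ℝ] ℝ) →ₗ[ℝ] E)
    (sh' : (T →ₗ[ℝ] ℝ) →ₗ[ℝ] E') (f : ι → ℝ) (g : κ → ℝ) (a : ι → E) (b : ι → E') (c : κ → E)
    (d : κ → E') (f₁ f₂ : ι → T →ₗ[ℝ] ℝ) (g₁ g₂ : κ → T →ₗ[ℝ] ℝ) (A : ι → κ → E)
    (B : ι → κ → E') (p q : ι → κ → ℝ)
    (h : ρ (∑ i, f i • a i) = ρ' (∑ i, f i • b i)) (h' : ρ (∑ j, g j • c j) = ρ' (∑ j, g j • d j)) :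
    ∑ i, ∑ j, ((f i * g j) • (A i j, B i j)
        + (f i * (g₁ j (ρ (a i)) + g₂ j (ρ' (b i)))) • (c j, d j)
        - (g j * (f₁ i (ρ (c j)) + f₂ i (ρ' (d j)))) • (a i, b i)
        + (g j * (p i j - q i j)) • (sh (f₁ i), - sh' (f₂ i))) =
      (∑ i, ∑ j, ((f i * g j) • A i j + (f i * (g₁ j + g₂ j) (ρ (a i))) • c j
        - (g j * (f₁ i + f₂ i) (ρ (c j))) • a i + (g j * p i j) • sh (f₁ i + f₂ i)),
       ∑ i, ∑ j, ((f i * g j) • B i j + (f i * (g₁ j + g₂ j) (ρ' (b i))) • d j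
        - (g j * (f₁ i + f₂ i) (ρ' (d j))) • b i + (g j * q i j) • sh' (f₁ i + f₂ i)))
      + ∑ i, ∑ j, (- g j) • (sh (q i j • f₁ i + p i j • f₂ i), sh' (q i j • f₁ i + p i j • f₂ i)) := by
  -- Replacing `ρ'(b i)` by `ρ(a i)` inside a partial derivative changes the sum over `i` by the
  -- derivative along `ρ'(∑ f b) - ρ(∑ f a)`, which is zero. Hence each partial derivative may be
  -- taken along either anchor, and only the `sh` terms differ.
  have key (U : Type u) [AddCommGroup U] [Module ℝ U] (l : κ → T →ₗ[ℝ] ℝ) (u : κ → U) :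
      ∑ i, ∑ j, (f i * l j (ρ' (b i) - ρ (a i))) • u j = 0 := by
    rw [Finset.sum_comm]
    refine Finset.sum_eq_zero fun j _ => ?_
    have h0 : ∑ i, f i * l j (ρ' (b i) - ρ (a i)) = 0 := by
      have := congrArg (l j) (sub_eq_zero.2 h.symm)
      simpa only [map_sum, map_sub, map_smul, map_zero, smul_eq_mul, ← Finset.sum_sub_distrib,
        ← mul_sub] using this
    rw [← Finset.sum_smul, h0, zero_smul]
  have key' (U : Type u) [AddCommGroup U] [Module ℝ U] (l : ι → T →ₗ[ℝ] ℝ) (u : ι → U) :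
      ∑ i, ∑ j, (g j * l i (ρ' (d j) - ρ (c j))) • u i = 0 := by
    refine Finset.sum_eq_zero fun i _ => ?_
    have h0 : ∑ j, g j * l i (ρ' (d j) - ρ (c j)) = 0 := by
      have := congrArg (l i) (sub_eq_zero.2 h'.symm)
      simpa only [map_sum, map_sub, map_smul, map_zero, smul_eq_mul, ← Finset.sum_sub_distrib,
        ← mul_sub] using this
    rw [← Finset.sum_smul, h0, zero_smul]
  refine Prod.ext ?_ ?_
  · have h1 := key E g₂ c
    have h2 := key' E f₂ a
    rw [← sub_eq_zero]
    refine Eq.trans ?_ (congrArg₂ (· - ·) h1 h2 |>.trans (sub_zero _))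
    simp only [Prod.fst_add, Prod.fst_sub, Prod.fst_sum, Prod.smul_fst, ← Finset.sum_sub_distrib,
      ← sub_sub, map_add, map_smul, map_sub, LinearMap.add_apply]
    refine Finset.sum_congr rfl fun i _ => Finset.sum_congr rfl fun j _ => ?_
    module
  · have h1 := key E' g₁ d
    have h2 := key' E' f₁ b
    rw [← sub_eq_zero]
    refine Eq.trans ?_ (congrArg₂ (fun x y => y - x) h1 h2 |>.trans (sub_zero _))
    simp only [Prod.snd_add, Prod.snd_sub, Prod.snd_sum, Prod.smul_snd, ← Finset.sum_sub_distrib,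
      ← sub_sub, map_add, map_smul, map_sub, LinearMap.add_apply]
    refine Finset.sum_congr rfl fun i _ => Finset.sum_congr rfl fun j _ => ?_
    module

end LinearAlgebra

/-! ### Leibniz rules of a Courant-Jacobi algebroid -/

namespace CourantJacobiData
section Leibniz

variable {n : ℕ} {M : Type*} [TopologicalSpace M] [ChartedSpace (EuclideanSpace ℝ (Fin n)) M]
  [IsManifold (𝓡 n) ∞ M] [T2Space M]
  {F : Type*} [NormedAddCommGroup F] [NormedSpace ℝ F] [FiniteDimensional ℝ F]
  {E : M → Type*} [TopologicalSpace (TotalSpace F E)]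
  [∀ x, AddCommGroup (E x)] [∀ x, Module ℝ (E x)] [∀ x, TopologicalSpace (E x)]
  [FiberBundle F E] [VectorBundle ℝ F E] [ContMDiffVectorBundle ∞ F E (𝓡 n)]
  {D : CourantJacobiData n F E}

/-- The differential of a function at a point. -/
def differential (f : M → ℝ) (x : M) : TangentSpace (𝓡 n) x →ₗ[ℝ] ℝ :=
  (mfderiv (𝓡 n) 𝓘(ℝ, ℝ) f x).toLinearMap

/-- The function `θ(e)`. -/
def thetaFun (D : CourantJacobiData n F E) (e : Cₛ^∞⟮𝓡 n; F, E⟯) : C^∞⟮𝓡 n, M; ℝ⟯ :=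
  ⟨fun x => D.theta x (e x), D.theta_smooth e⟩

theorem act_eq (e : Cₛ^∞⟮𝓡 n; F, E⟯) (f : C^∞⟮𝓡 n, M; ℝ⟯) :
    D.act e f = VectorField.act (D.anchor.map e) f + D.thetaFun e * f := rfl

theorem pairing_sharp (x : M) (l : E x →ₗ[ℝ] ℝ) (v : E x) :
    D.pairing x (D.sharp x l) v = l v := by
  have : FiniteDimensional ℝ (E x) := VectorBundle.finiteDimensional ℝ F E x
  exact LinearMap.BilinForm.apply_toDual_symm_apply ..

theorem eq_of_pairing_eq {x : M} {u v : E x}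
    (h : ∀ e : Cₛ^∞⟮𝓡 n; F, E⟯, D.pairing x u (e x) = D.pairing x v (e x)) : u = v := by
  refine sub_eq_zero.1 ((D.pairing_nondegenerate x).1 _ fun w => ?_)
  obtain ⟨e, rfl⟩ := exists_section_eq (n := n) (F := F) x w
  rw [map_sub, LinearMap.sub_apply, h, sub_self]

/-- `D.sharp` composed with the transpose of the anchor, as a linear map. -/
def coanchor (D : CourantJacobiData n F E) (x : M) :
    (TangentSpace (𝓡 n) x →ₗ[ℝ] ℝ) →ₗ[ℝ] E x where
  toFun l := D.sharp x (l ∘ₗ (D.anchor.toFun x).toLinearMap)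
  map_add' l l' := eq_of_pairing_eq (D := D) fun e => by
    simp only [map_add, LinearMap.add_apply, pairing_sharp, LinearMap.comp_apply]
  map_smul' c l := eq_of_pairing_eq (D := D) fun e => by
    simp only [map_smul, LinearMap.smul_apply, pairing_sharp, LinearMap.comp_apply,
      RingHom.id_apply]

theorem pairing_coanchor (x : M) (l : TangentSpace (𝓡 n) x →ₗ[ℝ] ℝ) (v : E x) :
    D.pairing x (D.coanchor x l) v = l (D.anchor.toFun x v) := pairing_sharp x _ v

/-- Compare the invariance axiom for `g • e₂` and for `e₂`: the `θ` terms agree up to the factor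
`g`, and nondegeneracy gives the bracket. -/
theorem IsCourantJacobi.bracket_smul (hD : D.IsCourantJacobi) (e₁ e₂ : Cₛ^∞⟮𝓡 n; F, E⟯)
    (g : C^∞⟮𝓡 n, M; ℝ⟯) :
    D.bracket e₁ (g • e₂) = g • D.bracket e₁ e₂ + VectorField.act (D.anchor.map e₁) g • e₂ := by
  ext x
  refine eq_of_pairing_eq (D := D) fun e => ?_
  have hp : D.pair (g • e₂) e = g * D.pair e₂ e := by
    ext y; exact LinearMap.map_smul₂ (D.pairing y) (g y) (e₂ y) (e y)
  have hp' : D.pair (g • e₂) (D.bracket e₁ e) = g * D.pair e₂ (D.bracket e₁ e) := by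
    ext y; exact LinearMap.map_smul₂ (D.pairing y) (g y) (e₂ y) _
  have h1 := hD.act_pair_eq e₁ (g • e₂) e
  have h2 := hD.act_pair_eq e₁ e₂ e
  rw [hp, hp'] at h1
  simp only [act_eq, VectorField.act_mul] at h1 h2
  have h3 : D.pair (D.bracket e₁ (g • e₂)) e =
      g * D.pair (D.bracket e₁ e₂) e + VectorField.act (D.anchor.map e₁) g * D.pair e₂ e := by
    linear_combination g * h2 - h1
  have h4 := congrArg (fun f : C^∞⟮𝓡 n, M; ℝ⟯ => f x) h3
  change _ = D.pairing x (g x • D.bracket e₁ e₂ x + VectorField.act (D.anchor.map e₁) g x • e₂ x) _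
  rw [map_add, LinearMap.add_apply, LinearMap.map_smul₂, LinearMap.map_smul₂]
  exact h4

/-- The axiom on the symmetric part of the bracket reduces the first argument to the second;
differentiating `f ⟨e₁, e₂⟩` there produces the extra term `⟨e₁, e₂⟩ ρ*(df)`. -/
theorem IsCourantJacobi.smul_bracket_apply (hD : D.IsCourantJacobi) (e₁ e₂ : Cₛ^∞⟮𝓡 n; F, E⟯)
    (f : C^∞⟮𝓡 n, M; ℝ⟯) (x : M) :
    D.bracket (f • e₁) e₂ x = f x • D.bracket e₁ e₂ x
      - VectorField.act (D.anchor.map e₂) f x • e₁ x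
      + D.pairing x (e₁ x) (e₂ x) • D.coanchor x (differential f x) := by
  refine eq_of_pairing_eq (D := D) fun e => ?_
  have hp : D.pair (f • e₁) e₂ = f * D.pair e₁ e₂ := by
    ext y; exact LinearMap.map_smul₂ (D.pairing y) (f y) (e₁ y) (e₂ y)
  have h1 := hD.act_pair e (f • e₁) e₂
  have h2 := hD.act_pair e e₁ e₂
  rw [hp, hD.bracket_smul] at h1
  simp only [act_eq, VectorField.act_mul] at h1 h2
  have h3 := congrArg (fun f : C^∞⟮𝓡 n, M; ℝ⟯ => f x) h1
  have h4 := congrArg (fun f : C^∞⟮𝓡 n, M; ℝ⟯ => f x) h2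
  change f x * VectorField.act (D.anchor.map e) (D.pair e₁ e₂) x
    + D.pairing x (e₁ x) (e₂ x) * VectorField.act (D.anchor.map e) f x
    + D.theta x (e x) * (f x * D.pairing x (e₁ x) (e₂ x)) = D.pairing x (e x)
      (D.bracket (f • e₁) e₂ x + (f x • D.bracket e₂ e₁ x
        + VectorField.act (D.anchor.map e₂) f x • e₁ x)) at h3
  change VectorField.act (D.anchor.map e) (D.pair e₁ e₂) x
    + D.theta x (e x) * D.pairing x (e₁ x) (e₂ x) = D.pairing x (e x)
      (D.bracket e₁ e₂ x + D.bracket e₂ e₁ x) at h4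
  simp only [map_add, map_sub, map_smul, LinearMap.add_apply, LinearMap.sub_apply,
    LinearMap.smul_apply, pairing_coanchor, smul_eq_mul, D.pairing_symm x (e x)] at h3 h4 ⊢
  have h5 : differential f x (D.anchor.toFun x (e x)) =
    VectorField.act (D.anchor.map e) f x := rfl
  rw [h5]
  linear_combination f x * h4 - h3

/-- The bracket as a biadditive map. -/
def IsCourantJacobi.bracketHom (hD : D.IsCourantJacobi) :
    Cₛ^∞⟮𝓡 n; F, E⟯ →+ Cₛ^∞⟮𝓡 n; F, E⟯ →+ Cₛ^∞⟮𝓡 n; F, E⟯ :=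
  biadd D.bracket hD.add_left hD.add_right

theorem section_sum_apply {ι : Type*} (s : Finset ι) (X : ι → Cₛ^∞⟮𝓡 n; F, E⟯) (x : M) :
    (∑ i ∈ s, X i) x = ∑ i ∈ s, X i x := by
  change ContMDiffSection.coeAddHom (𝓡 n) F ∞ E _ x = _
  rw [map_sum, Finset.sum_apply]; rfl

theorem IsCourantJacobi.bracket_sum_apply (hD : D.IsCourantJacobi) {ι κ : Type*} [Fintype ι]
    [Fintype κ] (f : ι → C^∞⟮𝓡 n, M; ℝ⟯) (g : κ → C^∞⟮𝓡 n, M; ℝ⟯) (a : ι → Cₛ^∞⟮𝓡 n; F, E⟯)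
    (c : κ → Cₛ^∞⟮𝓡 n; F, E⟯) (x : M) :
    D.bracket (∑ i, f i • a i) (∑ j, g j • c j) x =
      ∑ i, ∑ j, ((f i x * g j x) • D.bracket (a i) (c j) x
        + (f i x * differential (g j) x (D.anchor.toFun x (a i x))) • c j x
        - (g j x * differential (f i) x (D.anchor.toFun x (c j x))) • a i x
        + (g j x * D.pairing x (a i x) (c j x)) •
          D.coanchor x (differential (f i) x)) := by
  change hD.bracketHom _ _ x = _
  simp only [map_sum, AddMonoidHom.finsetSum_apply, section_sum_apply]
  rw [Finset.sum_comm]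
  refine Finset.sum_congr rfl fun i _ => Finset.sum_congr rfl fun j _ => ?_
  change D.bracket (f i • a i) (g j • c j) x = _
  rw [hD.bracket_smul]
  change g j x • D.bracket (f i • a i) (c j) x +
    differential (g j) x (D.anchor.toFun x (f i x • a i x)) • c j x = _
  rw [hD.smul_bracket_apply, map_smul, map_smul, smul_eq_mul]
  change g j x • (_ - differential (f i) x (D.anchor.toFun x (c j x)) • _
    + _) + _ = _
  module

end Leibniz
end CourantJacobiData

/-! ### Restriction to the diagonal -/

namespace CourantJacobiData
section Diagonal

universe u

variable {n : ℕ} {M : Type*} [TopologicalSpace M] [ChartedSpace (EuclideanSpace ℝ (Fin n)) M]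
  [IsManifold (𝓡 n) ∞ M] [T2Space M]
  {F : Type*} [NormedAddCommGroup F] [NormedSpace ℝ F] [FiniteDimensional ℝ F]
  {E : M → Type u} [TopologicalSpace (TotalSpace F E)]
  [∀ x, AddCommGroup (E x)] [∀ x, Module ℝ (E x)] [∀ x, TopologicalSpace (E x)]
  [FiberBundle F E] [VectorBundle ℝ F E] [ContMDiffVectorBundle ∞ F E (𝓡 n)]
  {F' : Type*} [NormedAddCommGroup F'] [NormedSpace ℝ F'] [FiniteDimensional ℝ F']
  {E' : M → Type u} [TopologicalSpace (TotalSpace F' E')]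
  [∀ x, AddCommGroup (E' x)] [∀ x, Module ℝ (E' x)] [∀ x, TopologicalSpace (E' x)]
  [FiberBundle F' E'] [VectorBundle ℝ F' E'] [ContMDiffVectorBundle ∞ F' E' (𝓡 n)]
  {D : CourantJacobiData n F E} {D' : CourantJacobiData n F' E'}

/-- The restriction of a function on `M × M` to the diagonal. -/
def diagRestrict (f : C^∞⟮(𝓡 n).prod (𝓡 n), M × M; ℝ⟯) : C^∞⟮𝓡 n, M; ℝ⟯ :=
  ⟨fun x => f (x, x), f.contMDiff.comp (contMDiff_id.prodMk contMDiff_id)⟩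

/-- The chain rule along the diagonal, whose derivative is `v ↦ (v, v)`. -/
theorem differential_diagRestrict (f : C^∞⟮(𝓡 n).prod (𝓡 n), M × M; ℝ⟯) (x : M) :
    differential (n := n) (diagRestrict f) x =
      differential (n := n) (fun x' => f (x', x)) x + differential (n := n) (fun y' => f (x, y')) x := by
  ext v
  have hf : MDifferentiableAt ((𝓡 n).prod (𝓡 n)) 𝓘(ℝ, ℝ) f (x, x) :=
    f.contMDiff.mdifferentiable (by simp) (x, x)
  have h1 : mfderiv (𝓡 n) 𝓘(ℝ, ℝ) (f ∘ fun x : M => (x, x)) x = _ :=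
    mfderiv_comp x hf (mdifferentiableAt_id.prodMk mdifferentiableAt_id)
  have h2 : mfderiv (𝓡 n) ((𝓡 n).prod (𝓡 n)) (fun x : M => (x, x)) x v = (v, v) := by
    have := mfderiv_prodMk (I := 𝓡 n) (x := x) (mdifferentiableAt_id (I := 𝓡 n) (M := M))
      (mdifferentiableAt_id (I := 𝓡 n) (M := M))
    simp only [mfderiv_id] at this
    exact congrArg (fun l => l v) this
  have h3 := mfderiv_prod_eq_add_apply (v := ((v, v) : TangentSpace ((𝓡 n).prod (𝓡 n)) (x, x))) hf
  change mfderiv (𝓡 n) 𝓘(ℝ, ℝ) (f ∘ fun x : M => (x, x)) x v = _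
  rw [h1]
  refine Eq.trans ?_ h3
  exact congrArg (mfderiv ((𝓡 n).prod (𝓡 n)) 𝓘(ℝ, ℝ) f (x, x)) h2

/-- For a family `L` that contains its orthogonal and satisfies the anchor condition, closure for
pairs of sections over `M` implies closure for sections with coefficients on `M × M`. -/
theorem prodBracket_diag_mem (hD : D.IsCourantJacobi) (hD' : D'.IsCourantJacobi)
    {L : ∀ x, Submodule ℝ (E x × E' x)}
    (hL : ∀ x u, (∀ v ∈ L x, diffPairing D D' x x u v = 0) → u ∈ L x)
    (hρ : ∀ x, ∀ u ∈ L x, D.anchor.toFun x u.1 = D'.anchor.toFun x u.2)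
    (hc : ∀ S S' T T', (∀ x, (S x, S' x) ∈ L x) → (∀ x, (T x, T' x) ∈ L x) →
      ∀ x, (D.bracket S T x, D'.bracket S' T' x) ∈ L x)
    (s t : ProdSection n F E n F' E') (hs : ∀ x, s.value x x ∈ L x)
    (ht : ∀ x, t.value x x ∈ L x) (x : M) : prodBracket D D' s t x x ∈ L x := by
  have hval : ∀ (s : ProdSection n F E n F' E') (x : M), s.value x x =
      ((∑ i, diagRestrict (s.coeff i) • s.left i) x,
        (∑ i, diagRestrict (s.coeff i) • s.right i) x) := fun s x => by
    rw [section_sum_apply, section_sum_apply, ProdSection.value]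
    exact Prod.ext (Prod.fst_sum ..) (Prod.snd_sum ..)
  have hval' : ∀ (s : ProdSection n F E n F' E') (x : M), s.value x x =
      (∑ i, s.coeff i (x, x) • s.left i x, ∑ i, s.coeff i (x, x) • s.right i x) := fun s x =>
    Prod.ext (Prod.fst_sum ..) (Prod.snd_sum ..)
  have h1 := hρ x _ (hs x)
  have h2 := hρ x _ (ht x)
  rw [hval'] at h1 h2
  -- On the diagonal `s` and `t` are pairs of genuine sections, so their componentwise bracket lies
  -- in `L`; `sum_leibniz_eq` measures its difference from the product bracket.
  have h3 := hc _ _ _ _ (fun x => hval s x ▸ hs x) (fun x => hval t x ▸ ht x) x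
  rw [hD.bracket_sum_apply, hD'.bracket_sum_apply] at h3
  simp only [differential_diagRestrict] at h3
  have key := sum_leibniz_eq (D.anchor.toFun x).toLinearMap (D'.anchor.toFun x).toLinearMap
    (D.coanchor x) (D'.coanchor x) (fun i => s.coeff i (x, x)) (fun j => t.coeff j (x, x))
    (fun i => s.left i x) (fun i => s.right i x) (fun j => t.left j x) (fun j => t.right j x)
    (fun i => differential (n := n) (fun x' => s.coeff i (x', x)) x)
    (fun i => differential (n := n) (fun x' => s.coeff i (x, x')) x)
    (fun i => differential (n := n) (fun x' => t.coeff i (x', x)) x)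
    (fun i => differential (n := n) (fun x' => t.coeff i (x, x')) x)
    (fun i j => D.bracket (s.left i) (t.left j) x) (fun i j => D'.bracket (s.right i) (t.right j) x)
    (fun i j => D.pairing x (s.left i x) (t.left j x))
    (fun i j => D'.pairing x (s.right i x) (t.right j x)) h1 h2
  change (∑ i, ∑ j, _ : E x × E' x) ∈ L x
  -- The difference is a combination of elements `(ρ*ω, ρ'*ω)`. Such an element pairs with `v ∈ L`
  -- to `ω(ρ v.1) - ω(ρ' v.2) = 0`, so it lies in `L`.
  refine (congrArg (· ∈ L x) key).mpr (Submodule.add_mem _ h3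
    (Submodule.sum_mem _ fun i _ => Submodule.sum_mem _ fun j _ => Submodule.smul_mem _ _
      (hL x _ fun v hv => ?_)))
  rw [diffPairing, pairing_coanchor, pairing_coanchor, hρ x v hv, sub_self]

end Diagonal
end CourantJacobiData

/-! ### The graph as a Dirac structure -/

section Main

variable {n : ℕ} {M : Type*} [TopologicalSpace M] [ChartedSpace (EuclideanSpace ℝ (Fin n)) M]
  [IsManifold (𝓡 n) ∞ M] [T2Space M]
  {F : Type*} [NormedAddCommGroup F] [NormedSpace ℝ F] [FiniteDimensional ℝ F]
  {V : M → Type*} [TopologicalSpace (TotalSpace F V)]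
  [∀ x, AddCommGroup (V x)] [∀ x, Module ℝ (V x)] [∀ x, TopologicalSpace (V x)]
  [FiberBundle F V] [VectorBundle ℝ F V] [ContMDiffVectorBundle ∞ F V (𝓡 n)]

theorem stdDuality_transpose_apply (N : BundleMap n F V F V)
    (α : Cₛ^∞⟮𝓡 n; F →L[ℝ] ℝ, Dual V⟯) (x : M) :
    (stdDuality n F V).transpose N α x = (α x).comp (N.toFun x) := by
  ext v
  obtain ⟨X, rfl⟩ := exists_section_eq (n := n) (F := F) x v
  exact congrArg (fun f : C^∞⟮𝓡 n, M; ℝ⟯ => f x) ((stdDuality n F V).pairing_transpose N α X)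

namespace JacobiQuasiNijenhuis

variable {J : JacobiQuasiNijenhuis n F V} {ψ : ThreeForm n F V}

theorem mem_graph_iff {x : M} {u : (Dual V ×ᵇ V) x × (Dual V ×ᵇ V) x} :
    u ∈ J.graph x ↔ u.1.2 = J.N.toFun x u.2.2 ∧ u.2.1 = u.1.1.comp (J.N.toFun x) := by
  constructor
  · rintro ⟨a, α, rfl⟩
    exact ⟨rfl, rfl⟩
  · rintro ⟨h1, h2⟩
    exact ⟨u.2.2, u.1.1, Prod.ext (Prod.ext rfl h1) (Prod.ext h2 rfl)⟩

theorem twistedDouble_pairing (x : M) (u v : (Dual V ×ᵇ V) x) :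
    (J.twistedDouble ψ).pairing x u v = 1 / 2 * (u.1 v.2 + v.1 u.2) := rfl

theorem double_pairing (x : M) (u v : (Dual V ×ᵇ V) x) :
    J.double.pairing x u v = 1 / 2 * (u.1 v.2 + v.1 u.2) := rfl

theorem diffPairing_eq_zero_of_mem {x : M} {u v : (Dual V ×ᵇ V) x × (Dual V ×ᵇ V) x}
    (hu : u ∈ J.graph x) (hv : v ∈ J.graph x) :
    CourantJacobiData.diffPairing (J.twistedDouble ψ) J.double x x u v = 0 := by
  obtain ⟨a, α, rfl⟩ := hu
  obtain ⟨b, β, rfl⟩ := hv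
  rw [CourantJacobiData.diffPairing, twistedDouble_pairing, double_pairing]
  simp

/-- The orthogonal of the graph is contained in the graph: testing against the elements with `a = 0`
and with `α = 0` gives its two defining equations. This yields maximality without a dimension count,
and also places the terms `(ρ*ω, ρ'*ω)` in the graph. -/
theorem mem_graph_of_diffPairing {x : M} {u : (Dual V ×ᵇ V) x × (Dual V ×ᵇ V) x}
    (h : ∀ v ∈ J.graph x,
      CourantJacobiData.diffPairing (J.twistedDouble ψ) J.double x x u v = 0) :
    u ∈ J.graph x := by
  have h' : ∀ (c : V x) (γ : Dual V x), u.1.1 (J.N.toFun x c) + γ u.1.2 =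
      u.2.1 c + γ (J.N.toFun x u.2.2) := fun c γ => by
    have := h _ ⟨c, γ, rfl⟩
    rw [CourantJacobiData.diffPairing, twistedDouble_pairing, double_pairing] at this
    have e : γ.comp (J.N.toFun x) u.2.2 = γ (J.N.toFun x u.2.2) := rfl
    simp only [e] at this
    linarith
  refine mem_graph_iff.2 ⟨sub_eq_zero.1 ((stdDuality n F V).separating_right x _ fun γ => ?_), ?_⟩
  · have := h' 0 γ
    simp only [map_zero, zero_add] at this
    rw [map_sub, sub_eq_zero]
    exact this
  · ext c
    have := h' c 0
    simpa using this.symm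

theorem anchor_of_mem {x : M} {u : (Dual V ×ᵇ V) x × (Dual V ×ᵇ V) x} (hu : u ∈ J.graph x) :
    (J.twistedDouble ψ).anchor.toFun x u.1 = J.double.anchor.toFun x u.2 := by
  obtain ⟨a, α, rfl⟩ := hu
  obtain ⟨α, rfl⟩ := exists_section_eq (n := n) (F := F →L[ℝ] ℝ) x α
  have h := congrArg (fun s : Cₛ^∞⟮𝓡 n; F, V⟯ => s x) (J.map_sharp α)
  have h' : J.N.toFun x (J.bivector.sharp.toFun x (α x)) =
      J.bivector.sharp.toFun x ((α x).comp (J.N.toFun x)) := by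
    rw [← stdDuality_transpose_apply]; exact h
  change J.alg.anchor.toFun x (J.N.toFun x (J.bivector.sharp.toFun x (α x)))
    + J.alg.anchor.toFun x (J.N.toFun x a) = J.alg.anchor.toFun x (J.bivector.sharp.toFun x
      ((α x).comp (J.N.toFun x))) + J.alg.anchor.toFun x (J.N.toFun x a)
  rw [h']

theorem theta_of_mem {x : M} {u : (Dual V ×ᵇ V) x × (Dual V ×ᵇ V) x} (hu : u ∈ J.graph x) :
    (J.twistedDouble ψ).theta x u.1 = J.double.theta x u.2 := by
  obtain ⟨a, α, rfl⟩ := hu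
  change α (- J.N.toFun x (J.bivector.sharp.toFun x (J.alg.form x)))
      + J.alg.form x (J.N.toFun x a) =
    α (J.N.toFun x (- J.bivector.sharp.toFun x (J.alg.form x)))
      + (stdDuality n F V).transpose J.N J.alg.form x a
  rw [stdDuality_transpose_apply, map_neg (J.N.toFun x)]
  rfl

theorem finrank_graph (x : M) :
    Module.finrank ℝ (J.graph x) = Module.finrank ℝ (F × (F →L[ℝ] ℝ)) := by
  let l : (V x × Dual V x) →ₗ[ℝ] ((Dual V ×ᵇ V) x × (Dual V ×ᵇ V) x) :=
    { toFun := fun u => ((u.2, J.N.toFun x u.1), (u.2.comp (J.N.toFun x), u.1))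
      map_add' := fun u v => by simp
      map_smul' := fun c u => by simp }
  have hl : Function.Injective l := fun u v h =>
    Prod.ext (congrArg (fun w => w.2.2) h) (congrArg (fun w => w.1.1) h)
  have hr : LinearMap.range l = J.graph x := by
    ext u
    constructor
    · rintro ⟨v, rfl⟩
      exact ⟨v.1, v.2, rfl⟩
    · rintro ⟨a, α, rfl⟩
      exact ⟨(a, α), rfl⟩
  rw [← hr, LinearMap.finrank_range_of_inj hl]
  exact ((VectorBundle.continuousLinearEquivAt ℝ F V x).toLinearEquiv.prodCongr
    (VectorBundle.continuousLinearEquivAt ℝ (F →L[ℝ] ℝ) (Dual V) x).toLinearEquiv).finrank_eq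

/-- Sections of the graph are parametrized by smooth `α` and `X`, because these are components of
the given sections; the two bracket identities then apply. -/
theorem bracket_mem_graph (h : J.threeForm = ψ.pullback J.N)
    (S S' T T' : Cₛ^∞⟮𝓡 n; (F →L[ℝ] ℝ) × F, Dual V ×ᵇ V⟯) (hS : ∀ x, (S x, S' x) ∈ J.graph x)
    (hT : ∀ x, (T x, T' x) ∈ J.graph x) (x : M) :
    ((J.twistedDouble ψ).bracket S T x, J.double.bracket S' T' x) ∈ J.graph x := by
  have key : ∀ S S' : Cₛ^∞⟮𝓡 n; (F →L[ℝ] ℝ) × F, Dual V ×ᵇ V⟯, (∀ x, (S x, S' x) ∈ J.graph x) →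
      ∃ α X, components S = (α, J.N.map X) ∧
        components S' = ((stdDuality n F V).transpose J.N α, X) := fun S S' hS => by
    refine ⟨(components S).1, (components S').2, Prod.ext rfl ?_, Prod.ext ?_ rfl⟩
    · ext x
      exact (mem_graph_iff.1 (hS x)).1
    · ext x : 1
      rw [stdDuality_transpose_apply]
      exact (mem_graph_iff.1 (hS x)).2
  obtain ⟨α, X, hS1, hS2⟩ := key S S' hS
  obtain ⟨β, Y, hT1, hT2⟩ := key T T' hT
  have h1 : components ((J.twistedDouble ψ).bracket S T) = _ := components_bracket _ _ _ S T
  have h2 : components (J.double.bracket S' T') = _ := components_bracket _ _ _ S' T'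
  rw [hS1, hT1] at h1
  rw [hS2, hT2] at h2
  have h3 := doubleBracket_snd h α β X Y
  have h4 := doubleBracket_fst h α β X Y
  rw [← h1, ← h2] at h3 h4
  refine mem_graph_iff.2 ⟨congrArg (fun s : Cₛ^∞⟮𝓡 n; F, V⟯ => s x) h3, ?_⟩
  have h5 := congrArg (fun s : Cₛ^∞⟮𝓡 n; F →L[ℝ] ℝ, Dual V⟯ => s x) h4
  simp only [stdDuality_transpose_apply] at h5
  exact h5

theorem graph_isCourantJacobiMorphism (hψ : J.alg.IsClosed ψ) (h : J.threeForm = ψ.pullback J.N) :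
    IsCourantJacobiMorphism (J.twistedDouble ψ) J.double ContMDiffMap.id J.graph where
  left := twistedDouble_isCourantJacobi h hψ
  right := J.double_isCourantJacobi
  rank_locally_constant x₀ := Filter.Eventually.of_forall fun x =>
    (finrank_graph x).trans (finrank_graph x₀).symm
  exists_section x₀ u hu := by
    obtain ⟨a, α, rfl⟩ := hu
    obtain ⟨X, rfl⟩ := exists_section_eq (n := n) (F := F) x₀ a
    obtain ⟨α, rfl⟩ := exists_section_eq (n := n) (F := F →L[ℝ] ℝ) x₀ α
    -- Extending `a` and `α` to global sections gives a single term with coefficient `1`, whose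
    -- value on the diagonal lies in the graph everywhere.
    let s : ProdSection n ((F →L[ℝ] ℝ) × F) (Dual V ×ᵇ V) n ((F →L[ℝ] ℝ) × F) (Dual V ×ᵇ V) :=
      ⟨1, fun _ => 1, fun _ => directSum α (J.N.map X),
        fun _ => directSum ((stdDuality n F V).transpose J.N α) X⟩
    have hs : ∀ x, s.value x x =
        ((α x, J.N.toFun x (X x)), ((α x).comp (J.N.toFun x), X x)) := fun x => by
      rw [← stdDuality_transpose_apply]
      exact (Fin.sum_univ_one _).trans (one_smul ℝ _)
    exact ⟨s, hs x₀, Filter.Eventually.of_forall fun x => ⟨X x, α x, hs x⟩⟩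
  isotropic x u hu v hv := diffPairing_eq_zero_of_mem hu hv
  maximal x K hK hLK := le_antisymm
    (fun u hu => mem_graph_of_diffPairing fun v hv => hK u hu v (hLK hv)) hLK
  anchor x u hu := by
    refine ⟨?_, theta_of_mem hu⟩
    have h1 : mfderiv (𝓡 n) (𝓡 n) (ContMDiffMap.id : C^∞⟮𝓡 n, M; 𝓡 n, M⟯) x =
      ContinuousLinearMap.id ℝ (TangentSpace (𝓡 n) x) := mfderiv_id
    rw [h1]
    exact anchor_of_mem hu
  closed s t hs ht x := CourantJacobiData.prodBracket_diag_mem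
    (twistedDouble_isCourantJacobi h hψ) J.double_isCourantJacobi
    (fun _ _ => mem_graph_of_diffPairing) (fun _ _ => anchor_of_mem) (bracket_mem_graph h)
    s t hs ht x

end JacobiQuasiNijenhuis
end Main

end JQN

end

theorem mainTheorem3 {n : ℕ} {M : Type*} [TopologicalSpace M] [T2Space M] [SigmaCompactSpace M]
    [ChartedSpace (EuclideanSpace ℝ (Fin n)) M] [IsManifold (𝓡 n) ∞ M]
    {F : Type*} [NormedAddCommGroup F] [NormedSpace ℝ F] [FiniteDimensional ℝ F]
    {V : M → Type*} [TopologicalSpace (TotalSpace F V)]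
    [∀ x, AddCommGroup (V x)] [∀ x, Module ℝ (V x)] [∀ x, TopologicalSpace (V x)]
    [FiberBundle F V] [VectorBundle ℝ F V] [ContMDiffVectorBundle ∞ F V (𝓡 n)]
    (J : JQN.JacobiQuasiNijenhuis n F V) (ψ : JQN.ThreeForm n F V) (hψ : J.alg.IsClosed ψ)
    (h : J.threeForm = ψ.pullback J.N) :
    JQN.IsCourantJacobiMorphism (J.twistedDouble ψ) J.double ContMDiffMap.id J.graph :=
  JQN.JacobiQuasiNijenhuis.graph_isCourantJacobiMorphism hψ h
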